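/- Let $\alpha\in(0,1)$ and $\mu>-1$. There is a constant $c>0$, depending only on $\alpha$ and $\mu$, such that the following holds. Setting. Let $d\in\{1,2\}$, let $\Omega\subset\mathbb R^d$ be a bounded domain, and write $(\cdot,\cdot)$, $\|\cdot\|$ for the inner product and norm of $L^2(\Omega)$. Let $Av=-\sum_{i,j}\partial_i(a_{ij}\partial_j v)+c_0v$ be a self-adjoint, uniformly elliptic, positive definite operator with bounded measurable coefficients and homogeneous Dirichlet boundary condition, with bilinear form $A(v,w)=\int_\Omega\big(\sum_{i,j} a_{ij}\,\partial_jv\,\partial_iw+c_0vw\big)\,dx$. Let $\mathcal T_h$ be a conforming finite simplicial mesh with simplices contained in $\overline\Omega$ (for polygonal $\Omega$, in particular, a triangulation of $\overline\Omega$), and let $X_h\subset H^1_0(\Omega)$ be the space of continuous functions that are affine on each simplex and vanish outside the mesh and outside $\Omega$. Let $P_h:L^2(\Omega)\to X_h$ be the $L^2$-projection and $A_h:X_h\to X_h$ the operator with $(A_h\varphi,\psi)=A(\varphi,\psi)$ for $\varphi,\psi\in X_h$. Data. Let $T>0$, $u^0\in L^2(\Omega)$, and $$f(t)=(t^\mu*g)(t)=\int_0^t(t-s)^\mu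 g(s)\,ds ,$$ where $g\in W^{1,\infty}(0,T;L^2(\Omega))$ has a second weak derivative $g''$ with $$\int_0^t(t-\zeta)^{\min(\alpha+\mu,0)}\|g''(\zeta)\|\,d\zeta<\infty\qquad\text{for all }t\in(0,T];$$ $g$ and $g'$ are identified with their continuous representatives on $[0,T]$. Semidiscrete problem. Let $u_h:[0,T]\to X_h$ be absolutely continuous with $u_h(0)=P_hu^0$ and, for almost every $t\in(0,T]$, $$\frac1{\Gamma(1-\alpha)}\int_0^t(t-\zeta)^{-\alpha}u_h'(\zeta)\,d\zeta+A_hu_h(t)=P_hf(t).$$ Scheme CN-I. Let $N\ge1$, $\tau=T/N$, $t_n=n\tau$, $F_h(t)=\int_0^tP_hf(s)\,ds$, $\sigma_0=1$, $\sigma_j=\big(1-\frac{\alpha+1}{j}\big)\sigma_{j-1}$ for $j\ge1$, and let $p(t)=t^{2-\alpha}/\Gamma(3-\alpha)$ for $t>0$, $p(t)=0$ for $t\le0$. Put $D_\tau w(t)=\tau^{-1}\big(\tfrac32w(t)-2w(t-\tau)+\tfrac12w(t-2\tau)\big)$. Let $\tilde U_h^n,\tilde u_h^n\in X_h$ satisfy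 $\tilde U_h^k=0$ for $k\le0$ and, for $1\le n\le N$, $$\tau^{-\alpha}\sum_{j=0}^n\sigma_j\tilde U_h^{n-j}+\big(1-\tfrac\alpha2\big)A_h\tilde U_h^n+\tfrac\alpha2A_h\tilde U_h^{n-1}=\big(1-\tfrac\alpha2\big)\big(F_h(t_n)+D_\tau p(t_n)\,u_h(0)\big)+\tfrac\alpha2\big(F_h(t_{n-1})+D_\tau p(t_{n-1})\,u_h(0)\big),$$ $$\tilde u_h^n=\tfrac1\tau\big(\tfrac32\tilde U_h^n-2\tilde U_h^{n-1}+\tfrac12\tilde U_h^{n-2}\big).$$ Conclusion. For all $1\le n\le N$, $$\|u_h(t_n)-\tilde u_h^n\|\le c\,\tau^2\Big(t_n^{-2}\|u^0\|+t_n^{\alpha+\mu-1}\|g(0)\|+t_n^{\alpha+\mu}\|g'(0)\|+\int_0^{t_n}(t_n-\zeta)^{\alpha+\mu}\|g''(\zeta)\|\,d\zeta\Big).$$ -/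

import Mathlib

open MeasureTheory Set

noncomputable section

namespace SubDiffusion

/-! ### Space: the domain, the elliptic operator, the finite element space -/

/-- Euclidean space `ℝ^d`. -/
abbrev Space (d : ℕ) : Type := EuclideanSpace ℝ (Fin d)

/-- The real Hilbert space `L²(Ω)`. -/
abbrev L2 {d : ℕ} (Ω : Set (Space d)) : Type := Lp ℝ 2 (volume.restrict Ω)

/-- The partial derivative `∂ᵢ v`. For Lipschitz `v` it exists almost everywhere
(Rademacher) and is the weak partial derivative of `v`. -/
def partialDeriv {d : ℕ} (i : Fin d) (v : Space d → ℝ) (x : Space d) : ℝ :=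
  fderiv ℝ v x (EuclideanSpace.single i 1)

/-- The bilinear form `A(v, w) = ∫_Ω (∑ᵢⱼ aᵢⱼ ∂ⱼv ∂ᵢw + c v w) dx` of the second-order operator
`A v = -∑ᵢⱼ ∂ᵢ(aᵢⱼ ∂ⱼ v) + c v`. -/
def ellipticForm {d : ℕ} (Ω : Set (Space d)) (a : Space d → Matrix (Fin d) (Fin d) ℝ)
    (c : Space d → ℝ) (v w : Space d → ℝ) : ℝ :=
  ∫ x in Ω, ((∑ i, ∑ j, a x i j * partialDeriv j v x * partialDeriv i w x) + c x * v x * w x)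

/-- A self-adjoint positive definite second-order elliptic operator
`A v = -∑ᵢⱼ ∂ᵢ(aᵢⱼ ∂ⱼ v) + c v` on `Ω` with homogeneous Dirichlet boundary condition.
The zero order coefficient may change sign as long as the operator is positive definite.
The Lipschitz functions on `ℝ^d` that vanish outside a bounded `Ω` lie in `H¹₀(Ω)`, and they
are dense there since they include the test functions; so `posDef` is
`A(v, v) ≥ κ ‖v‖²` on `H¹₀(Ω)`. -/
structure EllipticOperator {d : ℕ} (Ω : Set (Space d)) where
  a : Space d → Matrix (Fin d) (Fin d) ℝ
  c : Space d → ℝ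
  measurable_a : ∀ i j, AEMeasurable (fun x => a x i j) (volume.restrict Ω)
  measurable_c : AEMeasurable c (volume.restrict Ω)
  bounded : ∃ M : ℝ, ∀ᵐ x ∂(volume.restrict Ω), (∀ i j, |a x i j| ≤ M) ∧ |c x| ≤ M
  symm : ∀ᵐ x ∂(volume.restrict Ω), (a x).IsSymm
  elliptic : ∃ κ : ℝ, 0 < κ ∧ ∀ᵐ x ∂(volume.restrict Ω), ∀ ξ : Fin d → ℝ,
    κ * ∑ i, ξ i ^ 2 ≤ ∑ i, ∑ j, a x i j * ξ j * ξ i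
  posDef : ∃ κ : ℝ, 0 < κ ∧ ∀ v : Space d → ℝ, (∃ K, LipschitzWith K v) →
    (∀ x, x ∉ Ω → v x = 0) → κ * ∫ x in Ω, v x ^ 2 ≤ ellipticForm Ω a c v v

/-- The bilinear form `A(·,·)` associated with the elliptic operator. -/
def EllipticOperator.form {d : ℕ} {Ω : Set (Space d)} (A : EllipticOperator Ω)
    (v w : Space d → ℝ) : ℝ :=
  ellipticForm Ω A.a A.c v w

/-- A conforming mesh of `Ω`: finitely many nondegenerate simplices, any two of which meet in a
common face or not at all, contained in the closure of `Ω`. The union of the simplices need not be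
all of `closure Ω`, so that a triangulation of a polygonal `Ω` and a triangulation of a polygonal
domain inscribed in a curved `Ω` are both allowed. -/
structure Mesh {d : ℕ} (Ω : Set (Space d)) where
  complex : Geometry.SimplicialComplex ℝ (Space d)
  finite : complex.faces.Finite
  space_subset : complex.space ⊆ closure Ω

theorem Mesh.isCompact_space {d : ℕ} {Ω : Set (Space d)} (𝒯 : Mesh Ω) :
    IsCompact 𝒯.complex.space :=
  𝒯.finite.isCompact_biUnion fun s _ => s.finite_toSet.isCompact_convexHull ℝ

/-- The finite element space `X_h ⊂ H¹₀(Ω)`: the continuous functions that are affine on every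
simplex of the mesh and vanish outside of it and outside `Ω`. A continuous function of this kind
has finitely many affine pieces, so it is Lipschitz. -/
def femSpace {d : ℕ} {Ω : Set (Space d)} (𝒯 : Mesh Ω) : Submodule ℝ (Space d → ℝ) where
  carrier := {φ | (∃ K, LipschitzWith K φ) ∧
    (∀ s ∈ 𝒯.complex.faces, ∃ L : Space d →ᵃ[ℝ] ℝ, ∀ x ∈ convexHull ℝ (s : Set (Space d)),
      φ x = L x) ∧
    (∀ x, x ∉ 𝒯.complex.space → φ x = 0) ∧ (∀ x, x ∉ Ω → φ x = 0)}
  add_mem' := by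
    rintro φ ψ ⟨⟨K, hK⟩, h2, h3, h4⟩ ⟨⟨K', hK'⟩, k2, k3, k4⟩
    refine ⟨⟨K + K', hK.add hK'⟩, fun s hs => ?_, fun x hx => ?_, fun x hx => ?_⟩
    · obtain ⟨L, hL⟩ := h2 s hs
      obtain ⟨L', hL'⟩ := k2 s hs
      exact ⟨L + L', fun x hx => by simp [hL x hx, hL' x hx]⟩
    · simp [h3 x hx, k3 x hx]
    · simp [h4 x hx, k4 x hx]
  zero_mem' := ⟨⟨0, LipschitzWith.const 0⟩, fun _ _ => ⟨0, fun _ _ => by simp⟩,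
    fun _ _ => rfl, fun _ _ => rfl⟩
  smul_mem' := by
    rintro r φ ⟨⟨K, hK⟩, h2, h3, h4⟩
    refine ⟨⟨‖r‖₊ * K, ?_⟩, fun s hs => ?_, fun x hx => ?_, fun x hx => ?_⟩
    · exact (lipschitzWith_smul r).comp hK
    · obtain ⟨L, hL⟩ := h2 s hs
      exact ⟨r • L, fun x hx => by simp [hL x hx]⟩
    · simp [h3 x hx]
    · simp [h4 x hx]

theorem memLp_of_mem_femSpace {d : ℕ} {Ω : Set (Space d)} {𝒯 : Mesh Ω} {φ : Space d → ℝ}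
    (hφ : φ ∈ femSpace 𝒯) : MemLp φ 2 (volume.restrict Ω) := by
  obtain ⟨⟨K, hK⟩, -, h3, -⟩ := hφ
  have hc : HasCompactSupport φ := HasCompactSupport.intro 𝒯.isCompact_space h3
  exact (hK.continuous.memLp_of_hasCompactSupport (μ := volume) hc).restrict Ω

/-- The embedding `X_h → L²(Ω)`. -/
def toL2 {d : ℕ} {Ω : Set (Space d)} {𝒯 : Mesh Ω} : femSpace 𝒯 →ₗ[ℝ] L2 Ω where
  toFun φ := (memLp_of_mem_femSpace φ.2).toLp φ
  map_add' _ _ := rfl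
  map_smul' _ _ := rfl

/-- `v = P_h w`, the `L²`-projection: `(v, χ) = (w, χ)` for all `χ ∈ X_h`. -/
def IsL2Projection {d : ℕ} {Ω : Set (Space d)} {𝒯 : Mesh Ω} (v : femSpace 𝒯) (w : L2 Ω) : Prop :=
  ∀ χ : femSpace 𝒯, inner ℝ (toL2 v) (toL2 χ) = inner ℝ w (toL2 χ)

/-! ### Time: Caputo derivative, convolution, weak derivatives -/

section Time

variable {X : Type*} [NormedAddCommGroup X] [NormedSpace ℝ X]

/-- The left Caputo derivative of order `α`,
`(1 / Γ(1-α)) ∫₀ᵗ (t-ζ)^(-α) v'(ζ) dζ`. -/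
def caputoDeriv (α : ℝ) (v : ℝ → X) (t : ℝ) : X :=
  (1 / Real.Gamma (1 - α)) • ∫ ζ in (0 : ℝ)..t, (t - ζ) ^ (-α) • deriv v ζ

/-- `v` is absolutely continuous on `[0, T]` (as the integral of its derivative). -/
def IsAbsCont (T : ℝ) (v : ℝ → X) : Prop :=
  IntervalIntegrable (deriv v) volume 0 T ∧
    ∀ t ∈ Icc 0 T, v t = v 0 + ∫ ζ in (0 : ℝ)..t, deriv v ζ

/-- The time convolution `(t^μ * g)(t) = ∫₀ᵗ (t-s)^μ g(s) ds`. -/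
def powConv (μ : ℝ) (g : ℝ → X) (t : ℝ) : X :=
  ∫ s in (0 : ℝ)..t, (t - s) ^ μ • g s

/-- `g'` is the weak derivative of `g` on the interval `(0, T)`. -/
def HasWeakDeriv (T : ℝ) (g g' : ℝ → X) : Prop :=
  LocallyIntegrableOn g (Ioo 0 T) ∧ LocallyIntegrableOn g' (Ioo 0 T) ∧
    ∀ φ : ℝ → ℝ, ContDiff ℝ (⊤ : ℕ∞) φ → HasCompactSupport φ → tsupport φ ⊆ Ioo 0 T →
      ∫ t in Ioo 0 T, deriv φ t • g t = -∫ t in Ioo 0 T, φ t • g' t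

/-- `g ∈ W^{1,∞}(0, T; X)` with weak derivative `g'`. -/
def IsW1Inf (T : ℝ) (g g' : ℝ → X) : Prop :=
  MemLp g ⊤ (volume.restrict (Ioo 0 T)) ∧ MemLp g' ⊤ (volume.restrict (Ioo 0 T)) ∧
    HasWeakDeriv T g g'

end Time

/-! ### The semidiscrete problem and the Crank-Nicolson scheme -/

/-- `u` solves the semidiscrete problem `D^α u + A_h u = P_h f` on `(0, T]`, `u(0) = P_h u⁰`, that
is, `(D^α u(t), χ) + A(u(t), χ) = (f(t), χ)` for all `χ ∈ X_h`. Here `u` is absolutely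
continuous in time and the equation holds for almost every `t`. -/
structure IsSemidiscreteSolution {d : ℕ} {Ω : Set (Space d)} (A : EllipticOperator Ω)
    {𝒯 : Mesh Ω} (α T : ℝ) (u0 : L2 Ω) (f : ℝ → L2 Ω) (u : ℝ → femSpace 𝒯) : Prop where
  absCont : IsAbsCont T fun t => toL2 (u t)
  initial : IsL2Projection (u 0) u0
  eqn : ∀ᵐ t ∂(volume.restrict (Ioc 0 T)), ∀ χ : femSpace 𝒯,
    inner ℝ (caputoDeriv α (fun s => toL2 (u s)) t) (toL2 χ) + A.form (u t) χ
      = inner ℝ (f t) (toL2 χ)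

/-- The Grünwald-Letnikov coefficients: `σ₀ = 1`, `σⱼ = (1 - (α+1)/j) σⱼ₋₁`. -/
def glCoeff (α : ℝ) : ℕ → ℝ
  | 0 => 1
  | j + 1 => (1 - (α + 1) / ((j : ℝ) + 1)) * glCoeff α j

/-- The function `t^(2-α) / Γ(3-α)`, prescribed by zero for `t ≤ 0`. -/
def startFun (α t : ℝ) : ℝ :=
  if t ≤ 0 then 0 else t ^ (2 - α) / Real.Gamma (3 - α)

/-- The second-order BDF operator `D_τ w(t) = τ⁻¹ (3/2 w(t) - 2 w(t-τ) + 1/2 w(t-2τ))`. -/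
def bdf2 (τ : ℝ) (w : ℝ → ℝ) (t : ℝ) : ℝ :=
  τ⁻¹ * (3 / 2 * w t - 2 * w (t - τ) + 1 / 2 * w (t - 2 * τ))

/-- `U` (the values `Ũ^n`) and `ut` (the values `ũ^n`) satisfy the Crank-Nicolson scheme with time
step `τ` and `N` steps, initial value `uh0`, source `f` with primitive `F(t) = ∫₀ᵗ f`: for
`1 ≤ n ≤ N`, in `X_h`,

`τ^(-α) ∑_{j=0}^n σⱼ U^{n-j} + (1-α/2) A_h U^n + (α/2) A_h U^{n-1}
  = (1-α/2) P_h F(t_n) + (α/2) P_h F(t_{n-1})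
    + (1-α/2) D_τ(t^{2-α}/Γ(3-α))(t_n) uh0 + (α/2) D_τ(t^{2-α}/Γ(3-α))(t_{n-1}) uh0`,

`ut^n = τ⁻¹ (3/2 U^n - 2 U^{n-1} + 1/2 U^{n-2})`,

with `U^k = 0` for `k ≤ 0`. The first equation is written tested with every `χ ∈ X_h`, where
`(A_h v, χ) = A(v, χ)` and `(P_h w, χ) = (w, χ)`. -/
structure IsCrankNicolsonSolution {d : ℕ} {Ω : Set (Space d)} (A : EllipticOperator Ω)
    {𝒯 : Mesh Ω} (α τ : ℝ) (N : ℕ) (uh0 : femSpace 𝒯) (f : ℝ → L2 Ω)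
    (U : ℤ → femSpace 𝒯) (ut : ℕ → femSpace 𝒯) : Prop where
  start : ∀ k : ℤ, k ≤ 0 → U k = 0
  step : ∀ n : ℕ, 1 ≤ n → n ≤ N → ∀ χ : femSpace 𝒯,
    τ ^ (-α) * inner ℝ
        (toL2 (∑ j ∈ Finset.range (n + 1), glCoeff α j • U ((n : ℤ) - (j : ℤ)))) (toL2 χ)
      + (1 - α / 2) * A.form (U n) χ + α / 2 * A.form (U ((n : ℤ) - 1)) χ
    = (1 - α / 2) * inner ℝ (∫ s in (0 : ℝ)..((n : ℝ) * τ), f s) (toL2 χ)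
      + α / 2 * inner ℝ (∫ s in (0 : ℝ)..(((n : ℝ) - 1) * τ), f s) (toL2 χ)
      + (1 - α / 2) * bdf2 τ (startFun α) ((n : ℝ) * τ) * inner ℝ (toL2 uh0) (toL2 χ)
      + α / 2 * bdf2 τ (startFun α) (((n : ℝ) - 1) * τ) * inner ℝ (toL2 uh0) (toL2 χ)
  recover : ∀ n : ℕ, 1 ≤ n → n ≤ N →
    ut n = τ⁻¹ • ((3 / 2 : ℝ) • U n - (2 : ℝ) • U ((n : ℤ) - 1)
      + (1 / 2 : ℝ) • U ((n : ℤ) - 2))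

end SubDiffusion

end

open SubDiffusion

/-!
The error is a sum over the eigenvectors of the discrete elliptic operator, and each component is
estimated uniformly in its eigenvalue.

*Diagonalization.* The form `A` is symmetric and positive on the finite dimensional finite element
space, so there is an `L²`-orthonormal basis of eigenvectors with eigenvalues `l ≥ 0`
(`exists_fem_eigenvectors`). Along an eigenvector the semidiscrete problem is the scalar equation
`D^α y + l y = f`, and the scheme is the same Crank-Nicolson recursion with a number `l` in place of
`A_h`. Nothing is known about `l` from above, so every constant has to be independent of it.

*Exact component.* With the kernels `t^(b-1) / Γ(b)` (`fracKernel`), Taylor's formula writes `g`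
through `g(0)`, `g'(0)` and a convolution with `g''`. The component of the solution is then a linear
combination of Mittag-Leffler kernels `relaxKernel`, whose Laplace transform is
`z^(-a) / (z^α + l)` (`exactSymbol`): `relaxKernel α l (1 - α)` multiplies the initial value and the
kernels with `a = μ + 2` and `a = μ + 3` multiply the data of `g`. This formula is derived by
convolving the equation with the resolvent kernel (`eq_relaxKernel_of_caputo_eq`), which also covers
solutions that are only absolutely continuous. The classical Taylor formula is available because a
continuous function with an integrable weak derivative is a primitive of it
(`HasWeakDeriv.eq_add_integral`).

*Discrete component.* Generating power series solve the recursion (`scheme_eq_sum`). The result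
satisfies the formula of the exact component with `discreteKernel` in place of `relaxKernel`; here
`discreteKernel` is a sum of shifts of the primitive `t^(b-1) / Γ(b)` that the scheme samples. As a
function of continuous time its Laplace transform is `z^(-b) G(e^(-z))` (`discreteSymbol`) with the
generating function
`G(ζ) = (3/2 - 2ζ + ζ²/2)^i (1 - α/2 + αζ/2) / ((1 - ζ)^α + l (1 - α/2 + αζ/2))`. The same function
`discreteKernel` serves all sources, so the integral term with `g''` needs no quadrature estimate.

*Uniformity in the eigenvalue.* For `|ζ| < 1` the numbers `(1 - ζ)^α` and `1 - α/2 + αζ/2` lie on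
opposite sides of the real axis, the first in the sector `|arg| < α π / 2`, the second in the right
half plane.
Hence they cannot cancel, and the denominator of `G` is at least a constant times
`|1 - ζ|^α + l` (`sector_lower_bound`). The weights `1 - α/2`, `α/2` make the scheme consistent of
second order, and on the strip `|Im z| ≤ π` the two symbols differ by
`O(|z|^(i - b - α + 2))` uniformly in `l` (`exists_norm_discreteSymbol_sub_exactSymbol_le`).

*Inversion.* Three derivatives of the transform make the inversion integral absolutely convergent at
the price of a factor `t³` (`laplace_inversion`). On the line `Re z = 1/s` the difference of the
symbols is integrated period by period, the factor `e^(-z)` being periodic and `z^(-b)` giving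
convergence of the sum over the periods (`integral_le_of_periods`,
`exists_integral_norm_iteratedDeriv_sub_le`). The result is the bound `C s^(α + b - i - 3)` for the
difference of the kernels at time `s ≥ 1` with unit step (`exists_abs_discreteKernel_sub_le`). For
the sources, `i = 1`, the same bound holds for `s ≤ 1`, where both kernels are bounded directly
(`exists_abs_discreteKernel_one_sub_le`). Scaling time by `τ` and the eigenvalue by `τ^α` then
produces the factor `τ²` (`exists_abs_errorKernel_le`, `exists_abs_startError_le`). The initial
value needs the bound at the grid points only, that is, for `s ≥ 1`.

*Summation.* The error is tested with itself. By the Cauchy-Schwarz and Bessel inequalities the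
uniform bounds on the components carry over to the norm in `L²` without any dependence on the mesh
(`abs_sum_mul_inner_le`, `abs_sum_mul_integral_inner_le`).
-/

noncomputable section

open Filter Topology

namespace SubDiffusion

/-! ### Complex powers near the right half plane -/

theorem arg_abs_lt_of_re_pos {x : ℂ} (hx : 0 < x.re) : |x.arg| < Real.pi / 2 :=
  Complex.abs_arg_lt_pi_div_two_iff.2 (Or.inl hx)

theorem ne_zero_of_re_pos {x : ℂ} (hx : 0 < x.re) : x ≠ 0 := by
  rintro rfl; simp at hx

theorem arg_add_arg_mem_of_re_pos {x y : ℂ} (hx : 0 < x.re) (hy : 0 < y.re) :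
    x.arg + y.arg ∈ Ioo (-Real.pi) Real.pi := by
  have h1 := abs_lt.1 (arg_abs_lt_of_re_pos hx)
  have h2 := abs_lt.1 (arg_abs_lt_of_re_pos hy)
  constructor <;> linarith [h1.1, h1.2, h2.1, h2.2]

theorem mul_cpow_of_re_pos {x y : ℂ} (hx : 0 < x.re) (hy : 0 < y.re) (s : ℂ) :
    (x * y) ^ s = x ^ s * y ^ s := by
  have hx0 := ne_zero_of_re_pos hx
  have hy0 := ne_zero_of_re_pos hy
  rw [Complex.cpow_def_of_ne_zero (mul_ne_zero hx0 hy0), Complex.cpow_def_of_ne_zero hx0,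
    Complex.cpow_def_of_ne_zero hy0, (Complex.log_mul_eq_add_log_iff hx0 hy0).2
      (Ioo_subset_Ioc_self (arg_add_arg_mem_of_re_pos hx hy)), add_mul, Complex.exp_add]

theorem mul_mem_slitPlane_of_re_pos {x y : ℂ} (hx : 0 < x.re) (hy : 0 < y.re) :
    x * y ∈ Complex.slitPlane := by
  have hx0 := ne_zero_of_re_pos hx
  have hy0 := ne_zero_of_re_pos hy
  have h := arg_add_arg_mem_of_re_pos hx hy
  rw [Complex.mem_slitPlane_iff_arg, Complex.arg_mul hx0 hy0 (Ioo_subset_Ioc_self h)]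
  exact ⟨h.2.ne, mul_ne_zero hx0 hy0⟩

theorem one_add_re_pos {u : ℂ} (hu : ‖u‖ < 1) : 0 < (1 + u).re := by
  have := (abs_le.1 (Complex.abs_re_le_norm u)).1
  simp only [Complex.add_re, Complex.one_re]; linarith

theorem norm_one_add_cpow_sub_one_le {α : ℝ} (h0 : 0 ≤ α) (h1 : α ≤ 1) {u : ℂ}
    (hu : ‖u‖ ≤ 1 / 2) : ‖(1 + u) ^ (α : ℂ) - 1‖ ≤ 3 * ‖u‖ := by
  have hne := ne_zero_of_re_pos (one_add_re_pos (hu.trans_lt (by norm_num)))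
  have hl := Complex.norm_log_one_add_half_le_self hu
  have hx : ‖Complex.log (1 + u) * α‖ ≤ 3 / 2 * ‖u‖ := by
    rw [norm_mul, Complex.norm_real, Real.norm_of_nonneg h0]
    exact (mul_le_of_le_one_right (norm_nonneg _) h1).trans hl
  rw [Complex.cpow_def_of_ne_zero hne]
  have := Complex.norm_exp_sub_one_le (x := Complex.log (1 + u) * α) (by linarith)
  linarith

theorem norm_one_add_cpow_sub_le {α : ℝ} (h0 : 0 ≤ α) (h1 : α ≤ 1) {u : ℂ}
    (hu : ‖u‖ ≤ 1 / 2) : ‖(1 + u) ^ (α : ℂ) - 1 - α * u‖ ≤ 4 * ‖u‖ ^ 2 := by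
  have hne := ne_zero_of_re_pos (one_add_re_pos (hu.trans_lt (by norm_num)))
  have hl := Complex.norm_log_one_add_half_le_self hu
  have hx : ‖Complex.log (1 + u) * α‖ ≤ 3 / 2 * ‖u‖ := by
    rw [norm_mul, Complex.norm_real, Real.norm_of_nonneg h0]
    exact (mul_le_of_le_one_right (norm_nonneg _) h1).trans hl
  have h2 := Complex.norm_exp_sub_one_sub_id_le (x := Complex.log (1 + u) * α) (by linarith)
  have h3 : ‖Complex.log (1 + u) - u‖ ≤ ‖u‖ ^ 2 := by
    refine (Complex.norm_log_one_add_sub_self_le (hu.trans_lt (by norm_num))).trans ?_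
    have : (1 - ‖u‖)⁻¹ ≤ 2 := by
      rw [inv_le_comm₀ (by linarith) (by norm_num)]; linarith
    nlinarith [sq_nonneg ‖u‖]
  rw [Complex.cpow_def_of_ne_zero hne]
  have e : Complex.exp (Complex.log (1 + u) * α) - 1 - α * u
      = (Complex.exp (Complex.log (1 + u) * α) - 1 - Complex.log (1 + u) * α)
        + (Complex.log (1 + u) - u) * α := by ring
  rw [e]
  refine (norm_add_le _ _).trans ?_
  have h4 : ‖(Complex.log (1 + u) - u) * α‖ ≤ ‖u‖ ^ 2 := by
    rw [norm_mul, Complex.norm_real, Real.norm_of_nonneg h0]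
    exact (mul_le_of_le_one_right (norm_nonneg _) h1).trans h3
  have h5 : ‖Complex.log (1 + u) * α‖ ^ 2 ≤ (3 / 2 * ‖u‖) ^ 2 := by gcongr
  nlinarith [sq_nonneg ‖u‖]

theorem sector_lower_bound_aux {α : ℝ} (h0 : 0 < α) (h1 : α < 1) {w m : ℂ} {l κ : ℝ}
    (hw : 0 < w.re) (hl : 0 ≤ l) (hκ : 0 ≤ κ) (hm : κ ≤ m.re) (hwi : 0 ≤ w.im)
    (hmi : m.im ≤ 0) :
    Real.cos ((1 + α) * Real.pi / 4) * (‖w‖ ^ α + l * κ) ≤ ‖w ^ (α : ℂ) + l * m‖ := by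
  have hpi := Real.pi_pos
  set ψ : ℝ := (1 - α) * Real.pi / 4 with hψ
  have hψ0 : 0 ≤ ψ := by rw [hψ]; have := mul_nonneg (sub_nonneg.2 h1.le) hpi.le; linarith
  have harg := abs_lt.1 (arg_abs_lt_of_re_pos hw)
  have harg0 : 0 ≤ w.arg := Complex.arg_nonneg_iff.2 hwi
  have hw0 := ne_zero_of_re_pos hw
  have hle : ψ + α * w.arg ≤ (1 + α) * Real.pi / 4 := by
    rw [hψ]; nlinarith [mul_le_mul_of_nonneg_left harg.2.le h0.le]
  have hc1 : Real.cos ((1 + α) * Real.pi / 4) ≤ Real.cos (ψ + α * w.arg) :=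
    Real.cos_le_cos_of_nonneg_of_le_pi (by positivity) (by nlinarith) hle
  have hc2 : Real.cos ((1 + α) * Real.pi / 4) ≤ Real.cos ψ :=
    Real.cos_le_cos_of_nonneg_of_le_pi hψ0 (by nlinarith) (by rw [hψ]; nlinarith)
  have hc0 : 0 ≤ Real.cos ((1 + α) * Real.pi / 4) :=
    Real.cos_nonneg_of_mem_Icc ⟨by nlinarith, by nlinarith⟩
  have hs : 0 ≤ Real.sin ψ := Real.sin_nonneg_of_nonneg_of_le_pi hψ0 (by rw [hψ]; nlinarith)
  have e1 : w ^ (α : ℂ) = (‖w‖ ^ α : ℝ) * Complex.exp ((α * w.arg : ℝ) * Complex.I) := by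
    rw [← Complex.norm_cpow_real, Complex.cpow_def_of_ne_zero hw0, Complex.norm_exp,
      Complex.ofReal_exp, ← Complex.exp_add]
    congr 1
    apply Complex.ext <;> simp [Complex.log_re, Complex.log_im, mul_comm]
  have e2 : (Complex.exp (ψ * Complex.I) * (w ^ (α : ℂ) + l * m)).re
      = ‖w‖ ^ α * Real.cos (ψ + α * w.arg) + l * (Real.cos ψ * m.re - Real.sin ψ * m.im) := by
    have : Complex.exp (ψ * Complex.I) * (w ^ (α : ℂ) + l * m)
      = (‖w‖ ^ α : ℝ) * Complex.exp ((ψ + α * w.arg : ℝ) * Complex.I)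
        + l * (Complex.exp (ψ * Complex.I) * m) := by
      rw [e1, Complex.ofReal_add, add_mul, Complex.exp_add]; ring
    rw [this, Complex.add_re, Complex.re_ofReal_mul, Complex.re_ofReal_mul,
      Complex.exp_ofReal_mul_I_re, Complex.mul_re, Complex.exp_ofReal_mul_I_re,
      Complex.exp_ofReal_mul_I_im]
  have e3 : ‖Complex.exp (ψ * Complex.I) * (w ^ (α : ℂ) + l * m)‖ = ‖w ^ (α : ℂ) + l * m‖ := by
    rw [norm_mul, Complex.norm_exp_ofReal_mul_I, one_mul]
  rw [← e3]
  refine le_trans ?_ (Complex.re_le_norm _)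
  rw [e2]
  have hA : 0 ≤ ‖w‖ ^ α := by positivity
  have t1 : Real.cos ((1 + α) * Real.pi / 4) * ‖w‖ ^ α ≤ ‖w‖ ^ α * Real.cos (ψ + α * w.arg) := by
    rw [mul_comm]; gcongr
  have t2 : Real.cos ((1 + α) * Real.pi / 4) * κ ≤ Real.cos ψ * m.re - Real.sin ψ * m.im := by
    have := mul_le_mul hc2 hm hκ (hc0.trans hc2)
    have := mul_nonneg hs (neg_nonneg.2 hmi)
    linarith
  have t3 := mul_le_mul_of_nonneg_left t2 hl
  linarith

/-- If `w` lies in the right half plane and `m` in the half plane `re m ≥ κ ≥ 0`, on the other side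
of the real axis, then `w ^ α` and `l * m` cannot cancel: after a rotation by a quarter of
`(1 - α) π` towards `w` both have a positive real part comparable with their norm. -/
theorem sector_lower_bound {α : ℝ} (h0 : 0 < α) (h1 : α < 1) {w m : ℂ} {l κ : ℝ}
    (hw : 0 < w.re) (hl : 0 ≤ l) (hκ : 0 ≤ κ) (hm : κ ≤ m.re)
    (him : (0 ≤ w.im ∧ m.im ≤ 0) ∨ (w.im ≤ 0 ∧ 0 ≤ m.im)) :
    Real.cos ((1 + α) * Real.pi / 4) * (‖w‖ ^ α + l * κ) ≤ ‖w ^ (α : ℂ) + l * m‖ := by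
  rcases him with h | h
  · exact sector_lower_bound_aux h0 h1 hw hl hκ hm h.1 h.2
  · have harg : w.arg ≠ Real.pi := by
      have := abs_lt.1 (arg_abs_lt_of_re_pos hw)
      have := Real.pi_pos
      intro h'; linarith
    have := sector_lower_bound_aux h0 h1 (w := (starRingEnd ℂ) w) (m := (starRingEnd ℂ) m)
      (l := l) (κ := κ) (by simpa using hw) hl hκ (by simpa using hm) (by simpa using h.1)
      (by simpa using h.2)
    rw [Complex.norm_conj] at this
    refine this.trans_eq ?_
    rw [Complex.conj_cpow _ _ harg, Complex.conj_ofReal]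
    have e : (starRingEnd ℂ) (w ^ (α : ℂ)) + l * (starRingEnd ℂ) m
        = (starRingEnd ℂ) (w ^ (α : ℂ) + l * m) := by
      rw [map_add, map_mul, Complex.conj_ofReal]
    rw [e, Complex.norm_conj]

theorem cos_sector_pos {α : ℝ} (h0 : 0 < α) (h1 : α < 1) :
    0 < Real.cos ((1 + α) * Real.pi / 4) := by
  have := Real.pi_pos
  exact Real.cos_pos_of_mem_Ioo ⟨by nlinarith, by nlinarith⟩

/-- A relative perturbation of size `‖u‖` changes `w ^ α` by a relative size of at most `3 ‖u‖`. -/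
theorem norm_mul_one_add_cpow_sub_le {α : ℝ} (h0 : 0 ≤ α) (h1 : α ≤ 1) {w u : ℂ}
    (hw : 0 < w.re) (hu : ‖u‖ ≤ 1 / 2) :
    ‖(w * (1 + u)) ^ (α : ℂ) - w ^ (α : ℂ)‖ ≤ 3 * ‖u‖ * ‖w‖ ^ α := by
  rw [mul_cpow_of_re_pos hw (one_add_re_pos (hu.trans_lt (by norm_num)))]
  have : w ^ (α : ℂ) * (1 + u) ^ (α : ℂ) - w ^ (α : ℂ)
      = ((1 + u) ^ (α : ℂ) - 1) * w ^ (α : ℂ) := by ring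
  rw [this, norm_mul, Complex.norm_cpow_real]
  gcongr
  exact norm_one_add_cpow_sub_one_le h0 h1 hu

/-! ### The symbols of the problem and of the scheme -/

/-- The generating polynomial `3/2 - 2ζ + ζ²/2` of the second-order BDF operator. -/
def bdfPoly (ζ : ℂ) : ℂ := 3 / 2 - 2 * ζ + ζ ^ 2 / 2

/-- The generating polynomial `(1 - α/2) + (α/2) ζ` of the averaging in the Crank-Nicolson
scheme. -/
def cnPoly (α : ℝ) (ζ : ℂ) : ℂ := 1 - α / 2 + α / 2 * ζ

/-- The generating function `(1 - ζ)^α + l ((1 - α/2) + (α/2) ζ)` of the left-hand side of the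
Crank-Nicolson scheme with unit time step and spectral parameter `l`. -/
def schemeFun (α l : ℝ) (ζ : ℂ) : ℂ := (1 - ζ) ^ (α : ℂ) + l * cnPoly α ζ

/-- The generating function of the discrete solution operator; `i` counts the BDF operators
applied. -/
def transferFun (α l : ℝ) (i : ℕ) (ζ : ℂ) : ℂ := bdfPoly ζ ^ i * cnPoly α ζ / schemeFun α l ζ

/-- The Laplace transform `z⁻ᵃ / (z^α + l)` of the exact solution operator applied to
`t^(a-1) / Γ(a)`. -/
def exactSymbol (α l a : ℝ) (z : ℂ) : ℂ := z ^ (-(a : ℂ)) / (z ^ (α : ℂ) + l)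

theorem one_sub_re_pos {ζ : ℂ} (h : ‖ζ‖ < 1) : 0 < (1 - ζ).re := by
  have := Complex.re_le_norm ζ
  simp only [Complex.sub_re, Complex.one_re]; linarith

/-- The value `(1 - ζ)^α + l (1 - α/2 + (α/2) ζ)` stays away from `0` uniformly in `l`, because the
quotient of its two terms avoids a sector around the negative real axis. -/
theorem schemeFun_lower_bound {α : ℝ} (h0 : 0 < α) (h1 : α < 1) {l : ℝ} (hl : 0 ≤ l) {ζ : ℂ}
    (h : ‖ζ‖ < 1) :
    Real.cos ((1 + α) * Real.pi / 4) * (‖1 - ζ‖ ^ α + l * (1 - α)) ≤ ‖schemeFun α l ζ‖ := by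
  have hre := abs_le.1 (Complex.abs_re_le_norm ζ)
  have e : cnPoly α ζ = ((1 - α / 2 + α / 2 * ζ.re : ℝ) : ℂ) + (α / 2 * ζ.im : ℝ) * Complex.I := by
    apply Complex.ext <;> simp [cnPoly]
  have e1 : (cnPoly α ζ).re = 1 - α / 2 + α / 2 * ζ.re := by rw [e]; simp
  have e2 : (cnPoly α ζ).im = α / 2 * ζ.im := by rw [e]; simp
  refine sector_lower_bound h0 h1 (one_sub_re_pos h) hl (by linarith) ?_ ?_
  · rw [e1]; nlinarith
  · rw [e2]
    simp only [Complex.sub_im, Complex.one_im, zero_sub]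
    rcases le_total 0 ζ.im with h | h
    · right; exact ⟨by linarith, by positivity⟩
    · left; exact ⟨by linarith, mul_nonpos_of_nonneg_of_nonpos (by positivity) h⟩

/-- In a period strip of the right half plane `1 - e⁻ᶻ` is at least of the size of `z`. -/
theorem norm_one_sub_exp_neg_lower_bound {z : ℂ} (h0 : 0 < z.re) (h1 : z.re ≤ 1)
    (hi : |z.im| ≤ Real.pi) : ‖z‖ / 8 ≤ ‖1 - Complex.exp (-z)‖ := by
  have hpi := Real.pi_pos
  have hpi4 := Real.pi_lt_d2
  set x := z.re
  set y := z.im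
  set r := Real.exp (-x)
  have hr0 : 0 < r := Real.exp_pos _
  have hr1 : r ≤ 1 - x / 2 := by
    have hx : |(-x)| ≤ 1 := by rw [abs_neg, abs_of_pos h0]; exact h1
    have hx2 := (abs_le.1 (Real.abs_exp_sub_one_sub_id_le hx)).2
    have hx3 := Real.one_sub_le_exp_neg x
    have : r * (1 + x) ≤ 1 := by
      have := Real.add_one_le_exp x
      have e : r * Real.exp x = 1 := by rw [← Real.exp_add]; simp
      nlinarith
    nlinarith
  have hr2 : 1 / 3 ≤ r := by
    have : Real.exp (-1) ≤ r := Real.exp_le_exp.2 (by linarith)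
    have h3 : Real.exp 1 ≤ 3 := Real.exp_one_lt_three.le
    have h4 : Real.exp (-1) * Real.exp 1 = 1 := by rw [← Real.exp_add]; simp
    nlinarith [Real.exp_pos (-1)]
  have hs : (y / Real.pi) ^ 2 ≤ Real.sin (y / 2) ^ 2 := by
    have h2 : |y / 2| ≤ Real.pi / 2 := by rw [abs_div, abs_two]; linarith
    have := Real.mul_abs_le_abs_sin h2
    rw [abs_div, abs_two] at this
    rw [sq_le_sq, abs_div, abs_of_pos hpi]
    refine le_trans (le_of_eq ?_) this
    field_simp
  have hsq : ‖1 - Complex.exp (-z)‖ ^ 2 = (1 - r) ^ 2 + 4 * r * Real.sin (y / 2) ^ 2 := by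
    have hre : (1 - Complex.exp (-z)).re = 1 - r * Real.cos y := by
      simp [Complex.exp_re, x, y, r]
    have him : (1 - Complex.exp (-z)).im = r * Real.sin y := by
      simp [Complex.exp_im, x, y, r]
    rw [← Complex.normSq_eq_norm_sq, Complex.normSq_apply, hre, him]
    have c1 : Real.cos y = 1 - 2 * Real.sin (y / 2) ^ 2 := by
      have := Real.cos_two_mul (y / 2)
      rw [show 2 * (y / 2) = y by ring] at this
      have h2 := Real.sin_sq_add_cos_sq (y / 2)
      linarith
    have c2 := Real.sin_sq_add_cos_sq y
    have : (1 - r * Real.cos y) * (1 - r * Real.cos y) + r * Real.sin y * (r * Real.sin y)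
      = 1 - 2 * r * Real.cos y + r ^ 2 * (Real.sin y ^ 2 + Real.cos y ^ 2) := by ring
    rw [this, c2, c1]; ring
  have hz : ‖z‖ ^ 2 = x ^ 2 + y ^ 2 := by
    rw [← Complex.normSq_eq_norm_sq, Complex.normSq_apply]; ring
  have hy : y ^ 2 / 10 ≤ (y / Real.pi) ^ 2 := by
    rw [div_pow]
    gcongr
    nlinarith
  refine abs_le_of_sq_le_sq' ?_ (norm_nonneg _) |>.2
  rw [hsq, div_pow, hz]
  nlinarith [sq_nonneg y, sq_nonneg x, mul_nonneg hr0.le (sub_nonneg.2 hs)]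

theorem norm_le_four_of_strip {z : ℂ} (h0 : 0 < z.re) (h1 : z.re ≤ 1)
    (hi : |z.im| ≤ Real.pi) : ‖z‖ ≤ 4 := by
  have hpi4 := Real.pi_lt_d2
  have hz : ‖z‖ ^ 2 = z.re ^ 2 + z.im ^ 2 := by
    rw [← Complex.normSq_eq_norm_sq, Complex.normSq_apply]; ring
  have := abs_le.1 hi
  nlinarith [norm_nonneg z, sq_abs z.im, abs_nonneg z.im]

/-- Under a relative perturbation `z = z₀ (1 + u)` of a point of the period strip, `1 - e⁻ᶻ` is
perturbed relatively by `16 ‖u‖` at most. -/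
theorem one_sub_exp_neg_perturb {z u : ℂ} (h0 : 0 < z.re) (h1 : z.re ≤ 1)
    (hi : |z.im| ≤ Real.pi) (hu : ‖u‖ ≤ 1 / 8) :
    ∃ u' : ℂ, ‖u'‖ ≤ 16 * ‖u‖ ∧
      1 - Complex.exp (-(z * (1 + u))) = (1 - Complex.exp (-z)) * (1 + u') := by
  have hlow := norm_one_sub_exp_neg_lower_bound h0 h1 hi
  have hz4 := norm_le_four_of_strip h0 h1 hi
  have hz0 : 0 < ‖z‖ := norm_pos_iff.2 (ne_zero_of_re_pos h0)
  have hw0 : 1 - Complex.exp (-z) ≠ 0 := by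
    rw [← norm_pos_iff]; linarith
  refine ⟨Complex.exp (-z) * (1 - Complex.exp (-(z * u))) / (1 - Complex.exp (-z)), ?_, ?_⟩
  · rw [norm_div, div_le_iff₀ (norm_pos_iff.2 hw0), norm_mul]
    have hzu : ‖-(z * u)‖ ≤ 1 := by
      rw [norm_neg, norm_mul]; nlinarith [norm_nonneg u]
    have a1 := Complex.norm_exp_sub_one_le hzu
    rw [norm_sub_rev, norm_neg, norm_mul] at a1
    have a2 : ‖Complex.exp (-z)‖ ≤ 1 := by
      rw [Complex.norm_exp]; simpa using h0.le
    calc ‖Complex.exp (-z)‖ * ‖1 - Complex.exp (-(z * u))‖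
        ≤ 1 * (2 * (‖z‖ * ‖u‖)) := by gcongr
      _ ≤ 16 * ‖u‖ * ‖1 - Complex.exp (-z)‖ := by nlinarith [norm_nonneg u]
  · have : Complex.exp (-(z * (1 + u))) = Complex.exp (-z) * Complex.exp (-(z * u)) := by
      rw [← Complex.exp_add]; congr 1; ring
    rw [this]
    field_simp
    ring

/-! ### Sector bounds and consistency of the symbols -/

/-- The constant in the lower bounds for `(1 - ζ)^α + l (1 - α/2 + (α/2) ζ)`: the cosine
measures the opening of the sector, and `1 - α` bounds `|1 - α/2 + (α/2) ζ|` from below. -/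
def sectorGap (α : ℝ) : ℝ := Real.cos ((1 + α) * Real.pi / 4) * (1 - α)

theorem sectorGap_pos {α : ℝ} (h0 : 0 < α) (h1 : α < 1) : 0 < sectorGap α :=
  mul_pos (cos_sector_pos h0 h1) (by linarith)

theorem sectorGap_le_cos {α : ℝ} (h0 : 0 < α) (h1 : α < 1) :
    sectorGap α ≤ Real.cos ((1 + α) * Real.pi / 4) :=
  mul_le_of_le_one_right (cos_sector_pos h0 h1).le (by linarith)

theorem sectorGap_le_one {α : ℝ} (h0 : 0 < α) (h1 : α < 1) : sectorGap α ≤ 1 :=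
  (sectorGap_le_cos h0 h1).trans (Real.cos_le_one _)

theorem one_add_sub_lower_bound {a b : ℂ} {p q : ℝ} (ha : p ≤ ‖a‖) (hb : ‖b - a‖ ≤ q) :
    p - q ≤ ‖b‖ := by
  have := norm_sub_norm_le a b
  rw [norm_sub_rev] at this
  linarith

/-- The sector bound for the exact symbol, slightly beyond the right half plane. -/
theorem exact_lower_bound {α : ℝ} (h0 : 0 < α) (h1 : α < 1) {l : ℝ} (hl : 0 ≤ l) {z u : ℂ}
    (hz : 0 < z.re) (hu : ‖u‖ ≤ sectorGap α / 96) :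
    sectorGap α / 16 * (‖z‖ ^ α + l) ≤ ‖(z * (1 + u)) ^ (α : ℂ) + l‖ := by
  have hg := sectorGap_pos h0 h1
  have hg1 := sectorGap_le_one h0 h1
  have hgc := sectorGap_le_cos h0 h1
  have hA : 0 ≤ ‖z‖ ^ α := by positivity
  have b1 := sector_lower_bound h0 h1 (w := z) (m := 1) (l := l) (κ := 1) hz hl zero_le_one
    (by simp) (by simp [le_total])
  rw [mul_one, mul_one] at b1
  have b2 := norm_mul_one_add_cpow_sub_le h0.le h1.le hz (u := u) (by linarith)
  have b3 := one_add_sub_lower_bound (b := (z * (1 + u)) ^ (α : ℂ) + l)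
    (q := 3 * ‖u‖ * ‖z‖ ^ α) b1
    (by rw [add_sub_add_right_eq_sub]; exact b2)
  refine le_trans ?_ b3
  have t1 : 3 * ‖u‖ * ‖z‖ ^ α ≤ 3 * (sectorGap α / 96) * ‖z‖ ^ α := by gcongr
  have t2 := mul_le_mul_of_nonneg_right hgc (add_nonneg hA hl)
  nlinarith [mul_nonneg hg.le hA, mul_nonneg hg.le hl]

/-- The sector bound for the symbol of the scheme, slightly beyond the right half plane. -/
theorem schemeFun_exp_lower_bound {α : ℝ} (h0 : 0 < α) (h1 : α < 1) {l : ℝ} (hl : 0 ≤ l) {z u : ℂ}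
    (hz : 0 < z.re) (hz1 : z.re ≤ 1) (hi : |z.im| ≤ Real.pi) (hu : ‖u‖ ≤ sectorGap α / 96) :
    1 - Complex.exp (-(z * (1 + u))) ∈ Complex.slitPlane ∧
    sectorGap α / 16 * (‖z‖ ^ α + l) ≤ ‖schemeFun α l (Complex.exp (-(z * (1 + u))))‖ := by
  have hg := sectorGap_pos h0 h1
  have hg1 := sectorGap_le_one h0 h1
  have hgc := sectorGap_le_cos h0 h1
  obtain ⟨u', hu', e⟩ := one_sub_exp_neg_perturb hz hz1 hi (u := u) (by linarith)
  have hE : ‖Complex.exp (-z)‖ < 1 := by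
    rw [Complex.norm_exp]; simpa using hz
  set w := 1 - Complex.exp (-z) with hw
  have hwre : 0 < w.re := one_sub_re_pos hE
  have hu2 : ‖u'‖ ≤ 1 / 2 := by linarith
  refine ⟨?_, ?_⟩
  · rw [e]
    exact mul_mem_slitPlane_of_re_pos hwre (one_add_re_pos (by linarith))
  have b1 := schemeFun_lower_bound h0 h1 hl hE
  rw [← hw] at b1
  have b2 := norm_mul_one_add_cpow_sub_le h0.le h1.le hwre hu2
  have hw2 : ‖w‖ ≤ 2 := by
    refine (norm_sub_le _ _).trans ?_
    rw [norm_one]; linarith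
  have b3 : ‖schemeFun α l (Complex.exp (-(z * (1 + u)))) - schemeFun α l (Complex.exp (-z))‖
      ≤ 48 * ‖u‖ * ‖w‖ ^ α + l * (16 * ‖u‖) := by
    have e3 : schemeFun α l (Complex.exp (-(z * (1 + u)))) - schemeFun α l (Complex.exp (-z))
        = ((w * (1 + u')) ^ (α : ℂ) - w ^ (α : ℂ)) - (l * (α / 2) : ℝ) * (w * u') := by
      have e4 : Complex.exp (-(z * (1 + u))) = 1 - w * (1 + u') := by rw [← e]; ring
      have e5 : Complex.exp (-z) = 1 - w := by rw [hw]; ring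
      simp only [schemeFun, cnPoly]
      rw [e4, e5]
      push_cast
      ring_nf
    rw [e3]
    refine (norm_sub_le _ _).trans ?_
    have hA : 0 ≤ ‖w‖ ^ α := by positivity
    have c1 : 3 * ‖u'‖ * ‖w‖ ^ α ≤ 3 * (16 * ‖u‖) * ‖w‖ ^ α := by gcongr
    have c2 : ‖((l * (α / 2) : ℝ) : ℂ) * (w * u')‖ ≤ (l * (1 / 2)) * (2 * (16 * ‖u‖)) := by
      rw [norm_mul, norm_mul, Complex.norm_real, Real.norm_of_nonneg (by positivity)]
      gcongr
    linarith
  have b4 := one_add_sub_lower_bound b1 b3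
  refine le_trans ?_ b4
  have hwz : ‖z‖ ^ α / 8 ≤ ‖w‖ ^ α := by
    have := norm_one_sub_exp_neg_lower_bound hz hz1 hi
    have h8 : (‖z‖ / 8) ^ α ≤ ‖w‖ ^ α := Real.rpow_le_rpow (by positivity) this h0.le
    refine le_trans ?_ h8
    rw [Real.div_rpow (norm_nonneg _) (by norm_num)]
    gcongr
    calc (8 : ℝ) ^ α ≤ 8 ^ (1 : ℝ) := Real.rpow_le_rpow_of_exponent_le (by norm_num) h1.le
      _ = 8 := by norm_num
  have hA : 0 ≤ ‖w‖ ^ α := by positivity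
  have hB : 0 ≤ ‖z‖ ^ α := by positivity
  have t1 : 48 * ‖u‖ * ‖w‖ ^ α ≤ 48 * (sectorGap α / 96) * ‖w‖ ^ α := by gcongr
  have t2 : l * (16 * ‖u‖) ≤ l * (16 * (sectorGap α / 96)) := by gcongr
  have t3 := mul_le_mul_of_nonneg_right hgc hA
  have t4 := mul_le_mul_of_nonneg_left hwz hg.le
  have t5 := mul_nonneg hg.le hl
  have e6 : Real.cos ((1 + α) * Real.pi / 4) * (l * (1 - α)) = sectorGap α * l := by
    rw [sectorGap]; ring
  rw [mul_add, mul_add, e6]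
  nlinarith

theorem exists_norm_bdfPoly_exp_sub_le :
    ∃ C : ℝ, 0 ≤ C ∧ ∀ z : ℂ, ‖z‖ ≤ 5 → ‖bdfPoly (Complex.exp (-z)) - z‖ ≤ C * ‖z‖ ^ 3 := by
  refine ⟨2 * Real.exp 5 + 4 * Real.exp 10, by positivity, fun z hz => ?_⟩
  have h1 := Complex.norm_exp_sub_sum_le_norm_mul_exp (-z) 3
  have h2 := Complex.norm_exp_sub_sum_le_norm_mul_exp (-(2 * z)) 3
  simp only [Finset.sum_range_succ, Finset.sum_range_zero, norm_neg, Nat.factorial,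
    norm_mul, Complex.norm_two] at h1 h2
  have e : bdfPoly (Complex.exp (-z)) - z
      = -2 * (Complex.exp (-z) - (1 + -z + (-z) ^ 2 / 2))
        + (1 / 2) * (Complex.exp (-(2 * z)) - (1 + -(2 * z) + (-(2 * z)) ^ 2 / 2)) := by
    have : Complex.exp (-(2 * z)) = Complex.exp (-z) ^ 2 := by
      rw [← Complex.exp_nat_mul]; congr 1; push_cast; ring
    rw [bdfPoly, this]; ring
  rw [e]
  refine (norm_add_le _ _).trans ?_
  rw [norm_mul, norm_mul, norm_neg, Complex.norm_two]
  have a1 : ‖Complex.exp (-z) - (1 + -z + (-z) ^ 2 / 2)‖ ≤ ‖z‖ ^ 3 * Real.exp 5 := by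
    refine le_trans (le_of_eq ?_) (h1.trans (by gcongr))
    congr 1; norm_num
  have a2 : ‖Complex.exp (-(2 * z)) - (1 + -(2 * z) + (-(2 * z)) ^ 2 / 2)‖
      ≤ (2 * ‖z‖) ^ 3 * Real.exp 10 := by
    refine le_trans (le_of_eq ?_) (h2.trans ?_)
    · congr 1; norm_num
    · gcongr; linarith
  have a3 : ‖(1 / 2 : ℂ)‖ = 1 / 2 := by norm_num
  rw [a3]
  nlinarith

theorem norm_exp_neg_le_of_norm_le {z : ℂ} (hz : ‖z‖ ≤ 5) :
    ‖Complex.exp (-z)‖ ≤ Real.exp 5 :=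
  (Complex.norm_exp_le_exp_norm _).trans (Real.exp_le_exp.2 (by rwa [norm_neg]))

theorem norm_cnPoly_le {α : ℝ} (h0 : 0 < α) (h1 : α < 1) {ζ : ℂ} {B : ℝ} (h : ‖ζ‖ ≤ B) :
    ‖cnPoly α ζ‖ ≤ 1 + B := by
  have e : cnPoly α ζ = ((1 - α / 2 : ℝ) : ℂ) + (α / 2 : ℝ) * ζ := by
    rw [cnPoly]; push_cast; ring
  rw [e]
  refine (norm_add_le _ _).trans ?_
  rw [norm_mul, Complex.norm_real, Complex.norm_real, Real.norm_of_nonneg (by linarith),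
    Real.norm_of_nonneg (by linarith)]
  have := norm_nonneg ζ
  nlinarith

/-- Second order consistency of the averaged Grünwald-Letnikov formula, in Laplace space. -/
theorem exists_norm_cnPoly_mul_cpow_sub_le {α : ℝ} (h0 : 0 < α) (h1 : α < 1) :
    ∃ C : ℝ, 0 ≤ C ∧ ∀ z u : ℂ, 0 < z.re → z.re ≤ 1 → |z.im| ≤ Real.pi → ‖u‖ ≤ 1 / 8 →
      ‖cnPoly α (Complex.exp (-(z * (1 + u)))) * (z * (1 + u)) ^ (α : ℂ)
        - (1 - Complex.exp (-(z * (1 + u)))) ^ (α : ℂ)‖ ≤ C * ‖z * (1 + u)‖ ^ (α + 2) := by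
  set B := 1 + Real.exp 5 with hB
  have hBpos : 0 < B := by positivity
  refine ⟨max 100 ((B * 5 + B) * 64), by positivity, fun z u hz hz1 hi hu => ?_⟩
  set x := z * (1 + u) with hx
  have hu1 := one_add_re_pos (hu.trans_lt (by norm_num))
  have hx0 : x ≠ 0 := mul_ne_zero (ne_zero_of_re_pos hz) (ne_zero_of_re_pos hu1)
  have hxp : 0 < ‖x‖ := norm_pos_iff.2 hx0
  have hz4 := norm_le_four_of_strip hz hz1 hi
  have hx5 : ‖x‖ ≤ 5 := by
    rw [hx, norm_mul]
    have : ‖1 + u‖ ≤ 1 + 1 / 8 := (norm_add_le _ _).trans (by rw [norm_one]; linarith)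
    nlinarith [norm_nonneg z]
  have hE := norm_exp_neg_le_of_norm_le hx5
  rcases le_total ‖x‖ (1 / 4) with hs | hs
  · -- Near the origin `1 - e⁻ˣ = x (1 + v)` with `v = -x/2 + O(x²)`.
    have hr := Complex.norm_exp_sub_sum_le_norm_mul_exp (-x) 3
    simp only [Finset.sum_range_succ, Finset.sum_range_zero, norm_neg, Nat.factorial] at hr
    set r : ℂ := Complex.exp (-x) - (1 + -x + (-x) ^ 2 / 2) with hrdef
    have hexp : Real.exp ‖x‖ ≤ 2 := by
      have : Real.exp ‖x‖ ≤ Real.exp (1 / 4) := Real.exp_le_exp.2 hs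
      have h4 : Real.exp (1 / 4) ≤ 2 := by
        have := Real.abs_exp_sub_one_sub_id_le (x := 1 / 4) (by rw [abs_of_pos] <;> norm_num)
        have := (abs_le.1 this).2
        linarith
      linarith
    have hr' : ‖r‖ ≤ ‖x‖ ^ 3 * 2 := by
      have e : r = Complex.exp (-x) - (0 + (-x) ^ 0 / ((1 : ℕ) : ℂ)
          + (-x) ^ 1 / (((0 + 1) * 1 : ℕ) : ℂ)
          + (-x) ^ 2 / (((1 + 1) * ((0 + 1) * 1) : ℕ) : ℂ)) := by
        rw [hrdef]; norm_num
      rw [e]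
      exact hr.trans (by gcongr)
    set v : ℂ := -x / 2 - r / x with hv
    have hrx : ‖r / x‖ ≤ ‖x‖ ^ 2 * 2 := by
      rw [norm_div, div_le_iff₀ hxp]; linarith
    have hvn : ‖v‖ ≤ ‖x‖ := by
      refine (norm_sub_le _ _).trans ?_
      rw [norm_div, norm_neg, Complex.norm_two]
      nlinarith
    have ew : 1 - Complex.exp (-x) = x * (1 + v) := by
      have : Complex.exp (-x) = r + (1 + -x + (-x) ^ 2 / 2) := by rw [hrdef]; ring
      rw [this, hv]; field_simp; ring
    have hv1 := one_add_re_pos (u := v) (by linarith)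
    have huv : ‖u + v + u * v‖ < 1 := by
      calc ‖u + v + u * v‖ ≤ ‖u‖ + ‖v‖ + ‖u‖ * ‖v‖ := by
            refine (norm_add_le _ _).trans ?_
            rw [norm_mul]
            gcongr
            exact norm_add_le _ _
        _ ≤ 1 / 8 + 1 / 4 + 1 / 8 * (1 / 4) := by
            have : ‖v‖ ≤ 1 / 4 := by linarith
            gcongr
        _ < 1 := by norm_num
    have epow : (1 - Complex.exp (-x)) ^ (α : ℂ) = x ^ (α : ℂ) * (1 + v) ^ (α : ℂ) := by
      have e1 : x * (1 + v) = z * (1 + (u + v + u * v)) := by rw [hx]; ring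
      rw [ew, e1, mul_cpow_of_re_pos hz (one_add_re_pos huv), hx, mul_cpow_of_re_pos hz hu1,
        mul_assoc, ← mul_cpow_of_re_pos hu1 hv1]
      congr 2; ring
    have hcn : cnPoly α (Complex.exp (-x)) - (1 + v) ^ (α : ℂ)
        = -((1 + v) ^ (α : ℂ) - 1 - α * v) + (α : ℂ) * (-(x * v) / 2 + r / x) := by
      have : Complex.exp (-x) = 1 - x * (1 + v) := by rw [← ew]; ring
      rw [cnPoly, this]
      linear_combination (-α : ℂ) * hv
    have hq := norm_one_add_cpow_sub_le h0.le h1.le (u := v) (by linarith)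
    have hbound : ‖cnPoly α (Complex.exp (-x)) - (1 + v) ^ (α : ℂ)‖ ≤ 100 * ‖x‖ ^ 2 := by
      rw [hcn]
      refine (norm_add_le _ _).trans ?_
      rw [norm_neg, norm_mul, Complex.norm_real, Real.norm_of_nonneg h0.le]
      have c1 : ‖-(x * v) / 2 + r / x‖ ≤ 3 * ‖x‖ ^ 2 := by
        refine (norm_add_le _ _).trans ?_
        rw [norm_div, norm_neg, norm_mul, Complex.norm_two]
        nlinarith
      have c2 : 4 * ‖v‖ ^ 2 ≤ 4 * ‖x‖ ^ 2 := by gcongr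
      have c3 : α * ‖-(x * v) / 2 + r / x‖ ≤ 1 * (3 * ‖x‖ ^ 2) := by gcongr
      nlinarith [sq_nonneg ‖x‖]
    have efin : cnPoly α (Complex.exp (-x)) * x ^ (α : ℂ) - (1 - Complex.exp (-x)) ^ (α : ℂ)
        = x ^ (α : ℂ) * (cnPoly α (Complex.exp (-x)) - (1 + v) ^ (α : ℂ)) := by
      rw [epow]; ring
    rw [efin, norm_mul, Complex.norm_cpow_real, Real.rpow_add hxp, Real.rpow_two]
    have hA : 0 ≤ ‖x‖ ^ α := by positivity
    calc ‖x‖ ^ α * ‖cnPoly α (Complex.exp (-x)) - (1 + v) ^ (α : ℂ)‖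
        ≤ ‖x‖ ^ α * (100 * ‖x‖ ^ 2) := by gcongr
      _ = 100 * (‖x‖ ^ α * ‖x‖ ^ 2) := by ring
      _ ≤ _ := by gcongr; exact le_max_left _ _
  · have a1 : ‖cnPoly α (Complex.exp (-x))‖ ≤ B := norm_cnPoly_le h0 h1 hE
    have a2 : ‖x‖ ^ α ≤ 5 := by
      calc ‖x‖ ^ α ≤ 5 ^ α := Real.rpow_le_rpow hxp.le hx5 h0.le
        _ ≤ 5 ^ (1 : ℝ) := Real.rpow_le_rpow_of_exponent_le (by norm_num) h1.le
        _ = 5 := by norm_num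
    have a3 : ‖1 - Complex.exp (-x)‖ ≤ B := (norm_sub_le _ _).trans (by rw [norm_one]; linarith)
    have hB1 : 1 ≤ B := by rw [hB]; linarith [Real.exp_pos 5]
    have a4 : ‖1 - Complex.exp (-x)‖ ^ α ≤ B := by
      calc ‖1 - Complex.exp (-x)‖ ^ α ≤ B ^ α := Real.rpow_le_rpow (norm_nonneg _) a3 h0.le
        _ ≤ B ^ (1 : ℝ) := Real.rpow_le_rpow_of_exponent_le hB1 h1.le
        _ = B := by simp
    have a5 : 1 / 64 ≤ ‖x‖ ^ (α + 2) := by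
      calc (1 / 64 : ℝ) = (1 / 4) ^ (3 : ℝ) := by norm_num
        _ ≤ (1 / 4) ^ (α + 2) :=
          Real.rpow_le_rpow_of_exponent_ge (by norm_num) (by norm_num) (by linarith)
        _ ≤ ‖x‖ ^ (α + 2) := Real.rpow_le_rpow (by norm_num) hs (by linarith)
    refine (norm_sub_le _ _).trans ?_
    rw [norm_mul, Complex.norm_cpow_real, Complex.norm_cpow_real]
    calc ‖cnPoly α (Complex.exp (-x))‖ * ‖x‖ ^ α + ‖1 - Complex.exp (-x)‖ ^ α
        ≤ B * 5 + B := by gcongr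
      _ = (B * 5 + B) * 64 * (1 / 64) := by ring
      _ ≤ (B * 5 + B) * 64 * ‖x‖ ^ (α + 2) := by gcongr
      _ ≤ _ := by gcongr; exact le_max_right _ _

/-! ### Bounds for the third derivatives of the symbols -/

/-- The Laplace transform `z⁻ᵇ G(e⁻ᶻ)` of the discrete solution for the primitive
`t^(b-1) / Γ(b)`, with unit time step. -/
def discreteSymbol (α l b : ℝ) (i : ℕ) (z : ℂ) : ℂ :=
  z ^ (-(b : ℂ)) * transferFun α l i (Complex.exp (-z))

theorem rpow_le_two_rpow_abs_mul {x y : ℝ} (hx : 0 < x) (h1 : x / 2 ≤ y) (h2 : y ≤ 2 * x) (p : ℝ) :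
    y ^ p ≤ 2 ^ |p| * x ^ p := by
  have hy : 0 < y := by linarith
  rcases le_total 0 p with hp | hp
  · rw [abs_of_nonneg hp, ← Real.mul_rpow (by norm_num) hx.le]
    exact Real.rpow_le_rpow hy.le h2 hp
  · rw [abs_of_nonpos hp]
    have e : (2 : ℝ) ^ (-p) * x ^ p = (x / 2) ^ p := by
      rw [Real.div_rpow hx.le (by norm_num), Real.rpow_neg (by norm_num)]
      ring
    rw [e]
    exact Real.rpow_le_rpow_of_nonpos (by linarith) h1 hp

theorem norm_mul_one_add_le {z u : ℂ} (hu : ‖u‖ ≤ 1 / 8) :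
    ‖z‖ / 2 ≤ ‖z * (1 + u)‖ ∧ ‖z * (1 + u)‖ ≤ 2 * ‖z‖ ∧ ‖z * (1 + u)‖ ≤ 5 / 4 * ‖z‖ := by
  have h1 : ‖1 + u‖ ≤ 1 + 1 / 8 := (norm_add_le _ _).trans (by rw [norm_one]; linarith)
  have h2 : 1 - 1 / 8 ≤ ‖1 + u‖ := one_add_sub_lower_bound (a := 1) (by simp) (by simpa using hu)
  rw [norm_mul]
  have := norm_nonneg z
  refine ⟨?_, ?_, ?_⟩ <;> nlinarith

theorem cube_le_of_le_five {x : ℝ} (h0 : 0 ≤ x) (h5 : x ≤ 5) : x ^ 3 ≤ 25 * x := by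
  have : x ^ 2 ≤ 25 := by nlinarith
  nlinarith

/-- Cauchy's estimate on a disc whose radius is proportional to the distance from the origin. -/
theorem norm_iteratedDeriv_three_le {f : ℂ → ℂ} {z : ℂ} {ε K : ℝ} (hz : z ≠ 0) (hε : 0 < ε)
    (hd : ∀ u : ℂ, ‖u‖ ≤ ε → DifferentiableAt ℂ f (z * (1 + u)))
    (hb : ∀ u : ℂ, ‖u‖ ≤ ε → ‖f (z * (1 + u))‖ ≤ K) :
    ‖iteratedDeriv 3 f z‖ ≤ 6 * K / (ε * ‖z‖) ^ 3 := by
  have hzn : 0 < ‖z‖ := norm_pos_iff.2 hz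
  have key : ∀ x ∈ Metric.closedBall z (ε * ‖z‖), ∃ u : ℂ, ‖u‖ ≤ ε ∧ x = z * (1 + u) := by
    intro x hx
    refine ⟨(x - z) / z, ?_, by field_simp; ring⟩
    rw [norm_div, div_le_iff₀ hzn, ← dist_eq_norm]
    exact hx
  have := Complex.norm_iteratedDeriv_le_of_forall_mem_sphere_norm_le (f := f) (c := z) (C := K) 3
    (mul_pos hε hzn) ?_ ?_
  · simpa [Nat.factorial] using this
  · apply DifferentiableOn.diffContOnCl
    rw [closure_ball _ (mul_pos hε hzn).ne']
    intro x hx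
    obtain ⟨u, hu, rfl⟩ := key x hx
    exact (hd u hu).differentiableWithinAt
  · intro x hx
    obtain ⟨u, hu, rfl⟩ := key x (Metric.sphere_subset_closedBall hx)
    exact hb u hu

theorem differentiableAt_exactSymbol {α l a : ℝ} {z : ℂ} (hz : z ∈ Complex.slitPlane)
    (h : z ^ (α : ℂ) + l ≠ 0) : DifferentiableAt ℂ (exactSymbol α l a) z := by
  unfold exactSymbol
  refine DifferentiableAt.div ?_ ?_ h
  · exact differentiableAt_id.cpow_const hz
  · exact (differentiableAt_id.cpow_const hz).add_const _

theorem differentiableAt_transferFun {α l : ℝ} {i : ℕ} {ζ : ℂ}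
    (hz : 1 - ζ ∈ Complex.slitPlane) (h : schemeFun α l ζ ≠ 0) :
    DifferentiableAt ℂ (transferFun α l i) ζ := by
  unfold transferFun
  refine DifferentiableAt.div ?_ ?_ h
  · unfold bdfPoly cnPoly; fun_prop
  · unfold schemeFun
    refine DifferentiableAt.add ?_ ?_
    · exact ((differentiableAt_const _).sub differentiableAt_id).cpow_const hz
    · unfold cnPoly; fun_prop

theorem differentiableAt_transferFun_exp {α l : ℝ} {i : ℕ} {z : ℂ}
    (hw : 1 - Complex.exp (-z) ∈ Complex.slitPlane)
    (h : schemeFun α l (Complex.exp (-z)) ≠ 0) :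
    DifferentiableAt ℂ (fun x => transferFun α l i (Complex.exp (-x))) z :=
  DifferentiableAt.comp z (differentiableAt_transferFun hw h) (by fun_prop)

theorem differentiableAt_discreteSymbol {α l b : ℝ} {i : ℕ} {z : ℂ} (hz : z ∈ Complex.slitPlane)
    (hw : 1 - Complex.exp (-z) ∈ Complex.slitPlane)
    (h : schemeFun α l (Complex.exp (-z)) ≠ 0) :
    DifferentiableAt ℂ (discreteSymbol α l b i) z := by
  unfold discreteSymbol
  exact (differentiableAt_id.cpow_const hz).mul (differentiableAt_transferFun_exp hw h)

section Bounds

variable {α : ℝ} (h0 : 0 < α) (h1 : α < 1)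
include h0 h1

theorem sectorGap_div_le : sectorGap α / 96 ≤ 1 / 8 := by
  linarith [sectorGap_le_one h0 h1]

/-- The bound of `exact_lower_bound` in terms of the perturbed point, as the Cauchy estimates on a
disc around `z` require. -/
theorem exact_lower_bound' {l : ℝ} (hl : 0 ≤ l) {z u : ℂ}
    (hz : 0 < z.re) (hu : ‖u‖ ≤ sectorGap α / 96) :
    z * (1 + u) ∈ Complex.slitPlane ∧ 0 < ‖z * (1 + u)‖ ∧
    sectorGap α / 32 * ‖z * (1 + u)‖ ^ α ≤ ‖(z * (1 + u)) ^ (α : ℂ) + l‖ := by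
  have hg := sectorGap_pos h0 h1
  have hu8 := hu.trans (sectorGap_div_le h0 h1)
  have hb := exact_lower_bound h0 h1 hl hz hu
  have hu1 := one_add_re_pos (hu8.trans_lt (by norm_num))
  obtain ⟨-, n2, -⟩ := norm_mul_one_add_le (z := z) hu8
  refine ⟨mul_mem_slitPlane_of_re_pos hz hu1, norm_pos_iff.2
    (mul_ne_zero (ne_zero_of_re_pos hz) (ne_zero_of_re_pos hu1)), le_trans ?_ hb⟩
  have : ‖z * (1 + u)‖ ^ α ≤ 2 * ‖z‖ ^ α := by
    calc ‖z * (1 + u)‖ ^ α ≤ (2 * ‖z‖) ^ α := Real.rpow_le_rpow (norm_nonneg _) n2 h0.le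
      _ = 2 ^ α * ‖z‖ ^ α := Real.mul_rpow (by norm_num) (norm_nonneg _)
      _ ≤ 2 ^ (1 : ℝ) * ‖z‖ ^ α := by
        gcongr; norm_num
      _ = 2 * ‖z‖ ^ α := by norm_num
  nlinarith

/-- The bound of `schemeFun_exp_lower_bound` in terms of the perturbed point. -/
theorem schemeFun_exp_lower_bound' {l : ℝ} (hl : 0 ≤ l) {z u : ℂ}
    (hz : 0 < z.re) (hz1 : z.re ≤ 1) (hi : |z.im| ≤ Real.pi) (hu : ‖u‖ ≤ sectorGap α / 96) :
    sectorGap α / 32 * ‖z * (1 + u)‖ ^ α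
      ≤ ‖schemeFun α l (Complex.exp (-(z * (1 + u))))‖ := by
  have hg := sectorGap_pos h0 h1
  have hu8 := hu.trans (sectorGap_div_le h0 h1)
  have hb := (schemeFun_exp_lower_bound h0 h1 hl hz hz1 hi hu).2
  obtain ⟨-, n2, -⟩ := norm_mul_one_add_le (z := z) hu8
  refine le_trans ?_ hb
  have : ‖z * (1 + u)‖ ^ α ≤ 2 * ‖z‖ ^ α := by
    calc ‖z * (1 + u)‖ ^ α ≤ (2 * ‖z‖) ^ α := Real.rpow_le_rpow (norm_nonneg _) n2 h0.le
      _ = 2 ^ α * ‖z‖ ^ α := Real.mul_rpow (by norm_num) (norm_nonneg _)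
      _ ≤ 2 ^ (1 : ℝ) * ‖z‖ ^ α := by
        gcongr; norm_num
      _ = 2 * ‖z‖ ^ α := by norm_num
  nlinarith

theorem exists_norm_iteratedDeriv_exactSymbol_le (a : ℝ) :
    ∃ C : ℝ, 0 ≤ C ∧ ∀ l : ℝ, 0 ≤ l → ∀ z : ℂ, 0 < z.re →
      ‖iteratedDeriv 3 (exactSymbol α l a) z‖ ≤ C * ‖z‖ ^ (-a - α - 3) := by
  have hg := sectorGap_pos h0 h1
  refine ⟨6 * (32 / sectorGap α * 2 ^ |-a - α|) / (sectorGap α / 96) ^ 3, by positivity,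
    fun l hl z hz => ?_⟩
  have hz0 := ne_zero_of_re_pos hz
  have hzn : 0 < ‖z‖ := norm_pos_iff.2 hz0
  refine (norm_iteratedDeriv_three_le (ε := sectorGap α / 96)
    (K := 32 / sectorGap α * 2 ^ |-a - α| * ‖z‖ ^ (-a - α)) hz0 (by positivity) ?_ ?_).trans ?_
  · intro u hu
    obtain ⟨b1, b2, b3⟩ := exact_lower_bound' h0 h1 hl hz hu
    refine differentiableAt_exactSymbol b1 ?_
    rw [← norm_pos_iff]
    exact lt_of_lt_of_le (by positivity) b3
  · intro u hu
    obtain ⟨b1, b2, b3⟩ := exact_lower_bound' h0 h1 hl hz hu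
    obtain ⟨n1, n2, -⟩ := norm_mul_one_add_le (z := z) (hu.trans (sectorGap_div_le h0 h1))
    rw [exactSymbol, norm_div, ← Complex.ofReal_neg, Complex.norm_cpow_real]
    set x := z * (1 + u)
    calc ‖x‖ ^ (-a) / ‖x ^ (α : ℂ) + l‖ ≤ ‖x‖ ^ (-a) / (sectorGap α / 32 * ‖x‖ ^ α) := by gcongr
      _ = 32 / sectorGap α * ‖x‖ ^ (-a - α) := by
        rw [Real.rpow_sub b2]; field_simp
      _ ≤ 32 / sectorGap α * (2 ^ |-a - α| * ‖z‖ ^ (-a - α)) := by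
        gcongr
        exact rpow_le_two_rpow_abs_mul hzn n1 n2 _
      _ = _ := by ring
  · apply le_of_eq
    rw [Real.rpow_sub hzn (-a - α) 3, mul_pow]
    norm_num
    field_simp

/-- The symbol of the scheme is of the order of the exact one in a period strip. -/
theorem exists_norm_transferFun_exp_le (i : ℕ) :
    ∃ C : ℝ, 0 ≤ C ∧ ∀ l : ℝ, 0 ≤ l → ∀ z u : ℂ, 0 < z.re → z.re ≤ 1 → |z.im| ≤ Real.pi →
      ‖u‖ ≤ sectorGap α / 96 →
      ‖transferFun α l i (Complex.exp (-(z * (1 + u))))‖ ≤ C * ‖z * (1 + u)‖ ^ ((i : ℝ) - α) := by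
  have hg := sectorGap_pos h0 h1
  obtain ⟨C₁, hC₁, hδ⟩ := exists_norm_bdfPoly_exp_sub_le
  refine ⟨(C₁ * 25 + 1) ^ i * (1 + Real.exp 5) * (32 / sectorGap α), by positivity,
    fun l hl z u hz hz1 hi hu => ?_⟩
  have hz4 := norm_le_four_of_strip hz hz1 hi
  obtain ⟨-, -, n3⟩ := norm_mul_one_add_le (z := z) (hu.trans (sectorGap_div_le h0 h1))
  obtain ⟨-, b2, -⟩ := exact_lower_bound' h0 h1 hl hz hu
  have b3 := schemeFun_exp_lower_bound' h0 h1 hl hz hz1 hi hu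
  set x := z * (1 + u)
  have hx5 : ‖x‖ ≤ 5 := by linarith
  have d1 : ‖bdfPoly (Complex.exp (-x))‖ ≤ (C₁ * 25 + 1) * ‖x‖ := by
    have e : bdfPoly (Complex.exp (-x)) = (bdfPoly (Complex.exp (-x)) - x) + x := by ring
    rw [e]
    refine (norm_add_le _ _).trans ?_
    have h3 := hδ x hx5
    have h4 : ‖x‖ ^ 3 ≤ 25 * ‖x‖ := cube_le_of_le_five (norm_nonneg x) hx5
    nlinarith [mul_le_mul_of_nonneg_left h4 hC₁]
  have d2 := norm_cnPoly_le h0 h1 (norm_exp_neg_le_of_norm_le hx5)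
  rw [transferFun, norm_div, norm_mul, norm_pow]
  calc ‖bdfPoly (Complex.exp (-x))‖ ^ i * ‖cnPoly α (Complex.exp (-x))‖
        / ‖schemeFun α l (Complex.exp (-x))‖
      ≤ ((C₁ * 25 + 1) * ‖x‖) ^ i * (1 + Real.exp 5) / (sectorGap α / 32 * ‖x‖ ^ α) := by gcongr
    _ = _ := by
      rw [Real.rpow_sub b2, Real.rpow_natCast, mul_pow]; field_simp

/-- Second order consistency of the scheme in Laplace space, uniformly in the spectral
parameter. -/
theorem exists_norm_discreteSymbol_sub_exactSymbol_le {i : ℕ} (hi12 : i = 1 ∨ i = 2) (b : ℝ) :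
    ∃ C : ℝ, 0 ≤ C ∧ ∀ l : ℝ, 0 ≤ l → ∀ z u : ℂ, 0 < z.re → z.re ≤ 1 → |z.im| ≤ Real.pi →
      ‖u‖ ≤ sectorGap α / 96 →
      ‖discreteSymbol α l b i (z * (1 + u)) - exactSymbol α l (b - i) (z * (1 + u))‖
        ≤ C * ‖z * (1 + u)‖ ^ ((i : ℝ) - b - α + 2) := by
  have hg := sectorGap_pos h0 h1
  obtain ⟨C₁, hC₁, hδ⟩ := exists_norm_bdfPoly_exp_sub_le
  obtain ⟨C₂, hC₂, hM⟩ := exists_norm_cnPoly_mul_cpow_sub_le h0 h1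
  set g := sectorGap α / 32 with hgdef
  have hgp : 0 < g := by positivity
  set K := C₁ * (C₁ * 25 + 2) with hK
  refine ⟨(C₁ + K) * (1 + Real.exp 5) / g + C₂ / g ^ 2, by positivity,
    fun l hl z u hz hz1 hi hu => ?_⟩
  have hz4 := norm_le_four_of_strip hz hz1 hi
  have hu8 := hu.trans (sectorGap_div_le h0 h1)
  obtain ⟨-, -, n3⟩ := norm_mul_one_add_le (z := z) hu8
  obtain ⟨-, b2, b1⟩ := exact_lower_bound' h0 h1 hl hz hu
  have b3 := schemeFun_exp_lower_bound' h0 h1 hl hz hz1 hi hu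
  have hMx := hM z u hz hz1 hi hu8
  set x := z * (1 + u)
  rw [← hgdef] at b1 b3
  have hx0 : x ≠ 0 := norm_pos_iff.1 b2
  have hx5 : ‖x‖ ≤ 5 := by linarith
  have d2 := norm_cnPoly_le h0 h1 (norm_exp_neg_le_of_norm_le hx5)
  have hδx := hδ x hx5
  have hS0 : schemeFun α l (Complex.exp (-x)) ≠ 0 := by
    rw [← norm_pos_iff]; exact lt_of_lt_of_le (by positivity) b3
  have hL0 : x ^ (α : ℂ) + l ≠ 0 := by
    rw [← norm_pos_iff]; exact lt_of_lt_of_le (by positivity) b1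
  have dd : ‖bdfPoly (Complex.exp (-x)) ^ i - x ^ i‖ ≤ (C₁ + K) * ‖x‖ ^ (i + 2) := by
    have hKn : 0 ≤ K := by positivity
    rcases hi12 with rfl | rfl
    · rw [pow_one, pow_one]
      refine hδx.trans ?_
      have : 0 ≤ K * ‖x‖ ^ 3 := by positivity
      rw [add_mul]
      exact le_add_of_nonneg_right this
    · have e : bdfPoly (Complex.exp (-x)) ^ 2 - x ^ 2
          = (bdfPoly (Complex.exp (-x)) - x) * ((bdfPoly (Complex.exp (-x)) - x) + 2 * x) := by
        ring
      have h4 : ‖x‖ ^ 3 ≤ 25 * ‖x‖ := cube_le_of_le_five (norm_nonneg x) hx5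
      have h5 : ‖bdfPoly (Complex.exp (-x)) - x + 2 * x‖ ≤ (C₁ * 25 + 2) * ‖x‖ := by
        refine (norm_add_le _ _).trans ?_
        rw [norm_mul, Complex.norm_two]
        nlinarith [mul_le_mul_of_nonneg_left h4 hC₁]
      rw [e, norm_mul]
      calc _ ≤ (C₁ * ‖x‖ ^ 3) * ((C₁ * 25 + 2) * ‖x‖) := by gcongr
        _ = K * ‖x‖ ^ 4 := by rw [hK]; ring
        _ ≤ (C₁ + K) * ‖x‖ ^ (2 + 2) := by
          have : 0 ≤ C₁ * ‖x‖ ^ 4 := by positivity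
          rw [add_mul]
          exact le_add_of_nonneg_left this
  have e1 : discreteSymbol α l b i x - exactSymbol α l (b - i) x
      = x ^ (-(b : ℂ)) * ((bdfPoly (Complex.exp (-x)) ^ i - x ^ i) * cnPoly α (Complex.exp (-x))
          / schemeFun α l (Complex.exp (-x))
        + x ^ i * (cnPoly α (Complex.exp (-x)) * x ^ (α : ℂ) - (1 - Complex.exp (-x)) ^ (α : ℂ))
          / (schemeFun α l (Complex.exp (-x)) * (x ^ (α : ℂ) + l))) := by
    have ep : x ^ (-((b - i : ℝ) : ℂ)) = x ^ (-(b : ℂ)) * x ^ i := by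
      rw [← Complex.cpow_natCast, ← Complex.cpow_add _ _ hx0]
      congr 1; push_cast; ring
    have eS : (1 - Complex.exp (-x)) ^ (α : ℂ)
        = schemeFun α l (Complex.exp (-x)) - l * cnPoly α (Complex.exp (-x)) := by
      rw [schemeFun]; ring
    rw [discreteSymbol, exactSymbol, transferFun, ep, eS]
    field_simp
    ring
  rw [e1, norm_mul, ← Complex.ofReal_neg, Complex.norm_cpow_real]
  have t1 : ‖(bdfPoly (Complex.exp (-x)) ^ i - x ^ i) * cnPoly α (Complex.exp (-x))
          / schemeFun α l (Complex.exp (-x))‖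
      ≤ (C₁ + K) * ‖x‖ ^ (i + 2) * (1 + Real.exp 5) / (g * ‖x‖ ^ α) := by
    rw [norm_div, norm_mul]
    gcongr
  have t2 : ‖x ^ i * (cnPoly α (Complex.exp (-x)) * x ^ (α : ℂ)
          - (1 - Complex.exp (-x)) ^ (α : ℂ))
          / (schemeFun α l (Complex.exp (-x)) * (x ^ (α : ℂ) + l))‖
      ≤ ‖x‖ ^ i * (C₂ * ‖x‖ ^ (α + 2)) / ((g * ‖x‖ ^ α) * (g * ‖x‖ ^ α)) := by
    rw [norm_div, norm_mul, norm_mul, norm_pow]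
    gcongr
  refine (mul_le_mul_of_nonneg_left ((norm_add_le _ _).trans (add_le_add t1 t2))
    (by positivity)).trans (le_of_eq ?_)
  have p1 : ‖x‖ ^ ((i : ℝ) - b - α + 2) = ‖x‖ ^ (-b) * ‖x‖ ^ i * ‖x‖ ^ 2 / ‖x‖ ^ α := by
    rw [← Real.rpow_natCast _ i, ← Real.rpow_natCast _ 2, ← Real.rpow_add b2, ← Real.rpow_add b2,
      ← Real.rpow_sub b2]
    congr 1; push_cast; ring
  have p2 : ‖x‖ ^ (α + 2) = ‖x‖ ^ α * ‖x‖ ^ 2 := by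
    rw [Real.rpow_add b2, Real.rpow_two]
  have hA : 0 < ‖x‖ ^ α := by positivity
  rw [p1, p2, pow_add]
  field_simp

/-- Consistency of second order for the third derivatives, by a Cauchy estimate on a disc whose
radius is proportional to `‖z‖`. -/
theorem exists_norm_iteratedDeriv_symbol_sub_le {i : ℕ} (hi12 : i = 1 ∨ i = 2) (b : ℝ) :
    ∃ C : ℝ, 0 ≤ C ∧ ∀ l : ℝ, 0 ≤ l → ∀ z : ℂ, 0 < z.re → z.re ≤ 1 → |z.im| ≤ Real.pi →
      ‖iteratedDeriv 3 (discreteSymbol α l b i - exactSymbol α l (b - i)) z‖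
        ≤ C * ‖z‖ ^ ((i : ℝ) - b - α - 1) := by
  have hg := sectorGap_pos h0 h1
  obtain ⟨C, hC, hb⟩ := exists_norm_discreteSymbol_sub_exactSymbol_le h0 h1 hi12 b
  set p := (i : ℝ) - b - α + 2 with hp
  refine ⟨6 * (C * 2 ^ |p|) / (sectorGap α / 96) ^ 3, by positivity, fun l hl z hz hz1 hi => ?_⟩
  have hz0 := ne_zero_of_re_pos hz
  have hzn : 0 < ‖z‖ := norm_pos_iff.2 hz0
  refine (norm_iteratedDeriv_three_le (ε := sectorGap α / 96)
    (K := C * 2 ^ |p| * ‖z‖ ^ p) hz0 (by positivity) ?_ ?_).trans ?_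
  · intro u hu
    obtain ⟨b1, b2, b3⟩ := exact_lower_bound' h0 h1 hl hz hu
    have s3 := schemeFun_exp_lower_bound' h0 h1 hl hz hz1 hi hu
    refine (differentiableAt_discreteSymbol b1
      (schemeFun_exp_lower_bound h0 h1 hl hz hz1 hi hu).1 ?_).sub
      (differentiableAt_exactSymbol b1 ?_)
    · rw [← norm_pos_iff]; exact lt_of_lt_of_le (by positivity) s3
    · rw [← norm_pos_iff]; exact lt_of_lt_of_le (by positivity) b3
  · intro u hu
    obtain ⟨n1, n2, -⟩ := norm_mul_one_add_le (z := z) (hu.trans (sectorGap_div_le h0 h1))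
    refine (hb l hl z u hz hz1 hi hu).trans ?_
    rw [mul_assoc]
    gcongr
    exact rpow_le_two_rpow_abs_mul hzn n1 n2 _
  · apply le_of_eq
    have : (i : ℝ) - b - α - 1 = p - (3 : ℕ) := by rw [hp]; push_cast; ring
    rw [this, Real.rpow_sub hzn, Real.rpow_natCast, mul_pow]
    field_simp

/-- Away from the real axis, in the period strips that do not contain the origin, the discrete
symbol has the singularity of the periodic factor only, and decays with the distance of the strip
from the origin. -/
theorem exists_norm_iteratedDeriv_discreteSymbol_le (i : ℕ) {b : ℝ}
    (hb0 : 0 ≤ b) :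
    ∃ C : ℝ, 0 ≤ C ∧ ∀ l : ℝ, 0 ≤ l → ∀ z : ℂ, 0 < z.re → z.re ≤ 1 → |z.im| ≤ Real.pi →
      ∀ j : ℤ, j ≠ 0 →
      ‖iteratedDeriv 3 (discreteSymbol α l b i) (z + j * (2 * Real.pi * Complex.I))‖
        ≤ C * |(j : ℝ)| ^ (-b) * ‖z‖ ^ ((i : ℝ) - α - 3) := by
  have hg := sectorGap_pos h0 h1
  obtain ⟨C, hC, hb⟩ := exists_norm_transferFun_exp_le h0 h1 i
  set p := (i : ℝ) - α with hp
  clear_value p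
  refine ⟨6 * (C * 2 ^ |p|) / (sectorGap α / 96) ^ 3, by positivity,
    fun l hl z hz hz1 hi j hj => ?_⟩
  have hz0 := ne_zero_of_re_pos hz
  have hzn : 0 < ‖z‖ := norm_pos_iff.2 hz0
  have hj1 : (1 : ℝ) ≤ |(j : ℝ)| := by exact_mod_cast Int.one_le_abs hj
  have hper : ∀ x : ℂ, Complex.exp (-(x + j * (2 * Real.pi * Complex.I))) = Complex.exp (-x) := by
    intro x
    rw [neg_add, ← sub_eq_add_neg, Complex.exp_sub, Complex.exp_int_mul_two_pi_mul_I, div_one]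
  have him : ∀ u : ℂ, ‖u‖ ≤ sectorGap α / 96 →
      |(j : ℝ)| ≤ |(z * (1 + u) + j * (2 * Real.pi * Complex.I)).im| := by
    intro u hu
    have hz4 := norm_le_four_of_strip hz hz1 hi
    have e : (z * (1 + u) + j * (2 * Real.pi * Complex.I)).im
        = j * (2 * Real.pi) - (-(z.im + (z * u).im)) := by
      simp [mul_add]; ring
    have f1 : |(z * u).im| ≤ 1 / 2 := by
      refine (Complex.abs_im_le_norm _).trans ?_
      rw [norm_mul]
      have := hu.trans (sectorGap_div_le h0 h1)
      nlinarith [norm_nonneg u]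
    have f2 : |-(z.im + (z * u).im)| ≤ Real.pi + 1 / 2 := by
      rw [abs_neg]; exact (abs_add_le _ _).trans (add_le_add hi f1)
    have f3 := abs_sub_abs_le_abs_sub ((j : ℝ) * (2 * Real.pi)) (-(z.im + (z * u).im))
    rw [abs_mul, abs_of_pos Real.two_pi_pos] at f3
    rw [e]
    have := Real.pi_gt_three
    nlinarith
  have htr : iteratedDeriv 3 (discreteSymbol α l b i) (z + j * (2 * Real.pi * Complex.I))
      = iteratedDeriv 3
          (fun x => discreteSymbol α l b i (x + j * (2 * Real.pi * Complex.I))) z := by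
    rw [iteratedDeriv_comp_add_const]
  rw [htr]
  refine (norm_iteratedDeriv_three_le (ε := sectorGap α / 96)
    (K := |(j : ℝ)| ^ (-b) * (C * 2 ^ |p| * ‖z‖ ^ p)) hz0 (by positivity) ?_ ?_).trans ?_
  · intro u hu
    have s3 := schemeFun_exp_lower_bound' h0 h1 hl hz hz1 hi hu
    obtain ⟨-, b2, -⟩ := exact_lower_bound' h0 h1 hl hz hu
    have hd := (differentiableAt_discreteSymbol (α := α) (l := l) (b := b) (i := i)
      (z := z * (1 + u) + j * (2 * Real.pi * Complex.I)) ?_ ?_ ?_)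
    · exact hd.comp (z * (1 + u)) (differentiableAt_id.add_const _)
    · right
      have := him u hu
      intro h
      rw [h, abs_zero] at this
      linarith
    · rw [hper]; exact (schemeFun_exp_lower_bound h0 h1 hl hz hz1 hi hu).1
    · rw [hper, ← norm_pos_iff]; exact lt_of_lt_of_le (by positivity) s3
  · intro u hu
    obtain ⟨n1, n2, -⟩ := norm_mul_one_add_le (z := z) (hu.trans (sectorGap_div_le h0 h1))
    simp only [discreteSymbol]
    rw [hper, norm_mul, ← Complex.ofReal_neg, Complex.norm_cpow_real]
    have q1 := (him u hu).trans (Complex.abs_im_le_norm _)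
    have q2 := Real.rpow_le_rpow_of_nonpos (by linarith) q1 (neg_nonpos.2 hb0)
    have q3 : ‖transferFun α l i (Complex.exp (-(z * (1 + u))))‖ ≤ C * 2 ^ |p| * ‖z‖ ^ p := by
      refine (hb l hl z u hz hz1 hi hu).trans ?_
      rw [mul_assoc]
      gcongr
      exact rpow_le_two_rpow_abs_mul hzn n1 n2 _
    exact mul_le_mul q2 q3 (norm_nonneg _) (by positivity)
  · apply le_of_eq
    have : p - 3 = p - (3 : ℕ) := by push_cast; ring
    rw [this, Real.rpow_sub hzn, Real.rpow_natCast, mul_pow]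
    field_simp

end Bounds

/-! ### Laplace transforms and their inversion -/

/-- The Riemann-Liouville kernel `t^(b-1) / Γ(b)`, extended by zero to `t ≤ 0`. -/
def fracKernel (b t : ℝ) : ℝ := if t ≤ 0 then 0 else t ^ (b - 1) / Real.Gamma b

theorem fracKernel_of_nonpos {b t : ℝ} (h : t ≤ 0) : fracKernel b t = 0 := if_pos h

theorem fracKernel_of_pos {b t : ℝ} (h : 0 < t) :
    fracKernel b t = t ^ (b - 1) / Real.Gamma b := if_neg h.not_ge

theorem fracKernel_nonneg {b : ℝ} (hb : 0 < b) (t : ℝ) : 0 ≤ fracKernel b t := by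
  unfold fracKernel
  split_ifs with h
  · exact le_rfl
  · exact div_nonneg (Real.rpow_nonneg (not_le.1 h).le _) (Real.Gamma_pos_of_pos hb).le

theorem measurable_fracKernel (b : ℝ) : Measurable (fracKernel b) :=
  Measurable.ite measurableSet_Iic measurable_const (by fun_prop)

theorem fracKernel_mul_exp_eq_indicator (b σ : ℝ) :
    (fun t => fracKernel b t * Real.exp (-(σ * t)))
      = (Ioi 0).indicator (fun t => t ^ (b - 1) * Real.exp (-(σ * t)) / Real.Gamma b) := by
  ext t
  rcases le_or_gt t 0 with h | h
  · rw [fracKernel_of_nonpos h, indicator_of_notMem (by simpa using h), zero_mul]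
  · rw [fracKernel_of_pos h, indicator_of_mem (by simpa using h)]; ring

theorem integrable_fracKernel_mul_exp {b σ : ℝ} (hb : 0 < b) (hσ : 0 < σ) :
    Integrable (fun t => fracKernel b t * Real.exp (-(σ * t))) := by
  rw [fracKernel_mul_exp_eq_indicator, integrable_indicator_iff measurableSet_Ioi]
  have := (integrableOn_rpow_mul_exp_neg_mul_rpow (p := 1) (s := b - 1) (b := σ)
    (by linarith) one_pos hσ).div_const (Real.Gamma b)
  simpa [IntegrableOn, Real.rpow_one, neg_mul] using this

theorem integral_fracKernel_mul_exp {b σ : ℝ} (hb : 0 < b) (hσ : 0 < σ) :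
    ∫ t, fracKernel b t * Real.exp (-(σ * t)) = σ ^ (-b) := by
  rw [fracKernel_mul_exp_eq_indicator, integral_indicator measurableSet_Ioi, integral_div,
    Real.integral_rpow_mul_exp_neg_mul_Ioi hb hσ, mul_div_assoc,
    div_self (Real.Gamma_pos_of_pos hb).ne', mul_one, one_div, Real.inv_rpow hσ.le,
    Real.rpow_neg hσ.le]

theorem integrable_fracKernel_mul_cexp {b : ℝ} {z : ℂ} (hb : 0 < b) (hz : 0 < z.re) :
    Integrable (fun t : ℝ => (fracKernel b t : ℂ) * Complex.exp (-(z * t))) := by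
  refine (integrable_fracKernel_mul_exp hb hz).congr' ?_ ?_
  · have := measurable_fracKernel b
    fun_prop
  · refine Filter.Eventually.of_forall fun t => ?_
    rw [norm_mul, norm_mul, Complex.norm_real, Complex.norm_exp]
    simp

theorem isPreconnected_re_gt (σ : ℝ) : IsPreconnected {z : ℂ | σ < z.re} :=
  (convex_halfSpace_re_gt σ).isPreconnected

theorem isOpen_re_gt (σ : ℝ) : IsOpen {z : ℂ | σ < z.re} :=
  isOpen_lt continuous_const Complex.continuous_re

/-- The Laplace transform of `t^(b-1) / Γ(b)` is `z⁻ᵇ`, by analytic continuation from the positive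
real axis. -/
theorem integral_fracKernel_mul_cexp {b : ℝ} {z : ℂ} (hb : 0 < b) (hz : 0 < z.re) :
    ∫ t : ℝ, (fracKernel b t : ℂ) * Complex.exp (-(z * t)) = z ^ (-(b : ℂ)) := by
  set ν : Measure ℝ := volume.withDensity (fun t => ENNReal.ofReal (fracKernel b t)) with hν
  have hm : Measurable fun t => ENNReal.ofReal (fracKernel b t) :=
    (measurable_fracKernel b).ennreal_ofReal
  have hfin : ∀ᵐ t ∂(volume : Measure ℝ), ENNReal.ofReal (fracKernel b t) < ⊤ :=
    Filter.Eventually.of_forall fun t => ENNReal.ofReal_lt_top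
  have hset : Ioi (0 : ℝ) ⊆ ProbabilityTheory.integrableExpSet (fun t : ℝ => -t) ν := by
    intro σ hσ
    rw [ProbabilityTheory.integrableExpSet, Set.mem_ofPred_eq, hν,
      integrable_withDensity_iff_integrable_smul' hm hfin]
    refine (integrable_fracKernel_mul_exp hb hσ).congr (Filter.Eventually.of_forall fun t => ?_)
    simp [ENNReal.toReal_ofReal (fracKernel_nonneg hb t)]
  have hint : ∀ w : ℂ, ProbabilityTheory.complexMGF (fun t : ℝ => -t) ν w
      = ∫ t : ℝ, (fracKernel b t : ℂ) * Complex.exp (-(w * t)) := by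
    intro w
    rw [ProbabilityTheory.complexMGF, hν, integral_withDensity_eq_integral_toReal_smul hm hfin]
    refine integral_congr_ae (Filter.Eventually.of_forall fun t => ?_)
    simp [ENNReal.toReal_ofReal (fracKernel_nonneg hb t)]
  have hA : AnalyticOnNhd ℂ (ProbabilityTheory.complexMGF (fun t : ℝ => -t) ν)
      {w : ℂ | 0 < w.re} := by
    refine ProbabilityTheory.analyticOnNhd_complexMGF.mono fun w hw => ?_
    exact interior_mono hset (by rwa [interior_Ioi])
  have hB : AnalyticOnNhd ℂ (fun w : ℂ => w ^ (-(b : ℂ))) {w : ℂ | 0 < w.re} := by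
    refine DifferentiableOn.analyticOnNhd (fun w hw => ?_) (isOpen_re_gt 0)
    exact (differentiableAt_id.cpow_const (Or.inl hw)).differentiableWithinAt
  rw [← hint]
  refine hA.eqOn_of_preconnected_of_frequently_eq hB (isPreconnected_re_gt 0)
    (z₀ := (1 : ℂ)) (by simp) ?_ hz
  -- The two sides agree at `1 + 1/(n+1)`, and these points accumulate at `1`.
  have hseq : Filter.Tendsto (fun n : ℕ => ((1 + 1 / ((n : ℝ) + 1) : ℝ) : ℂ)) Filter.atTop
      (nhdsWithin 1 {1}ᶜ) := by
    refine tendsto_nhdsWithin_iff.2 ⟨?_, Filter.Eventually.of_forall fun n => ?_⟩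
    · have h1 : Filter.Tendsto (fun n : ℕ => 1 + 1 / ((n : ℝ) + 1)) Filter.atTop (nhds (1 + 0)) :=
        tendsto_const_nhds.add tendsto_one_div_add_atTop_nhds_zero_nat
      have h2 := (Complex.continuous_ofReal.tendsto _).comp h1
      simpa [Function.comp_def] using h2
    · have : (0 : ℝ) < 1 / ((n : ℝ) + 1) := by positivity
      intro h
      have h' : ((1 + 1 / ((n : ℝ) + 1) : ℝ) : ℂ) = ((1 : ℝ) : ℂ) := by simpa using h
      have := Complex.ofReal_injective h'
      linarith
  refine hseq.frequently (Filter.Frequently.of_forall fun n => ?_)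
  have hp : (0 : ℝ) < 1 + 1 / ((n : ℝ) + 1) := by positivity
  rw [hint]
  have := integral_fracKernel_mul_exp hb hp
  rw [← Complex.ofReal_neg, ← Complex.ofReal_cpow hp.le, ← this, ← integral_complex_ofReal]
  refine integral_congr_ae (Filter.Eventually.of_forall fun t => ?_)
  push_cast
  rfl

/-- The point `σ + i y`. -/
def linePt (σ y : ℝ) : ℂ := σ + y * Complex.I

@[simp] theorem linePt_re (σ y : ℝ) : (linePt σ y).re = σ := by simp [linePt]

@[simp] theorem linePt_im (σ y : ℝ) : (linePt σ y).im = y := by simp [linePt]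

theorem continuous_linePt (σ : ℝ) : Continuous (linePt σ) := by
  unfold linePt; fun_prop

theorem deriv_comp_linePt {F : ℂ → ℂ} {σ₀ σ : ℝ} (hF : DifferentiableOn ℂ F {z | σ₀ < z.re})
    (hσ : σ₀ < σ) (c : ℂ) :
    deriv (fun ξ : ℝ => c * F (linePt σ (2 * Real.pi * ξ)))
      = fun ξ : ℝ => (c * (2 * Real.pi * Complex.I)) * deriv F (linePt σ (2 * Real.pi * ξ)) := by
  ext ξ
  have h1 : HasDerivAt F (deriv F (linePt σ (2 * Real.pi * ξ))) (linePt σ (2 * Real.pi * ξ)) :=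
    ((hF _ (by simpa using hσ)).differentiableAt
      ((isOpen_re_gt σ₀).mem_nhds (by simpa using hσ))).hasDerivAt
  have h2 : HasDerivAt (fun ξ : ℝ => linePt σ (2 * Real.pi * ξ)) (2 * Real.pi * Complex.I) ξ := by
    have h3 : HasDerivAt (fun ξ : ℝ => (ξ : ℂ)) 1 ξ := Complex.ofRealCLM.hasDerivAt
    have h4 := ((h3.const_mul (2 * Real.pi * Complex.I)).const_add (σ : ℂ))
    rw [mul_one] at h4
    have e : (fun ξ : ℝ => linePt σ (2 * Real.pi * ξ))
        = fun x : ℝ => (σ : ℂ) + 2 * Real.pi * Complex.I * x := by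
      funext x
      simp only [linePt]; push_cast; ring
    rw [e]
    exact h4
  have h3 := (h1.scomp ξ h2).const_mul c
  rw [show (fun ξ : ℝ => c * F (linePt σ (2 * Real.pi * ξ)))
    = fun y => c * (F ∘ fun ξ => linePt σ (2 * Real.pi * ξ)) y from rfl, h3.deriv]
  simp; ring

theorem differentiableOn_deriv_re_gt {F : ℂ → ℂ} {σ₀ : ℝ}
    (hF : DifferentiableOn ℂ F {z | σ₀ < z.re}) : DifferentiableOn ℂ (deriv F) {z | σ₀ < z.re} :=
  hF.deriv (isOpen_re_gt σ₀)

theorem iteratedDeriv_comp_linePt {F : ℂ → ℂ} {σ₀ σ : ℝ}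
    (hF : DifferentiableOn ℂ F {z | σ₀ < z.re}) (hσ : σ₀ < σ) (ξ : ℝ) :
    iteratedDeriv 3 (fun ξ : ℝ => F (linePt σ (2 * Real.pi * ξ))) ξ
      = (2 * Real.pi * Complex.I) ^ 3 * iteratedDeriv 3 F (linePt σ (2 * Real.pi * ξ)) := by
  have e1 := deriv_comp_linePt hF hσ 1
  have e2 := deriv_comp_linePt (differentiableOn_deriv_re_gt hF) hσ (1 * (2 * Real.pi * Complex.I))
  have e3 := deriv_comp_linePt (differentiableOn_deriv_re_gt (differentiableOn_deriv_re_gt hF)) hσ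
    (1 * (2 * Real.pi * Complex.I) * (2 * Real.pi * Complex.I))
  simp only [iteratedDeriv_succ, iteratedDeriv_zero]
  simp only [one_mul] at e1 e2 e3
  rw [e1, e2, e3]
  ring

/-- Laplace inversion along a vertical line, after multiplication by `t³`, which corresponds to
three derivatives of the transform. The derivatives improve the decay of the transform at infinity
and turn the order of its singularity at the origin into decay in time. -/
theorem laplace_inversion {f : ℝ → ℂ} {L : ℂ → ℂ} {σ₀ σ s : ℝ} (hσ : σ₀ < σ)
    (hneg : ∀ t ≤ 0, f t = 0)
    (hf : ∀ σ', σ₀ < σ' → Integrable fun t : ℝ => f t * Complex.exp (-((σ' : ℂ) * t)))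
    (hL : ∀ z : ℂ, σ₀ < z.re → ∫ t : ℝ, f t * Complex.exp (-(z * t)) = L z)
    (hd : DifferentiableOn ℂ L {z | σ₀ < z.re})
    (hi : Integrable fun y : ℝ => iteratedDeriv 3 L (linePt σ y)) (hs : ContinuousAt f s) :
    (s : ℂ) ^ 3 * f s = -(1 / (2 * Real.pi)) *
      ∫ y : ℝ, Complex.exp (linePt σ y * s) * iteratedDeriv 3 L (linePt σ y) := by
  have hpi := Real.pi_pos
  set g : ℝ → ℂ := fun t => f t * Complex.exp (-((σ : ℂ) * t)) with hg
  -- moments of the weighted function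
  have hmom : ∀ n : ℕ, Integrable fun t : ℝ => t ^ n • g t := by
    intro n
    set σ' := (σ₀ + σ) / 2
    have h1 := hf σ' (by simp only [σ']; linarith)
    set δ := σ - σ' with hδ
    have hδ0 : 0 < δ := by simp only [hδ, σ']; linarith
    have hb : ∀ t : ℝ, 0 ≤ t → t ^ n * Real.exp (-(δ * t)) ≤ n.factorial / δ ^ n := by
      intro t ht
      have := Real.pow_div_factorial_le_exp (δ * t) (by positivity) n
      rw [div_le_iff₀ (by positivity), mul_pow] at this
      rw [le_div_iff₀ (by positivity), Real.exp_neg]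
      have he := Real.exp_pos (δ * t)
      field_simp
      linarith
    have := h1.norm.const_mul (n.factorial / δ ^ n)
    refine this.mono' ?_ (Filter.Eventually.of_forall fun t => ?_)
    · exact (by fun_prop : Continuous fun t : ℝ => t ^ n).aestronglyMeasurable.smul
        (hf σ hσ).aestronglyMeasurable
    · rcases le_or_gt t 0 with ht | ht
      · simp [hg, hneg t ht]
      · have e : Complex.exp (-((σ : ℂ) * t))
            = Complex.exp (-((σ' : ℂ) * t)) * Real.exp (-(δ * t)) := by
          rw [Complex.ofReal_exp, ← Complex.exp_add]
          congr 1
          rw [hδ]; push_cast; ring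
        simp only [hg]
        rw [norm_smul, e, ← mul_assoc, norm_mul _ ((Real.exp (-(δ * t)) : ℝ) : ℂ),
          Complex.norm_real, Real.norm_of_nonneg (Real.exp_pos _).le, norm_pow,
          Real.norm_of_nonneg ht.le]
        have := mul_le_mul_of_nonneg_right (hb t ht.le)
          (norm_nonneg (f t * Complex.exp (-((σ' : ℂ) * t))))
        linarith
  have hFg : FourierTransform.fourier g = fun ξ : ℝ => L (linePt σ (2 * Real.pi * ξ)) := by
    ext ξ
    rw [Real.fourier_real_eq_integral_exp_smul, ← hL _ (by simpa using hσ)]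
    congr 1
    ext t
    rw [smul_eq_mul, hg, mul_left_comm, ← Complex.exp_add]
    congr 2
    simp [linePt]; ring
  have h3 := Real.iteratedDeriv_fourier (f := g) (N := ⊤) (n := 3) (fun n _ => hmom n) le_top
  set h : ℝ → ℂ := fun t => (t : ℂ) ^ 3 * g t with hh
  have hFh : FourierTransform.fourier h
      = fun ξ : ℝ => -iteratedDeriv 3 L (linePt σ (2 * Real.pi * ξ)) := by
    ext ξ
    have h4 := congrFun h3 ξ
    rw [hFg, iteratedDeriv_comp_linePt hd hσ] at h4
    have e : (fun x : ℝ => (-2 * (Real.pi : ℂ) * Complex.I * x) ^ 3 • g x)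
        = fun x => (-(2 * Real.pi * Complex.I) ^ 3 : ℂ) • h x := by
      ext x; simp only [hh, smul_eq_mul]; ring
    have e2 : FourierTransform.fourier (fun x => (-(2 * Real.pi * Complex.I) ^ 3 : ℂ) • h x) ξ
        = (-(2 * Real.pi * Complex.I) ^ 3 : ℂ) * FourierTransform.fourier h ξ := by
      rw [Real.fourier_real_eq_integral_exp_smul, Real.fourier_real_eq_integral_exp_smul,
        ← integral_const_mul]
      congr 1; ext t; simp only [smul_eq_mul]; ring
    rw [e, e2] at h4
    have hne : (2 * (Real.pi : ℂ) * Complex.I) ^ 3 ≠ 0 := by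
      refine pow_ne_zero _ (mul_ne_zero (mul_ne_zero two_ne_zero ?_) Complex.I_ne_zero)
      exact_mod_cast hpi.ne'
    apply mul_left_cancel₀ hne
    linear_combination h4
  have hhint : Integrable h := by
    refine (hmom 3).congr (Filter.Eventually.of_forall fun t => ?_)
    simp [hh]
  have hFhint : Integrable (FourierTransform.fourier h) := by
    rw [hFh]
    exact (hi.comp_mul_left' (by positivity : (2 * Real.pi) ≠ 0)).neg
  have hcont : ContinuousAt h s := by
    simp only [hh, hg]
    exact ((by fun_prop : Continuous fun t : ℝ => (t : ℂ) ^ 3).continuousAt).mul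
      (hs.mul (by fun_prop : Continuous fun t : ℝ =>
        Complex.exp (-((σ : ℂ) * t))).continuousAt)
  have hinv := hhint.fourierInv_fourier_eq hFhint hcont
  rw [Real.fourierInv_eq', hFh] at hinv
  have e5 : (s : ℂ) ^ 3 * f s = Complex.exp (σ * s) * h s := by
    simp only [hh, hg]
    rw [mul_left_comm, mul_left_comm _ (f s), ← Complex.exp_add, add_neg_cancel, Complex.exp_zero]
    ring
  rw [e5, ← hinv, ← integral_const_mul]
  have e6 := Measure.integral_comp_mul_left (fun y : ℝ => Complex.exp (linePt σ y * s)
    * iteratedDeriv 3 L (linePt σ y)) (2 * Real.pi)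
  rw [abs_of_pos (by positivity), Complex.real_smul] at e6
  have e7 : (-(1 / (2 * Real.pi)) : ℂ) * ∫ y : ℝ, Complex.exp (linePt σ y * s)
        * iteratedDeriv 3 L (linePt σ y)
      = -∫ x : ℝ, Complex.exp (linePt σ (2 * Real.pi * x) * s)
        * iteratedDeriv 3 L (linePt σ (2 * Real.pi * x)) := by
    rw [e6]; push_cast; ring
  rw [e7, ← integral_neg]
  congr 1
  ext ξ
  rw [smul_eq_mul, ← mul_assoc, ← Complex.exp_add, mul_neg]
  congr 3
  simp [linePt]; ring

/-! ### Vertical lines -/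

theorem norm_linePt_rpow {σ : ℝ} (hσ : 0 < σ) (p y : ℝ) :
    ‖linePt σ y‖ ^ (-p) = σ ^ (-p) * (1 + ‖σ⁻¹ * y‖ ^ 2) ^ (-p / 2) := by
  have h1 : ‖linePt σ y‖ ^ 2 = σ ^ 2 * (1 + ‖σ⁻¹ * y‖ ^ 2) := by
    rw [← Complex.normSq_eq_norm_sq, Complex.normSq_apply, linePt_re, linePt_im, Real.norm_eq_abs,
      sq_abs]
    field_simp
  have h2 : ‖linePt σ y‖ ^ (-p) = (‖linePt σ y‖ ^ 2) ^ (-p / 2) := by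
    rw [← Real.rpow_two, ← Real.rpow_mul (norm_nonneg _)]
    congr 1; ring
  rw [h2, h1, Real.mul_rpow (by positivity) (by positivity), ← Real.rpow_two,
    ← Real.rpow_mul hσ.le]
  congr 2; ring

/-- The constant `∫ (1 + y²)^(-p/2) dy`. -/
def bracketIntegral (p : ℝ) : ℝ := ∫ y : ℝ, (1 + ‖y‖ ^ 2) ^ (-p / 2)

theorem bracketIntegral_nonneg (p : ℝ) : 0 ≤ bracketIntegral p :=
  integral_nonneg fun y => by positivity

theorem integrable_norm_linePt_rpow {σ p : ℝ} (hσ : 0 < σ) (hp : 1 < p) :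
    Integrable fun y : ℝ => ‖linePt σ y‖ ^ (-p) := by
  simp_rw [norm_linePt_rpow hσ]
  have := (integrable_rpow_neg_one_add_norm_sq (E := ℝ) (μ := volume) (r := p) (by simpa using hp))
  exact (this.comp_mul_left' (inv_ne_zero hσ.ne')).const_mul _

theorem integral_norm_linePt_rpow {σ p : ℝ} (hσ : 0 < σ) :
    ∫ y : ℝ, ‖linePt σ y‖ ^ (-p) = σ ^ (1 - p) * bracketIntegral p := by
  simp_rw [norm_linePt_rpow hσ]
  rw [integral_const_mul, Measure.integral_comp_mul_left (fun y => (1 + ‖y‖ ^ 2) ^ (-p / 2)) σ⁻¹,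
    inv_inv, abs_of_pos hσ, smul_eq_mul, ← mul_assoc, bracketIntegral]
  congr 1
  rw [sub_eq_add_neg, Real.rpow_add hσ, Real.rpow_one, mul_comm]

/-- Cauchy's theorem for a vertical strip. -/
theorem integral_linePt_eq {Ψ : ℂ → ℂ} {σ₁ σ₂ K p : ℝ} (h1 : 0 < σ₁) (h12 : σ₁ ≤ σ₂) (hp : 1 < p)
    (hK : 0 ≤ K) (hd : DifferentiableOn ℂ Ψ {z | 0 < z.re})
    (hb : ∀ z : ℂ, σ₁ ≤ z.re → z.re ≤ σ₂ → ‖Ψ z‖ ≤ K * ‖z‖ ^ (-p)) :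
    ∫ y : ℝ, Ψ (linePt σ₁ y) = ∫ y : ℝ, Ψ (linePt σ₂ y) := by
  have h2 : 0 < σ₂ := h1.trans_le h12
  have hint : ∀ σ, σ₁ ≤ σ → σ ≤ σ₂ → Integrable fun y : ℝ => Ψ (linePt σ y) := by
    intro σ ha hb'
    refine ((integrable_norm_linePt_rpow (h1.trans_le ha) hp).const_mul K).mono' ?_
      (Eventually.of_forall fun y => hb _ (by simpa using ha) (by simpa using hb'))
    refine Continuous.aestronglyMeasurable ?_
    refine hd.continuousOn.comp_continuous (continuous_linePt σ) fun y => ?_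
    simpa using h1.trans_le ha
  have hT : ∀ σ, σ₁ ≤ σ → σ ≤ σ₂ → Tendsto (fun R : ℝ => ∫ y in (-R)..R, Ψ (linePt σ y)) atTop
      (𝓝 (∫ y : ℝ, Ψ (linePt σ y))) := fun σ ha hb' =>
    intervalIntegral_tendsto_integral (hint σ ha hb') tendsto_neg_atTop_atBot tendsto_id
  -- the horizontal sides of the rectangle of height `2R`
  have hside : ∀ c : ℝ, |c| = 1 → Tendsto (fun R : ℝ => ∫ x in σ₁..σ₂,
      Ψ ((x : ℂ) + ((c * R : ℝ) : ℂ) * Complex.I)) atTop (𝓝 0) := by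
    intro c hc
    have hlim : Tendsto (fun R : ℝ => K * R ^ (-p) * |σ₂ - σ₁|) atTop (𝓝 (K * 0 * |σ₂ - σ₁|)) :=
      ((tendsto_rpow_neg_atTop (by linarith)).const_mul K).mul_const _
    rw [mul_zero, zero_mul] at hlim
    refine squeeze_zero_norm' ?_ hlim
    filter_upwards [eventually_gt_atTop 0] with R hR
    refine intervalIntegral.norm_integral_le_of_norm_le_const fun x hx => ?_
    rw [uIoc_of_le h12] at hx
    refine (hb _ (by simpa using hx.1.le) (by simpa using hx.2)).trans ?_
    refine mul_le_mul_of_nonneg_left (Real.rpow_le_rpow_of_nonpos hR ?_ (by linarith)) hK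
    refine le_trans (le_of_eq ?_) (Complex.abs_im_le_norm _)
    simp [abs_mul, hc, abs_of_pos hR]
  have hrect : ∀ R : ℝ, (∫ x in σ₁..σ₂, Ψ ((x : ℂ) + ((-1 * R : ℝ) : ℂ) * Complex.I))
      - (∫ x in σ₁..σ₂, Ψ ((x : ℂ) + ((1 * R : ℝ) : ℂ) * Complex.I))
      + Complex.I • (∫ y in (-R)..R, Ψ (linePt σ₂ y))
      - Complex.I • (∫ y in (-R)..R, Ψ (linePt σ₁ y)) = 0 := by
    intro R
    have := Complex.integral_boundary_rect_eq_zero_of_differentiableOn Ψ (linePt σ₁ (-R))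
      (linePt σ₂ R) (hd.mono fun z hz => ?_)
    · simpa [linePt] using this
    · have := hz.1
      simp only [linePt_re, mem_preimage, uIcc_of_le h12] at this
      exact h1.trans_le this.1
  have hlim := (((hside (-1) (by simp)).sub (hside 1 (by simp))).add
    ((hT σ₂ h12 le_rfl).const_smul Complex.I)).sub ((hT σ₁ le_rfl h12).const_smul Complex.I)
  have h0 := tendsto_nhds_unique hlim (tendsto_const_nhds.congr fun R => (hrect R).symm)
  rw [sub_zero, zero_add, sub_eq_zero] at h0
  exact (smul_right_injective ℂ Complex.I_ne_zero h0).symm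

/-! ### Series of integrable functions -/

theorem measurable_tsum_of_summable {E : Type*} [NormedAddCommGroup E] [MeasurableSpace E]
    [BorelSpace E] [SecondCountableTopology E] {F : ℕ → ℝ → E} (hF : ∀ k, Measurable (F k))
    (hs : ∀ t, Summable fun k => F k t) : Measurable fun t => ∑' k, F k t := by
  refine measurable_of_tendsto_metrizable (f := fun n t => ∑ k ∈ Finset.range n, F k t)
    (fun n => Finset.measurable_sum _ fun k _ => hF k) ?_
  rw [tendsto_pi_nhds]
  exact fun t => (hs t).hasSum.tendsto_sum_nat

theorem integrable_tsum_of_summable {F : ℕ → ℝ → ℂ} (hF : ∀ k, Integrable (F k))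
    (hsum : Summable fun k => ∫ t, ‖F k t‖)
    (hm : AEStronglyMeasurable fun t => ∑' k, F k t) :
    Integrable fun t => ∑' k, F k t := by
  refine ⟨hm, ?_⟩
  rw [hasFiniteIntegral_def]
  refine (lintegral_mono fun t => enorm_tsum_le_tsum_enorm).trans_lt ?_
  rw [lintegral_tsum fun k => (hF k).aestronglyMeasurable.enorm]
  have e : ∀ k, ∫⁻ t, ‖F k t‖ₑ = ENNReal.ofReal (∫ t, ‖F k t‖) := by
    intro k
    rw [ofReal_integral_eq_lintegral_ofReal (hF k).norm
      (Eventually.of_forall fun t => norm_nonneg _)]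
    simp_rw [ofReal_norm]
  simp_rw [e]
  rw [← ENNReal.ofReal_tsum_of_nonneg (fun k => integral_nonneg fun t => norm_nonneg _) hsum]
  exact ENNReal.ofReal_lt_top

/-! ### The exact solution kernel -/

theorem rpow_mul_exp_neg_le_Gamma {c x : ℝ} (hc : 0 ≤ c) (hx : 0 < x) :
    x ^ c * Real.exp (-x) ≤ Real.Gamma (c + 1) := by
  rw [Real.Gamma_eq_integral (by linarith), add_sub_cancel_right]
  have hint := Real.GammaIntegral_convergent (s := c + 1) (by linarith)
  rw [add_sub_cancel_right] at hint
  calc x ^ c * Real.exp (-x) = ∫ t in Ioi x, x ^ c * Real.exp (-t) := by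
        rw [integral_const_mul, integral_exp_neg_Ioi]
    _ ≤ ∫ t in Ioi x, Real.exp (-t) * t ^ c := by
        refine setIntegral_mono_on ((integrableOn_exp_neg_Ioi x).const_mul _)
          (hint.mono_set (Ioi_subset_Ioi hx.le)) measurableSet_Ioi fun t ht => ?_
        rw [mul_comm]
        gcongr
        exact ht.le
    _ ≤ ∫ t in Ioi 0, Real.exp (-t) * t ^ c :=
        setIntegral_mono_set hint (ae_restrict_of_forall_mem measurableSet_Ioi fun t ht => by
          have : (0 : ℝ) < t := ht
          positivity) (Ioi_subset_Ioi hx.le).eventuallyLE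

/-- A geometric bound for the kernels `t^(b-1) / Γ(b)` with a free parameter `x`. -/
theorem fracKernel_le {b t x : ℝ} (hb : 0 < b) (ht : 0 < t) (hx : 0 < x) :
    fracKernel b t ≤ b / t * (t / x) ^ b * Real.exp x := by
  have hG := rpow_mul_exp_neg_le_Gamma hb.le hx
  rw [Real.Gamma_add_one hb.ne', Real.exp_neg] at hG
  have hGp := Real.Gamma_pos_of_pos hb
  have he := Real.exp_pos x
  have hxb : 0 < x ^ b := Real.rpow_pos_of_pos hx b
  have htb : 0 < t ^ b := Real.rpow_pos_of_pos ht b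
  rw [fracKernel_of_pos ht, Real.rpow_sub ht, Real.rpow_one, Real.div_rpow ht.le hx.le]
  rw [div_le_iff₀ hGp]
  rw [← div_eq_mul_inv, div_le_iff₀ he] at hG
  have : b / t * (t ^ b / x ^ b) * Real.exp x * Real.Gamma b
      = t ^ b / t * ((b * Real.Gamma b * Real.exp x) / x ^ b) := by
    field_simp
  rw [this]
  have h1 : 1 ≤ (b * Real.Gamma b * Real.exp x) / x ^ b := by rwa [one_le_div hxb]
  have h2 : 0 ≤ t ^ b / t := by positivity
  nlinarith

/-- The `k`-th term of the Mittag-Leffler series of the exact solution kernel. -/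
def relaxTerm (α l a : ℝ) (k : ℕ) (t : ℝ) : ℝ := (-l) ^ k * fracKernel (a + α * (k + 1)) t

/-- The solution `t^(a+α-1) E_{α,a+α}(-l t^α)` of the scalar problem `D^α y + l y = t^(a-1) / Γ(a)`
with vanishing initial value, as a Mittag-Leffler series. For `a = 0` it is the resolvent kernel and
for `a = 1 - α` the solution of the homogeneous problem with initial value `1`. -/
def relaxKernel (α l a t : ℝ) : ℝ := ∑' k : ℕ, relaxTerm α l a k t

theorem relaxTerm_of_nonpos {α l a : ℝ} {k : ℕ} {t : ℝ} (ht : t ≤ 0) : relaxTerm α l a k t = 0 := by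
  rw [relaxTerm, fracKernel_of_nonpos ht, mul_zero]

theorem relaxKernel_of_nonpos {α l a t : ℝ} (ht : t ≤ 0) : relaxKernel α l a t = 0 := by
  simp [relaxKernel, relaxTerm_of_nonpos ht]

theorem measurable_relaxTerm (α l a : ℝ) (k : ℕ) : Measurable (relaxTerm α l a k) :=
  (measurable_fracKernel _).const_mul _

theorem exists_abs_relaxTerm_le {α l a : ℝ} (h0 : 0 < α) (hl : 0 ≤ l) (ha : 0 ≤ a) (R : ℝ) :
    ∃ C : ℝ, 0 ≤ C ∧ ∀ (k : ℕ) (t : ℝ), 0 < t → t ≤ R →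
      |relaxTerm α l a k t| ≤ C * (1 / 2) ^ k * t ^ (a + α - 1) := by
  -- `x` is so large that the ratio of the geometric bound is at most `1/4`
  obtain ⟨x, hx, hxl⟩ : ∃ x : ℝ, 0 < x ∧ l * (R / x) ^ α ≤ 1 / 4 := by
    have h1 : Tendsto (fun x : ℝ => l * (R / x) ^ α) atTop (𝓝 (l * 0 ^ α)) := by
      refine ((Real.continuousAt_rpow_const 0 α (Or.inr h0.le)).tendsto.comp ?_).const_mul l
      exact tendsto_const_nhds.div_atTop tendsto_id
    rw [Real.zero_rpow h0.ne', mul_zero] at h1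
    obtain ⟨x, hx1, hx2⟩ := ((h1.eventually (ge_mem_nhds (by norm_num : (0 : ℝ) < 1 / 4))).and
      (eventually_gt_atTop 0)).exists
    exact ⟨x, hx2, hx1⟩
  refine ⟨(a + α) * x ^ (-(a + α)) * Real.exp x, by positivity, fun k t ht htR => ?_⟩
  set b := a + α * (k + 1) with hb
  have hbp : 0 < b := by positivity
  have hbk : b ≤ (a + α) * 2 ^ k := by
    have h2 : ((k : ℝ) + 1) ≤ 2 ^ k := by exact_mod_cast Nat.lt_two_pow_self (n := k)
    have h3 : b ≤ (a + α) * (k + 1) := by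
      rw [hb]; nlinarith [mul_nonneg ha (Nat.cast_nonneg (α := ℝ) k)]
    exact h3.trans (by gcongr)
  have h4 := fracKernel_le hbp ht hx
  rw [relaxTerm, abs_mul, abs_pow, abs_neg, abs_of_nonneg hl,
    abs_of_nonneg (fracKernel_nonneg hbp t)]
  have e1 : (t / x) ^ b = (t / x) ^ (a + α) * ((t / x) ^ α) ^ k := by
    rw [← Real.rpow_natCast, ← Real.rpow_mul (by positivity), ← Real.rpow_add (by positivity)]
    congr 1; rw [hb]; ring
  have e2 : l ^ k * ((t / x) ^ α) ^ k ≤ (1 / 4) ^ k := by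
    rw [← mul_pow]
    refine pow_le_pow_left₀ (by positivity) (le_trans ?_ hxl) k
    gcongr
  have e3 : (1 / 4 : ℝ) ^ k * 2 ^ k = (1 / 2) ^ k := by rw [← mul_pow]; norm_num
  calc l ^ k * fracKernel b t ≤ l ^ k * (b / t * (t / x) ^ b * Real.exp x) := by gcongr
    _ = (l ^ k * ((t / x) ^ α) ^ k) * (b * ((t / x) ^ (a + α) / t) * Real.exp x) := by
        rw [e1]; ring
    _ ≤ (1 / 4) ^ k * ((a + α) * 2 ^ k * ((t / x) ^ (a + α) / t) * Real.exp x) := by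
        gcongr
    _ = (a + α) * x ^ (-(a + α)) * Real.exp x * ((1 / 4) ^ k * 2 ^ k) * t ^ (a + α - 1) := by
        rw [Real.div_rpow ht.le hx.le, Real.rpow_neg hx.le, Real.rpow_sub_one ht.ne']
        ring
    _ = _ := by rw [e3]

theorem summable_abs_relaxTerm {α l a : ℝ} (h0 : 0 < α) (hl : 0 ≤ l) (ha : 0 ≤ a) (t : ℝ) :
    Summable fun k => |relaxTerm α l a k t| := by
  rcases le_or_gt t 0 with ht | ht
  · simp [relaxTerm_of_nonpos ht, summable_zero]
  · obtain ⟨C, hC, hb⟩ := exists_abs_relaxTerm_le h0 hl ha t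
    refine Summable.of_nonneg_of_le (fun k => abs_nonneg _) (fun k => hb k t ht le_rfl) ?_
    exact (summable_geometric_two.mul_left C).mul_right _

theorem summable_relaxTerm {α l a : ℝ} (h0 : 0 < α) (hl : 0 ≤ l) (ha : 0 ≤ a) (t : ℝ) :
    Summable fun k => relaxTerm α l a k t :=
  (summable_abs_relaxTerm h0 hl ha t).of_abs

theorem measurable_relaxKernel {α l a : ℝ} (h0 : 0 < α) (hl : 0 ≤ l) (ha : 0 ≤ a) :
    Measurable (relaxKernel α l a) :=
  measurable_tsum_of_summable (measurable_relaxTerm α l a) (summable_relaxTerm h0 hl ha)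

theorem exists_abs_relaxKernel_le {α l a : ℝ} (h0 : 0 < α) (hl : 0 ≤ l) (ha : 0 ≤ a) (R : ℝ) :
    ∃ C : ℝ, 0 ≤ C ∧ ∀ t : ℝ, 0 < t → t ≤ R →
      |relaxKernel α l a t| ≤ C * t ^ (a + α - 1) := by
  obtain ⟨C, hC, hb⟩ := exists_abs_relaxTerm_le h0 hl ha R
  refine ⟨C * 2, by positivity, fun t ht htR => ?_⟩
  have hs := summable_abs_relaxTerm h0 hl ha t
  have h1 : |relaxKernel α l a t| ≤ ∑' k, |relaxTerm α l a k t| := by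
    exact norm_tsum_le_tsum_norm (f := fun k => relaxTerm α l a k t) hs
  refine h1.trans ((hs.tsum_le_tsum (fun k => hb k t ht htR)
    ((summable_geometric_two.mul_left C).mul_right _)).trans (le_of_eq ?_))
  rw [tsum_mul_right, tsum_mul_left, tsum_geometric_two]

theorem continuousAt_relaxKernel {α l a t : ℝ} (h0 : 0 < α) (hl : 0 ≤ l) (ha : 0 ≤ a)
    (ht : 0 < t) : ContinuousAt (relaxKernel α l a) t := by
  obtain ⟨C, hC, hb⟩ := exists_abs_relaxTerm_le h0 hl ha (2 * t)
  have hmem : Ioo (t / 2) (2 * t) ∈ 𝓝 t := Ioo_mem_nhds (by linarith) (by linarith)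
  refine ContinuousOn.continuousAt ?_ hmem
  unfold relaxKernel
  refine continuousOn_tsum (u := fun k => C * (1 / 2) ^ k * (2 ^ |a + α - 1| * t ^ (a + α - 1)))
    (fun k => ?_) ((summable_geometric_two.mul_left C).mul_right _) fun k x hx => ?_
  · have : EqOn (relaxTerm α l a k) (fun x => (-l) ^ k * (x ^ (a + α * (k + 1) - 1)
        / Real.Gamma (a + α * (k + 1)))) (Ioo (t / 2) (2 * t)) := fun x hx => by
      have : 0 < x := by linarith [hx.1]
      rw [relaxTerm, fracKernel_of_pos this]
    refine ContinuousOn.congr ?_ this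
    refine continuousOn_const.mul (ContinuousOn.div_const ?_ _)
    intro x hx
    have hx0 : 0 < x := by linarith [hx.1]
    exact (Real.continuousAt_rpow_const x _ (Or.inl hx0.ne')).continuousWithinAt
  · have hx0 : 0 < x := by linarith [hx.1]
    refine (hb k x hx0 hx.2.le).trans ?_
    gcongr
    exact rpow_le_two_rpow_abs_mul ht hx.1.le hx.2.le _

/-! ### Generating series of the scheme -/

/-- The Taylor series at the origin. -/
def taylorSeries (f : ℂ → ℂ) : PowerSeries ℂ :=
  PowerSeries.mk fun n => iteratedDeriv n f 0 / n.factorial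

theorem taylorSeries_congr {f g : ℂ → ℂ} (h : f =ᶠ[𝓝 0] g) : taylorSeries f = taylorSeries g := by
  ext n
  simp [taylorSeries, h.iteratedDeriv_eq n]

theorem taylorSeries_mul {f g : ℂ → ℂ} (hf : AnalyticAt ℂ f 0) (hg : AnalyticAt ℂ g 0) :
    taylorSeries (fun z => f z * g z) = taylorSeries f * taylorSeries g := by
  ext n
  simp only [taylorSeries, PowerSeries.coeff_mul, PowerSeries.coeff_mk]
  rw [iteratedDeriv_fun_mul hf.contDiffAt hg.contDiffAt, Finset.sum_div,
    Finset.Nat.sum_antidiagonal_eq_sum_range_succ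
      (fun i j => iteratedDeriv i f 0 / i.factorial * (iteratedDeriv j g 0 / j.factorial))]
  refine Finset.sum_congr rfl fun k hk => ?_
  have hkn : k ≤ n := Nat.lt_succ_iff.1 (Finset.mem_range.1 hk)
  have h1 := Nat.choose_mul_factorial_mul_factorial hkn
  have h2 : ((n.choose k : ℂ)) * k.factorial * (n - k).factorial = n.factorial := by
    exact_mod_cast h1
  have h3 : (k.factorial : ℂ) ≠ 0 := by exact_mod_cast k.factorial_ne_zero
  have h4 : ((n - k).factorial : ℂ) ≠ 0 := by exact_mod_cast (n - k).factorial_ne_zero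
  have h5 : (n.factorial : ℂ) ≠ 0 := by exact_mod_cast n.factorial_ne_zero
  rw [div_mul_div_comm, div_eq_div_iff h5 (mul_ne_zero h3 h4), ← h2]
  ring

theorem taylorSeries_add {f g : ℂ → ℂ} (hf : AnalyticAt ℂ f 0) (hg : AnalyticAt ℂ g 0) :
    taylorSeries (fun z => f z + g z) = taylorSeries f + taylorSeries g := by
  ext n
  simp only [taylorSeries, map_add, PowerSeries.coeff_mk]
  have := iteratedDeriv_add (n := n) (x := (0 : ℂ)) hf.contDiffAt hg.contDiffAt
  rw [show (fun z => f z + g z) = f + g from rfl, this, add_div]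

theorem taylorSeries_const (c : ℂ) : taylorSeries (fun _ => c) = PowerSeries.C c := by
  ext n
  simp only [taylorSeries, PowerSeries.coeff_mk, iteratedDeriv_const, PowerSeries.coeff_C]
  split_ifs with h
  · simp [h]
  · simp

theorem taylorSeries_id : taylorSeries (fun z => z) = PowerSeries.X := by
  ext n
  simp only [taylorSeries, PowerSeries.coeff_mk, iteratedDeriv_fun_id, PowerSeries.coeff_X]
  split_ifs with h h' h'
  · omega
  · simp
  · simp [h']
  · simp

theorem taylorSeries_const_mul (c : ℂ) {f : ℂ → ℂ} (hf : AnalyticAt ℂ f 0) :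
    taylorSeries (fun z => c * f z) = PowerSeries.C c * taylorSeries f := by
  rw [taylorSeries_mul analyticAt_const hf, taylorSeries_const]

theorem coeff_taylorSeries_deriv (f : ℂ → ℂ) (n : ℕ) :
    PowerSeries.coeff n (taylorSeries (deriv f))
      = (n + 1) * PowerSeries.coeff (n + 1) (taylorSeries f) := by
  simp only [taylorSeries, PowerSeries.coeff_mk]
  rw [iteratedDeriv_succ', Nat.factorial_succ]
  have h1 : (n.factorial : ℂ) ≠ 0 := by exact_mod_cast n.factorial_ne_zero
  have h2 : (n : ℂ) + 1 ≠ 0 := by exact_mod_cast n.succ_ne_zero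
  push_cast
  field_simp

theorem hasSum_taylorSeries {f : ℂ → ℂ} (hf : DifferentiableOn ℂ f (Metric.ball 0 1)) {ζ : ℂ}
    (hζ : ‖ζ‖ < 1) : HasSum (fun n => PowerSeries.coeff n (taylorSeries f) * ζ ^ n) (f ζ) := by
  have := Complex.hasSum_taylorSeries_on_ball hf (z := ζ) (by simpa using hζ)
  have e : (fun n => PowerSeries.coeff n (taylorSeries f) * ζ ^ n)
      = fun n : ℕ => (n.factorial : ℂ)⁻¹ • (ζ - 0) ^ n • iteratedDeriv n f 0 := by
    ext n
    rw [taylorSeries, PowerSeries.coeff_mk, smul_eq_mul, smul_eq_mul, sub_zero]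
    ring
  rwa [e]

/-- The generating series of the Grünwald-Letnikov coefficients. -/
def glSeries (α : ℝ) : PowerSeries ℝ := PowerSeries.mk (glCoeff α)

/-- The generating series of the averaging in the Crank-Nicolson scheme. -/
def cnSeries (α : ℝ) : PowerSeries ℝ :=
  PowerSeries.C (1 - α / 2) + PowerSeries.C (α / 2) * PowerSeries.X

/-- The generating series of the second-order BDF operator. -/
def bdfSeries : PowerSeries ℝ :=
  PowerSeries.C (3 / 2) + PowerSeries.C (-2) * PowerSeries.X
    + PowerSeries.C (1 / 2) * (PowerSeries.X * PowerSeries.X)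

/-- The generating series of the left-hand side of the scheme. -/
def schemeSeries (α l : ℝ) : PowerSeries ℝ := glSeries α + PowerSeries.C l * cnSeries α

/-- The generating series of the discrete solution operator; `i` counts the BDF operators
applied. -/
def transferSeries (α l : ℝ) (i : ℕ) : PowerSeries ℝ :=
  bdfSeries ^ i * cnSeries α * (schemeSeries α l)⁻¹

theorem constantCoeff_schemeSeries (α l : ℝ) :
    PowerSeries.constantCoeff (schemeSeries α l) = 1 + l * (1 - α / 2) := by
  rw [← PowerSeries.coeff_zero_eq_constantCoeff_apply]
  simp [schemeSeries, glSeries, cnSeries, glCoeff]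

theorem constantCoeff_schemeSeries_pos {α l : ℝ} (h1 : α < 1) (hl : 0 ≤ l) :
    0 < PowerSeries.constantCoeff (schemeSeries α l) := by
  rw [constantCoeff_schemeSeries]
  have := mul_nonneg hl (by linarith : 0 ≤ 1 - α / 2)
  linarith

theorem analyticAt_one_sub_cpow (α : ℝ) : AnalyticAt ℂ (fun ζ : ℂ => (1 - ζ) ^ (α : ℂ)) 0 := by
  refine AnalyticAt.cpow (by fun_prop) analyticAt_const ?_
  simp

/-- The binomial series, from the differential equation `(1 - ζ) f' = -α f`. -/
theorem taylorSeries_one_sub_cpow (α : ℝ) :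
    taylorSeries (fun ζ : ℂ => (1 - ζ) ^ (α : ℂ))
      = PowerSeries.map (algebraMap ℝ ℂ) (glSeries α) := by
  set f : ℂ → ℂ := fun ζ => (1 - ζ) ^ (α : ℂ) with hf
  have hfa : AnalyticAt ℂ f 0 := analyticAt_one_sub_cpow α
  have hode : (fun ζ => deriv f ζ) =ᶠ[𝓝 0] fun ζ => ζ * deriv f ζ + (-α : ℂ) * f ζ := by
    filter_upwards [Metric.ball_mem_nhds (0 : ℂ) one_pos] with ζ hζ
    have hζ1 : ‖ζ‖ < 1 := by simpa using hζ
    have hre := one_sub_re_pos hζ1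
    have hne := ne_zero_of_re_pos hre
    have hd : HasDerivAt f (α * (1 - ζ) ^ ((α : ℂ) - 1) * (-1)) ζ :=
      HasDerivAt.cpow_const ((hasDerivAt_id ζ).const_sub 1) (Or.inl hre)
    rw [hd.deriv, Complex.cpow_sub _ _ hne, Complex.cpow_one, hf]
    field_simp
    ring
  have hda : AnalyticAt ℂ (deriv f) 0 := hfa.deriv
  have hT := taylorSeries_congr hode
  rw [taylorSeries_add (by fun_prop) (by fun_prop), taylorSeries_mul (by fun_prop) hda,
    taylorSeries_id, taylorSeries_const_mul _ hfa] at hT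
  have hrec : ∀ n : ℕ, ((n : ℂ) + 1) * PowerSeries.coeff (n + 1) (taylorSeries f)
      = (n - α) * PowerSeries.coeff n (taylorSeries f) := by
    intro n
    have := congrArg (PowerSeries.coeff n) hT
    rw [show taylorSeries (fun ζ => deriv f ζ) = taylorSeries (deriv f) from rfl,
      coeff_taylorSeries_deriv, map_add, PowerSeries.coeff_C_mul] at this
    rcases n with _ | n
    · simp at this ⊢; exact this
    · rw [PowerSeries.coeff_succ_X_mul, coeff_taylorSeries_deriv] at this
      push_cast at this ⊢
      linear_combination this
  ext n
  induction n with
  | zero => simp [taylorSeries, glSeries, glCoeff, hf]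
  | succ n ih =>
    have h2 : (n : ℂ) + 1 ≠ 0 := by exact_mod_cast n.succ_ne_zero
    apply mul_left_cancel₀ h2
    rw [hrec, ih]
    simp only [glSeries, PowerSeries.coeff_map, PowerSeries.coeff_mk, glCoeff,
      Complex.coe_algebraMap]
    push_cast
    field_simp
    ring

theorem analyticAt_cnPoly (α : ℝ) : AnalyticAt ℂ (cnPoly α) 0 := by
  unfold cnPoly; fun_prop

theorem analyticAt_bdfPoly : AnalyticAt ℂ bdfPoly 0 := by
  unfold bdfPoly; fun_prop

theorem analyticAt_bdfPoly_pow (k : ℕ) : AnalyticAt ℂ (fun ζ => bdfPoly ζ ^ k) 0 :=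
  analyticAt_bdfPoly.pow k

theorem analyticAt_const_mul_cnPoly (α l : ℝ) :
    AnalyticAt ℂ (fun ζ => (l : ℂ) * cnPoly α ζ) 0 :=
  analyticAt_const.mul (analyticAt_cnPoly α)

theorem taylorSeries_cnPoly (α : ℝ) :
    taylorSeries (cnPoly α) = PowerSeries.map (algebraMap ℝ ℂ) (cnSeries α) := by
  have e : cnPoly α = fun ζ => (1 - α / 2 : ℂ) + (α / 2 : ℂ) * ζ := rfl
  rw [e, taylorSeries_add analyticAt_const (by fun_prop), taylorSeries_const,
    taylorSeries_const_mul _ (by fun_prop), taylorSeries_id]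
  simp [cnSeries]

theorem taylorSeries_bdfPoly :
    taylorSeries bdfPoly = PowerSeries.map (algebraMap ℝ ℂ) bdfSeries := by
  have e : bdfPoly = fun ζ => ((3 / 2 : ℂ) + (-2 : ℂ) * ζ) + (1 / 2 : ℂ) * (ζ * ζ) := by
    ext ζ; rw [bdfPoly]; ring
  rw [e, taylorSeries_add (by fun_prop) (by fun_prop), taylorSeries_add analyticAt_const
    (by fun_prop), taylorSeries_const, taylorSeries_const_mul _ (by fun_prop),
    taylorSeries_const_mul _ (by fun_prop), taylorSeries_mul (by fun_prop) (by fun_prop),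
    taylorSeries_id]
  simp [bdfSeries]

theorem taylorSeries_schemeFun (α l : ℝ) :
    taylorSeries (schemeFun α l) = PowerSeries.map (algebraMap ℝ ℂ) (schemeSeries α l) := by
  have e : schemeFun α l = fun ζ => (1 - ζ) ^ (α : ℂ) + (l : ℂ) * cnPoly α ζ := rfl
  rw [e, taylorSeries_add (analyticAt_one_sub_cpow α)
    (analyticAt_const_mul_cnPoly α l), taylorSeries_one_sub_cpow,
    taylorSeries_const_mul _ (analyticAt_cnPoly α), taylorSeries_cnPoly]
  simp [schemeSeries]

section

variable {α : ℝ} (h0 : 0 < α) (h1 : α < 1) {l : ℝ} (hl : 0 ≤ l)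
include h0 h1 hl

theorem schemeFun_ne_zero {ζ : ℂ} (hζ : ‖ζ‖ < 1) : schemeFun α l ζ ≠ 0 := by
  rw [← norm_pos_iff]
  refine lt_of_lt_of_le (mul_pos (cos_sector_pos h0 h1) ?_) (schemeFun_lower_bound h0 h1 hl hζ)
  have h2 : 0 < ‖1 - ζ‖ := norm_pos_iff.2 (ne_zero_of_re_pos (one_sub_re_pos hζ))
  have := mul_nonneg hl (by linarith : 0 ≤ 1 - α)
  positivity

theorem differentiableOn_transferFun (i : ℕ) :
    DifferentiableOn ℂ (transferFun α l i) (Metric.ball 0 1) := by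
  intro ζ hζ
  have hζ1 : ‖ζ‖ < 1 := by simpa using hζ
  exact (differentiableAt_transferFun (Or.inl (one_sub_re_pos hζ1))
    (schemeFun_ne_zero h0 h1 hl hζ1)).differentiableWithinAt

theorem taylorSeries_transferFun (i : ℕ) :
    taylorSeries (transferFun α l i)
      = PowerSeries.map (algebraMap ℝ ℂ) (transferSeries α l i) := by
  have hS : AnalyticAt ℂ (schemeFun α l) 0 :=
    (analyticAt_one_sub_cpow α).add (analyticAt_const_mul_cnPoly α l)
  have hT : AnalyticAt ℂ (transferFun α l i) 0 :=
    (differentiableOn_transferFun h0 h1 hl i).analyticAt (Metric.ball_mem_nhds _ one_pos)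
  have hB : ∀ k : ℕ, taylorSeries (fun ζ => bdfPoly ζ ^ k)
      = PowerSeries.map (algebraMap ℝ ℂ) (bdfSeries ^ k) := by
    intro k
    induction k with
    | zero => simp [taylorSeries_const]
    | succ k ih =>
      simp_rw [pow_succ]
      rw [taylorSeries_mul (analyticAt_bdfPoly_pow k) analyticAt_bdfPoly, ih,
        taylorSeries_bdfPoly, map_mul]
  have hprod : (fun ζ => schemeFun α l ζ * transferFun α l i ζ)
      =ᶠ[𝓝 0] fun ζ => bdfPoly ζ ^ i * cnPoly α ζ := by
    filter_upwards [Metric.ball_mem_nhds (0 : ℂ) one_pos] with ζ hζ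
    have := schemeFun_ne_zero h0 h1 hl (ζ := ζ) (by simpa using hζ)
    rw [transferFun]
    field_simp
  have e1 := taylorSeries_congr hprod
  rw [taylorSeries_mul hS hT, taylorSeries_mul (analyticAt_bdfPoly_pow i) (analyticAt_cnPoly α),
    hB, taylorSeries_cnPoly, taylorSeries_schemeFun, ← map_mul] at e1
  have hc := (constantCoeff_schemeSeries_pos h1 hl).ne'
  have e2 : schemeSeries α l * transferSeries α l i = bdfSeries ^ i * cnSeries α := by
    rw [transferSeries, mul_left_comm, PowerSeries.mul_inv_cancel _ hc, mul_one]
  rw [← e2, map_mul] at e1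
  refine mul_left_cancel₀ ?_ e1
  intro h
  have h3 := congrArg PowerSeries.constantCoeff h
  rw [map_zero, ← PowerSeries.coeff_zero_eq_constantCoeff_apply, PowerSeries.coeff_map,
    PowerSeries.coeff_zero_eq_constantCoeff_apply] at h3
  exact hc (by simpa using h3)

/-- The power series of the discrete solution operator converges in the unit disc. -/
theorem hasSum_transferSeries (i : ℕ) {ζ : ℂ} (hζ : ‖ζ‖ < 1) :
    HasSum (fun n => ((PowerSeries.coeff n (transferSeries α l i) : ℝ) : ℂ) * ζ ^ n)
      (transferFun α l i ζ) := by
  have := hasSum_taylorSeries (differentiableOn_transferFun h0 h1 hl i) hζ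
  rw [taylorSeries_transferFun h0 h1 hl] at this
  simpa using this

theorem summable_abs_transferSeries (i : ℕ) {r : ℝ} (hr0 : 0 ≤ r) (hr : r < 1) :
    Summable fun n => |PowerSeries.coeff n (transferSeries α l i)| * r ^ n := by
  have := (hasSum_transferSeries h0 h1 hl i (ζ := (r : ℂ))
    (by rwa [Complex.norm_real, Real.norm_of_nonneg hr0])).summable.norm
  refine this.congr fun n => ?_
  rw [norm_mul, norm_pow, Complex.norm_real, Complex.norm_real, Real.norm_of_nonneg hr0,
    Real.norm_eq_abs]

end

/-! ### Inversion formulas for the exact and the discrete kernel -/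

theorem continuous_iteratedDeriv_linePt {L : ℂ → ℂ} {σ : ℝ} (hσ : 0 < σ)
    (hd : DifferentiableOn ℂ L {z | 0 < z.re}) :
    Continuous fun y : ℝ => iteratedDeriv 3 L (linePt σ y) := by
  have h3 := differentiableOn_deriv_re_gt (differentiableOn_deriv_re_gt
    (differentiableOn_deriv_re_gt hd))
  have e : iteratedDeriv 3 L = deriv (deriv (deriv L)) := by
    simp only [iteratedDeriv_succ, iteratedDeriv_zero]
  rw [e]
  exact h3.continuousOn.comp_continuous (continuous_linePt σ) fun y => by simpa using hσ

theorem differentiableOn_iteratedDeriv {L : ℂ → ℂ}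
    (hd : DifferentiableOn ℂ L {z | 0 < z.re}) :
    DifferentiableOn ℂ (iteratedDeriv 3 L) {z | 0 < z.re} := by
  have h3 := differentiableOn_deriv_re_gt (differentiableOn_deriv_re_gt
    (differentiableOn_deriv_re_gt hd))
  have e : iteratedDeriv 3 L = deriv (deriv (deriv L)) := by
    simp only [iteratedDeriv_succ, iteratedDeriv_zero]
  rwa [e]

theorem integral_norm_fracKernel_mul_cexp {b : ℝ} {z : ℂ} (hb : 0 < b) (hz : 0 < z.re) (m : ℝ) :
    ∫ t : ℝ, ‖(fracKernel b (t - m) : ℂ) * Complex.exp (-(z * t))‖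
      = Real.exp (-(z.re * m)) * z.re ^ (-b) := by
  rw [← integral_fracKernel_mul_exp hb hz, ← integral_const_mul,
    ← integral_sub_right_eq_self
      (fun t => Real.exp (-(z.re * m)) * (fracKernel b t * Real.exp (-(z.re * t)))) m]
  congr 1
  ext t
  rw [norm_mul, Complex.norm_real, Complex.norm_exp, Real.norm_of_nonneg (fracKernel_nonneg hb _),
    mul_left_comm, ← Real.exp_add]
  congr 2
  simp; ring

theorem integral_fracKernel_sub_mul_cexp {b : ℝ} {z : ℂ} (hb : 0 < b) (hz : 0 < z.re) (m : ℝ) :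
    ∫ t : ℝ, (fracKernel b (t - m) : ℂ) * Complex.exp (-(z * t))
      = Complex.exp (-(z * m)) * z ^ (-(b : ℂ)) := by
  rw [← integral_fracKernel_mul_cexp hb hz, ← integral_const_mul,
    ← integral_sub_right_eq_self
      (fun t : ℝ => Complex.exp (-(z * m)) * ((fracKernel b t : ℂ) * Complex.exp (-(z * t)))) m]
  congr 1
  ext t
  rw [mul_left_comm, ← Complex.exp_add]
  congr 2
  push_cast; ring

theorem integrable_fracKernel_sub_mul_cexp {b : ℝ} {z : ℂ} (hb : 0 < b) (hz : 0 < z.re) (m : ℝ) :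
    Integrable fun t : ℝ => (fracKernel b (t - m) : ℂ) * Complex.exp (-(z * t)) := by
  have := ((integrable_fracKernel_mul_cexp hb hz).comp_sub_right m).const_mul
    (Complex.exp (-(z * m)))
  refine this.congr (Eventually.of_forall fun t => ?_)
  simp only
  rw [mul_left_comm, ← Complex.exp_add]
  congr 2
  push_cast; ring

theorem differentiableOn_exactSymbol {α l : ℝ} (h0 : 0 < α) (h1 : α < 1) (hl : 0 ≤ l) (a : ℝ) :
    DifferentiableOn ℂ (exactSymbol α l a) {z | 0 < z.re} := by
  intro z hz
  have hg := sectorGap_pos h0 h1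
  obtain ⟨-, b2, b3⟩ := exact_lower_bound' h0 h1 hl (z := z) (u := 0) hz (by simp; positivity)
  rw [add_zero, mul_one] at b2 b3
  refine (differentiableAt_exactSymbol (Or.inl hz) ?_).differentiableWithinAt
  rw [← norm_pos_iff]
  exact lt_of_lt_of_le (by positivity) b3

theorem differentiableOn_discreteSymbol {α l : ℝ} (h0 : 0 < α) (h1 : α < 1) (hl : 0 ≤ l) (b : ℝ)
    (i : ℕ) : DifferentiableOn ℂ (discreteSymbol α l b i) {z | 0 < z.re} := by
  intro z hz
  have hz' : 0 < z.re := hz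
  have hE : ‖Complex.exp (-z)‖ < 1 := by rw [Complex.norm_exp]; simpa using hz'
  exact (differentiableAt_discreteSymbol (Or.inl hz') (Or.inl (one_sub_re_pos hE))
    (schemeFun_ne_zero h0 h1 hl hE)).differentiableWithinAt

/-- The Laplace transform of the exact kernel, where the Mittag-Leffler series can be transformed
term by term. -/
theorem laplace_relaxKernel {α l a : ℝ} (h0 : 0 < α) (hl : 0 ≤ l) (ha : 0 ≤ a) {z : ℂ}
    (hz0 : 0 < z.re) (hz : l < z.re ^ α) :
    (Integrable fun t : ℝ => (relaxKernel α l a t : ℂ) * Complex.exp (-(z * t))) ∧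
    ∫ t : ℝ, (relaxKernel α l a t : ℂ) * Complex.exp (-(z * t)) = exactSymbol α l a z := by
  have hzne := ne_zero_of_re_pos hz0
  have hb : ∀ k : ℕ, 0 < a + α * ((k : ℝ) + 1) := fun k => by positivity
  set F : ℕ → ℝ → ℂ := fun k t => (relaxTerm α l a k t : ℂ) * Complex.exp (-(z * t)) with hF
  have eF : ∀ k, F k = fun t : ℝ => ((-l : ℝ) : ℂ) ^ k
      * ((fracKernel (a + α * (k + 1)) (t - 0) : ℂ) * Complex.exp (-(z * t))) := by
    intro k; ext t; simp only [hF, relaxTerm, sub_zero]; push_cast; ring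
  have hFi : ∀ k, Integrable (F k) := fun k => by
    rw [eF]; exact (integrable_fracKernel_sub_mul_cexp (hb k) hz0 0).const_mul _
  have hFn : ∀ k, ∫ t, ‖F k t‖ = z.re ^ (-(a + α)) * (l * z.re ^ (-α)) ^ k := by
    intro k
    rw [eF]
    simp_rw [norm_mul (((-l : ℝ) : ℂ) ^ k)]
    rw [integral_const_mul, integral_norm_fracKernel_mul_cexp (hb k) hz0, norm_pow,
      Complex.norm_real, Real.norm_eq_abs, abs_neg, abs_of_nonneg hl, mul_zero, neg_zero,
      Real.exp_zero, one_mul, mul_pow, ← Real.rpow_natCast (z.re ^ (-α)), ← Real.rpow_mul hz0.le,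
      mul_left_comm, ← Real.rpow_add hz0]
    congr 2; ring
  have hr : l * z.re ^ (-α) < 1 := by
    rw [Real.rpow_neg hz0.le, ← div_eq_mul_inv, div_lt_one (by positivity)]; exact hz
  have hsum : Summable fun k => ∫ t, ‖F k t‖ := by
    simp_rw [hFn]
    exact (summable_geometric_of_lt_one (by positivity) hr).mul_left _
  have etsum : ∀ t : ℝ, ∑' k, F k t = (relaxKernel α l a t : ℂ) * Complex.exp (-(z * t)) := by
    intro t
    simp only [hF]
    rw [tsum_mul_right, relaxKernel, Complex.ofReal_tsum]
  have hFint : ∀ k, ∫ t, F k t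
      = z ^ (-(a : ℂ)) * z ^ (-(α : ℂ)) * (-(l * z ^ (-(α : ℂ)))) ^ k := by
    intro k
    rw [eF, integral_const_mul, integral_fracKernel_sub_mul_cexp (hb k) hz0]
    have e1 : z ^ (-((a + α * ((k : ℝ) + 1) : ℝ) : ℂ))
        = z ^ (-(a : ℂ)) * z ^ (-(α : ℂ)) * (z ^ (-(α : ℂ))) ^ k := by
      rw [← Complex.cpow_nat_mul, ← Complex.cpow_add _ _ hzne, ← Complex.cpow_add _ _ hzne]
      congr 1; push_cast; ring
    rw [e1]
    push_cast
    rw [mul_zero, neg_zero, Complex.exp_zero, one_mul, neg_pow,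
      neg_pow (l * z ^ (-(α : ℂ))), mul_pow]
    ring
  have hm : Measurable fun t : ℝ => (relaxKernel α l a t : ℂ) * Complex.exp (-(z * t)) := by
    have := measurable_relaxKernel h0 hl ha
    fun_prop
  have hI := integrable_tsum_of_summable hFi hsum (by
    simp_rw [etsum]; exact hm.aestronglyMeasurable)
  simp_rw [etsum] at hI
  refine ⟨hI, ?_⟩
  have h2 := hasSum_integral_of_summable_integral_norm hFi hsum
  simp_rw [etsum, hFint] at h2
  have hnorm : ‖-((l : ℂ) * z ^ (-(α : ℂ)))‖ < 1 := by
    rw [norm_neg, norm_mul, Complex.norm_real, Real.norm_of_nonneg hl, ← Complex.ofReal_neg,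
      Complex.norm_cpow_real]
    refine lt_of_le_of_lt ?_ hr
    refine mul_le_mul_of_nonneg_left ?_ hl
    exact Real.rpow_le_rpow_of_nonpos hz0 (Complex.re_le_norm z) (by linarith)
  have h3 := (hasSum_geometric_of_norm_lt_one hnorm).mul_left (z ^ (-(a : ℂ)) * z ^ (-(α : ℂ)))
  rw [h2.unique h3, exactSymbol]
  have hq : z ^ (α : ℂ) ≠ 0 := by rw [Complex.cpow_ne_zero_iff]; exact Or.inl hzne
  have hne : 1 - -((l : ℂ) * z ^ (-(α : ℂ))) ≠ 0 := by
    intro h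
    have : -((l : ℂ) * z ^ (-(α : ℂ))) = 1 := by linear_combination -h
    rw [this, norm_one] at hnorm
    exact lt_irrefl _ hnorm
  rw [Complex.cpow_neg z (α : ℂ)] at hne ⊢
  have hne2 : z ^ (α : ℂ) + l ≠ 0 := by
    intro h
    apply hne
    field_simp
    linear_combination h
  field_simp
  rw [sub_neg_eq_add, mul_div_assoc, div_self hne2, mul_one]

/-- The inversion formula for the exact kernel, on any vertical line of the right half plane. -/
theorem relaxKernel_inversion {α l a σ s : ℝ} (h0 : 0 < α) (h1 : α < 1) (hl : 0 ≤ l) (ha : 0 ≤ a)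
    (hσ : 0 < σ) (hs : 0 < s) :
    (Integrable fun y : ℝ => iteratedDeriv 3 (exactSymbol α l a) (linePt σ y)) ∧
    (s : ℂ) ^ 3 * (relaxKernel α l a s : ℂ) = -(1 / (2 * Real.pi)) *
      ∫ y : ℝ, Complex.exp (linePt σ y * s)
        * iteratedDeriv 3 (exactSymbol α l a) (linePt σ y) := by
  have hd := differentiableOn_exactSymbol h0 h1 hl a
  obtain ⟨C, hC, hb⟩ := exists_norm_iteratedDeriv_exactSymbol_le h0 h1 a
  have hint : ∀ σ : ℝ, 0 < σ →
      Integrable fun y : ℝ => iteratedDeriv 3 (exactSymbol α l a) (linePt σ y) := by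
    intro σ hσ
    refine ((integrable_norm_linePt_rpow (p := a + α + 3) hσ (by linarith)).const_mul C).mono'
      (continuous_iteratedDeriv_linePt hσ hd).aestronglyMeasurable
      (Eventually.of_forall fun y => ?_)
    refine (hb l hl _ (by simpa using hσ)).trans (le_of_eq ?_)
    congr 2; ring
  refine ⟨hint σ hσ, ?_⟩
  -- the formula holds far to the right, and the line of integration can be moved
  set σ₀ := (l + 1) ^ (1 / α) with hσ₀
  have hσ₀p : 0 < σ₀ := by positivity
  have hpow : ∀ x : ℝ, σ₀ < x → l < x ^ α := by
    intro x hx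
    have : σ₀ ^ α < x ^ α := Real.rpow_lt_rpow hσ₀p.le hx h0
    rw [hσ₀, ← Real.rpow_mul (by linarith), one_div, inv_mul_cancel₀ h0.ne', Real.rpow_one] at this
    linarith
  set σ₂ := max σ (σ₀ + 1) with hσ₂
  have hσ₂0 : σ₀ < σ₂ := lt_of_lt_of_le (by linarith) (le_max_right _ _)
  have hsub : {z : ℂ | σ₀ < z.re} ⊆ {z : ℂ | 0 < z.re} := fun z hz => hσ₀p.trans hz
  have hinv := laplace_inversion (f := fun t => (relaxKernel α l a t : ℂ))
    (L := exactSymbol α l a) (s := s) hσ₂0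
    (fun t ht => by rw [relaxKernel_of_nonpos ht, Complex.ofReal_zero])
    (fun σ' hσ' => (laplace_relaxKernel h0 hl ha (z := (σ' : ℂ))
      (by simpa using hσ₀p.trans hσ') (by simpa using hpow _ hσ')).1)
    (fun z hz => (laplace_relaxKernel h0 hl ha (hσ₀p.trans hz) (hpow _ hz)).2)
    (hd.mono hsub) (hint _ (hσ₀p.trans hσ₂0))
    (Complex.continuous_ofReal.continuousAt.comp (continuousAt_relaxKernel h0 hl ha hs))
  rw [hinv]
  congr 1
  symm
  refine integral_linePt_eq (Ψ := fun z => Complex.exp (z * s)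
    * iteratedDeriv 3 (exactSymbol α l a) z) (K := Real.exp (σ₂ * s) * C) (p := a + α + 3) hσ
    (le_max_left _ _) (by linarith) (by positivity) ?_ ?_
  · exact DifferentiableOn.mul (by fun_prop) (differentiableOn_iteratedDeriv hd)
  · intro z hz1 hz2
    have hz0 : 0 < z.re := hσ.trans_le hz1
    rw [norm_mul, Complex.norm_exp, mul_assoc]
    have e1 : Real.exp (z * s).re ≤ Real.exp (σ₂ * s) := by
      rw [Complex.re_mul_ofReal]
      gcongr
    refine mul_le_mul e1 ?_ (norm_nonneg _) (Real.exp_pos _).le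
    refine (hb l hl z hz0).trans (le_of_eq ?_)
    congr 2; ring

/-- The discrete solution, as a function of continuous time with unit step, for the primitive
`t^(b-1) / Γ(b)` of the source. -/
def discreteKernel (α l b : ℝ) (i : ℕ) (t : ℝ) : ℝ :=
  ∑' m : ℕ, PowerSeries.coeff m (transferSeries α l i) * fracKernel b (t - m)

theorem fracKernel_sub_eq_zero {b t : ℝ} {n m : ℕ} (ht : t ≤ n) (hm : m ∉ Finset.range n) :
    fracKernel b (t - m) = 0 := by
  refine fracKernel_of_nonpos ?_
  have : (n : ℝ) ≤ m := by exact_mod_cast not_lt.1 (fun h => hm (Finset.mem_range.2 h))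
  linarith

theorem discreteKernel_eq_sum {α l b : ℝ} {i : ℕ} {t : ℝ} {n : ℕ} (ht : t ≤ n) :
    discreteKernel α l b i t
      = ∑ m ∈ Finset.range n, PowerSeries.coeff m (transferSeries α l i) * fracKernel b (t - m) :=
  tsum_eq_sum fun m hm => by rw [fracKernel_sub_eq_zero ht hm, mul_zero]

theorem discreteKernel_of_nonpos {α l b : ℝ} {i : ℕ} {t : ℝ} (ht : t ≤ 0) :
    discreteKernel α l b i t = 0 := by
  rw [discreteKernel_eq_sum (n := 0) (by simpa using ht)]; simp

theorem continuous_fracKernel {b : ℝ} (hb : 1 < b) : Continuous (fracKernel b) := by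
  have : fracKernel b = fun t => (max t 0) ^ (b - 1) / Real.Gamma b := by
    ext t
    rcases le_or_gt t 0 with h | h
    · rw [fracKernel_of_nonpos h, max_eq_right h, Real.zero_rpow (by linarith), zero_div]
    · rw [fracKernel_of_pos h, max_eq_left h.le]
  rw [this]
  exact ((Real.continuous_rpow_const (by linarith)).comp (by fun_prop)).div_const _

theorem continuous_discreteKernel {α l b : ℝ} {i : ℕ} (hb : 1 < b) :
    Continuous (discreteKernel α l b i) := by
  rw [continuous_iff_continuousAt]
  intro s
  obtain ⟨n, hn⟩ := exists_nat_gt s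
  have hc := continuous_fracKernel hb
  have h1 : Continuous fun t : ℝ => ∑ m ∈ Finset.range n,
      PowerSeries.coeff m (transferSeries α l i) * fracKernel b (t - m) := by fun_prop
  refine h1.continuousAt.congr ?_
  filter_upwards [Iio_mem_nhds hn] with t ht
  exact (discreteKernel_eq_sum (le_of_lt ht)).symm

/-- The Laplace transform of the discrete kernel is `discreteSymbol`: the shift by `m` in the kernel
contributes the factor `e^(-mz)`, and the series in `e^(-z)` sums to `transferFun`. -/
theorem laplace_discreteKernel {α l b : ℝ} (h0 : 0 < α) (h1 : α < 1) (hl : 0 ≤ l) (hb : 1 < b)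
    (i : ℕ) {z : ℂ} (hz : 0 < z.re) :
    (Integrable fun t : ℝ => (discreteKernel α l b i t : ℂ) * Complex.exp (-(z * t))) ∧
    ∫ t : ℝ, (discreteKernel α l b i t : ℂ) * Complex.exp (-(z * t))
      = discreteSymbol α l b i z := by
  have hb0 : 0 < b := by linarith
  set v : ℕ → ℝ := fun m => PowerSeries.coeff m (transferSeries α l i) with hv
  set F : ℕ → ℝ → ℂ := fun m t => (v m : ℂ)
    * ((fracKernel b (t - m) : ℂ) * Complex.exp (-(z * t))) with hF
  have hFi : ∀ k, Integrable (F k) := fun k =>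
    (integrable_fracKernel_sub_mul_cexp hb0 hz (k : ℝ)).const_mul _
  have hFn : ∀ k, ∫ t, ‖F k t‖ = |v k| * Real.exp (-z.re) ^ k * z.re ^ (-b) := by
    intro k
    simp only [hF]
    simp_rw [norm_mul (v k : ℂ)]
    rw [integral_const_mul, integral_norm_fracKernel_mul_cexp hb0 hz, Complex.norm_real,
      Real.norm_eq_abs, ← Real.exp_nat_mul, ← mul_assoc]
    congr 3; ring
  have hE : ‖Complex.exp (-z)‖ < 1 := by rw [Complex.norm_exp]; simpa using hz
  have hsum : Summable fun k => ∫ t, ‖F k t‖ := by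
    simp_rw [hFn]
    exact (summable_abs_transferSeries h0 h1 hl i (Real.exp_pos _).le
      (by rw [Real.exp_lt_one_iff]; linarith)).mul_right _
  have etsum : ∀ t : ℝ, ∑' k, F k t
      = (discreteKernel α l b i t : ℂ) * Complex.exp (-(z * t)) := by
    intro t
    simp only [hF]
    simp_rw [← mul_assoc]
    rw [tsum_mul_right, discreteKernel, Complex.ofReal_tsum]
    push_cast
    rfl
  have hFint : ∀ k, ∫ t, F k t
      = (v k : ℂ) * Complex.exp (-z) ^ k * z ^ (-(b : ℂ)) := by
    intro k
    simp only [hF]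
    rw [integral_const_mul, integral_fracKernel_sub_mul_cexp hb0 hz, ← Complex.exp_nat_mul,
      ← mul_assoc]
    congr 3; push_cast; ring
  have hm : Continuous fun t : ℝ => (discreteKernel α l b i t : ℂ) * Complex.exp (-(z * t)) := by
    have := continuous_discreteKernel (α := α) (l := l) (i := i) hb
    fun_prop
  have hI := integrable_tsum_of_summable hFi hsum (by
    simp_rw [etsum]; exact hm.aestronglyMeasurable)
  simp_rw [etsum] at hI
  refine ⟨hI, ?_⟩
  have h2 := hasSum_integral_of_summable_integral_norm hFi hsum
  simp_rw [etsum, hFint] at h2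
  have h3 := (hasSum_transferSeries h0 h1 hl i hE).mul_right (z ^ (-(b : ℂ)))
  rw [h2.unique h3, discreteSymbol, mul_comm]

/-- The inversion formula for the discrete kernel. -/
theorem discreteKernel_inversion {α l b σ s : ℝ} (h0 : 0 < α) (h1 : α < 1) (hl : 0 ≤ l)
    (hb : 1 < b) (i : ℕ) (hσ : 0 < σ) :
    (Integrable fun y : ℝ => iteratedDeriv 3 (discreteSymbol α l b i) (linePt σ y)) ∧
    (s : ℂ) ^ 3 * (discreteKernel α l b i s : ℂ) = -(1 / (2 * Real.pi)) *
      ∫ y : ℝ, Complex.exp (linePt σ y * s)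
        * iteratedDeriv 3 (discreteSymbol α l b i) (linePt σ y) := by
  have hd := differentiableOn_discreteSymbol h0 h1 hl b i
  have hint : Integrable fun y : ℝ => iteratedDeriv 3 (discreteSymbol α l b i) (linePt σ y) := by
    -- the periodic factor is bounded to the right of `σ / 2`
    set r := Real.exp (-(σ / 2)) with hr
    have hsum := summable_abs_transferSeries h0 h1 hl i (r := r) (Real.exp_pos _).le
      (by rw [hr, Real.exp_lt_one_iff]; linarith)
    set B := ∑' m, |PowerSeries.coeff m (transferSeries α l i)| * r ^ m with hB
    have hB0 : 0 ≤ B := tsum_nonneg fun m => by positivity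
    have hG : ∀ z : ℂ, σ / 2 ≤ z.re → ‖transferFun α l i (Complex.exp (-z))‖ ≤ B := by
      intro z hz
      have hE : ‖Complex.exp (-z)‖ ≤ r := by
        rw [Complex.norm_exp, hr]
        exact Real.exp_le_exp.2 (by simpa using hz)
      have hE1 : ‖Complex.exp (-z)‖ < 1 := by
        refine hE.trans_lt ?_
        rw [hr, Real.exp_lt_one_iff]; linarith
      rw [← (hasSum_transferSeries h0 h1 hl i hE1).tsum_eq]
      have hle : ∀ m, ‖((PowerSeries.coeff m (transferSeries α l i) : ℝ) : ℂ)
          * Complex.exp (-z) ^ m‖ ≤ |PowerSeries.coeff m (transferSeries α l i)| * r ^ m := by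
        intro m
        rw [norm_mul, norm_pow, Complex.norm_real, Real.norm_eq_abs]
        gcongr
      exact tsum_of_norm_bounded hsum.hasSum hle
    refine ((integrable_norm_linePt_rpow (p := b) hσ hb).const_mul
      (6 * (2 ^ |(-b)| * B) / (σ / 2) ^ 3)).mono'
      (continuous_iteratedDeriv_linePt hσ hd).aestronglyMeasurable
      (Eventually.of_forall fun y => ?_)
    set z := linePt σ y with hz
    have hzn : σ ≤ ‖z‖ := by
      refine le_trans (le_of_eq ?_) (Complex.re_le_norm z); simp [hz]
    have hzp : 0 < ‖z‖ := hσ.trans_le hzn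
    have hz0 : z ≠ 0 := norm_pos_iff.1 hzp
    have hzu : ∀ u : ℂ, ‖u‖ ≤ σ / 2 / ‖z‖ → ‖z * u‖ ≤ σ / 2 := by
      intro u hu
      rw [norm_mul, mul_comm]
      exact (le_div_iff₀ hzp).1 hu
    have hre : ∀ u : ℂ, ‖u‖ ≤ σ / 2 / ‖z‖ → σ / 2 ≤ (z * (1 + u)).re := by
      intro u hu
      have := (abs_le.1 ((Complex.abs_re_le_norm _).trans (hzu u hu))).1
      rw [mul_add, mul_one, Complex.add_re, hz, linePt_re, ← hz]
      linarith
    have key := norm_iteratedDeriv_three_le (f := discreteSymbol α l b i) (z := z)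
      (ε := σ / 2 / ‖z‖) (K := 2 ^ |(-b)| * ‖z‖ ^ (-b) * B) hz0 (by positivity) ?_ ?_
    · refine key.trans (le_of_eq ?_)
      rw [div_mul_cancel₀ _ hzp.ne']
      ring
    · intro u hu
      have h2 := hre u hu
      have h3 : 0 < (z * (1 + u)).re := by linarith
      exact (hd _ h3).differentiableAt ((isOpen_re_gt 0).mem_nhds h3)
    · intro u hu
      have h2 := hzu u hu
      have n1 : ‖z‖ / 2 ≤ ‖z * (1 + u)‖ := by
        have := one_add_sub_lower_bound (a := z) (b := z * (1 + u)) (p := ‖z‖) (q := σ / 2) le_rfl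
          (by rw [mul_add, mul_one, add_sub_cancel_left]; exact h2)
        linarith
      have n2 : ‖z * (1 + u)‖ ≤ 2 * ‖z‖ := by
        rw [mul_add, mul_one]
        refine (norm_add_le _ _).trans ?_
        linarith
      rw [discreteSymbol, norm_mul, ← Complex.ofReal_neg, Complex.norm_cpow_real]
      exact mul_le_mul (rpow_le_two_rpow_abs_mul hzp n1 n2 _) (hG _ (hre u hu)) (norm_nonneg _)
        (by positivity)
  refine ⟨hint, ?_⟩
  exact laplace_inversion (f := fun t => (discreteKernel α l b i t : ℂ)) (σ₀ := 0) hσ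
    (fun t ht => by rw [discreteKernel_of_nonpos ht, Complex.ofReal_zero])
    (fun σ' hσ' => (laplace_discreteKernel h0 h1 hl hb i (z := (σ' : ℂ)) (by simpa using hσ')).1)
    (fun z hz => (laplace_discreteKernel h0 h1 hl hb i hz).2) hd hint
    (Complex.continuous_ofReal.continuousAt.comp (continuous_discreteKernel hb).continuousAt)

/-! ### The kernel error -/

theorem norm_rpow_neg_intCast_le {x c p : ℝ} {n : ℤ} (hn : n ≠ 0) (hx : |(n : ℝ)| ≤ x)
    (hp : p ≤ -2) (hc : 0 ≤ c) : c * x ^ p ≤ 1 / (n : ℝ) ^ 2 * c := by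
  have h1 : (1 : ℝ) ≤ |(n : ℝ)| := by exact_mod_cast Int.one_le_abs hn
  have h2 : x ^ p ≤ x ^ (-2 : ℝ) := Real.rpow_le_rpow_of_exponent_le (h1.trans hx) hp
  have h3 : x ^ (-2 : ℝ) ≤ |(n : ℝ)| ^ (-2 : ℝ) :=
    Real.rpow_le_rpow_of_nonpos (by linarith) hx (by norm_num)
  have h4 : |(n : ℝ)| ^ (-2 : ℝ) = 1 / (n : ℝ) ^ 2 := by
    rw [Real.rpow_neg (abs_nonneg _), ← sq_abs]
    norm_num
  rw [mul_comm]
  exact mul_le_mul_of_nonneg_right (h2.trans (h3.trans h4.le)) hc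

theorem intervalIntegral_norm_linePt_rpow_le {σ p : ℝ} (hσ : 0 < σ) (hp : 1 < p) :
    ∫ x in (-(1 / 2) : ℝ)..(1 / 2), ‖linePt σ (2 * Real.pi * x)‖ ^ (-p)
      ≤ σ ^ (1 - p) * bracketIntegral p := by
  have hpi := Real.pi_gt_three
  have h1 : Integrable fun x : ℝ => ‖linePt σ (2 * Real.pi * x)‖ ^ (-p) :=
    (integrable_norm_linePt_rpow hσ hp).comp_mul_left' (by positivity)
  rw [intervalIntegral.integral_of_le (by norm_num)]
  refine (setIntegral_le_integral h1 (Eventually.of_forall fun x => by positivity)).trans ?_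
  rw [Measure.integral_comp_mul_left (fun y => ‖linePt σ y‖ ^ (-p)),
    integral_norm_linePt_rpow hσ, smul_eq_mul, abs_of_pos (by positivity)]
  refine mul_le_of_le_one_left (mul_nonneg (by positivity) (bracketIntegral_nonneg p)) ?_
  exact inv_le_one_of_one_le₀ (by linarith)

/-- An integral along a vertical line, estimated period by period: `Q₀` controls the period around
the real axis, `n⁻² Q₁` the period around `2πn`. -/
theorem integral_le_of_periods {h Q₀ Q₁ : ℝ → ℝ} (hh : Integrable h) (hQ₀ : Continuous Q₀)
    (hQ₁ : Continuous Q₁) (hc : Continuous h)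
    (b0 : ∀ x : ℝ, |x| ≤ 1 / 2 → h x ≤ Q₀ x)
    (b1 : ∀ x : ℝ, |x| ≤ 1 / 2 → ∀ n : ℤ, n ≠ 0 → h (x + n) ≤ 1 / (n : ℝ) ^ 2 * Q₁ x) :
    ∫ x, h x ≤ (∫ x in (-(1 / 2) : ℝ)..(1 / 2), Q₀ x)
      + (∑' n : ℤ, 1 / (n : ℝ) ^ 2) * ∫ x in (-(1 / 2) : ℝ)..(1 / 2), Q₁ x := by
  have H := hh.hasSum_intervalIntegral (-(1 / 2))
  have e : ∀ n : ℤ, ∫ x in (-(1 / 2) : ℝ) + n..(-(1 / 2) : ℝ) + n + 1, h x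
      = ∫ x in (-(1 / 2) : ℝ)..(1 / 2), h (x + n) := by
    intro n
    rw [intervalIntegral.integral_comp_add_right]
    congr 1; ring
  simp_rw [e] at H
  have hS : HasSum (fun n : ℤ => 1 / (n : ℝ) ^ 2) (∑' n : ℤ, 1 / (n : ℝ) ^ 2) :=
    (Real.summable_one_div_int_pow.2 (by norm_num)).hasSum
  have hS2 := (hasSum_ite_eq (0 : ℤ) (∫ x in (-(1 / 2) : ℝ)..(1 / 2), Q₀ x)).add
    (hS.mul_right (∫ x in (-(1 / 2) : ℝ)..(1 / 2), Q₁ x))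
  refine hasSum_le (fun n => ?_) H hS2
  have hx : ∀ x ∈ Icc (-(1 / 2) : ℝ) (1 / 2), |x| ≤ 1 / 2 := fun x hx => abs_le.2 hx
  have hci : ∀ n : ℤ, IntervalIntegrable (fun x : ℝ => h (x + n)) volume (-(1 / 2)) (1 / 2) :=
    fun n => (hc.comp (by fun_prop)).intervalIntegrable _ _
  by_cases hn : n = 0
  · subst hn
    simpa using intervalIntegral.integral_mono_on (by norm_num) (by simpa using hci 0)
      (hQ₀.intervalIntegrable _ _) fun x hx' => b0 x (hx x hx')
  · rw [if_neg hn, zero_add, ← intervalIntegral.integral_const_mul]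
    exact intervalIntegral.integral_mono_on (by norm_num) (hci n)
      ((hQ₁.intervalIntegrable _ _).const_mul _) fun x hx' => b1 x (hx x hx') n hn

theorem iteratedDeriv_three_sub {f g : ℂ → ℂ} (hf : DifferentiableOn ℂ f {z | 0 < z.re})
    (hg : DifferentiableOn ℂ g {z | 0 < z.re}) {z : ℂ} (hz : 0 < z.re) :
    iteratedDeriv 3 (f - g) z = iteratedDeriv 3 f z - iteratedDeriv 3 g z :=
  iteratedDeriv_sub
    (hf.analyticAt ((isOpen_re_gt 0).mem_nhds hz)).contDiffAt
    (hg.analyticAt ((isOpen_re_gt 0).mem_nhds hz)).contDiffAt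

/-- The third derivatives of the discrete and of the exact symbol differ, in `L¹` of the line
`Re z = σ`, by `O(σ^(i - b - α))`, uniformly in the eigenvalue. -/
theorem exists_integral_norm_iteratedDeriv_sub_le {α b : ℝ} (h0 : 0 < α) (h1 : α < 1) {i : ℕ}
    (hi12 : i = 1 ∨ i = 2) (hb2 : 2 ≤ b) (hib : (i : ℝ) < b + α) :
    ∃ C : ℝ, 0 ≤ C ∧ ∀ l : ℝ, 0 ≤ l → ∀ σ : ℝ, 0 < σ → σ ≤ 1 →
      ∫ y : ℝ, ‖iteratedDeriv 3 (discreteSymbol α l b i) (linePt σ y)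
          - iteratedDeriv 3 (exactSymbol α l (b - i)) (linePt σ y)‖
        ≤ C * σ ^ ((i : ℝ) - b - α) := by
  obtain ⟨C₁, hC₁, k1⟩ := exists_norm_iteratedDeriv_symbol_sub_le h0 h1 hi12 b
  obtain ⟨C₂, hC₂, k2⟩ := exists_norm_iteratedDeriv_discreteSymbol_le h0 h1 i (by linarith : 0 ≤ b)
  obtain ⟨C₃, hC₃, k3⟩ := exists_norm_iteratedDeriv_exactSymbol_le h0 h1 (b - i)
  have hi2 : (i : ℝ) ≤ 2 := by rcases hi12 with h | h <;> norm_num [h]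
  have hib' : (i : ℝ) ≤ b := hi2.trans hb2
  set Z := ∑' n : ℤ, 1 / (n : ℝ) ^ 2 with hZ
  have hZ0 : 0 ≤ Z := tsum_nonneg fun n => by positivity
  set p := 1 + b + α - i with hp
  set q := 3 + α - i with hq
  have hpi := Real.pi_gt_three
  have hB1 := bracketIntegral_nonneg p
  have hB2 := bracketIntegral_nonneg q
  refine ⟨2 * Real.pi * (C₁ * bracketIntegral p + Z * (C₂ * bracketIntegral q + C₃)),
    by positivity, fun l hl σ hσ hσ1 => ?_⟩
  have hdD := differentiableOn_discreteSymbol h0 h1 hl b i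
  have hdE := differentiableOn_exactSymbol h0 h1 hl (b - i)
  set G : ℝ → ℂ := fun y => iteratedDeriv 3 (discreteSymbol α l b i) (linePt σ y)
          - iteratedDeriv 3 (exactSymbol α l (b - i)) (linePt σ y) with hG
  have hGi : Integrable G :=
    (discreteKernel_inversion (s := 1) h0 h1 hl (by linarith) i hσ).1.sub
      (relaxKernel_inversion h0 h1 hl (by linarith) hσ one_pos).1
  have hGc : Continuous G :=
    (continuous_iteratedDeriv_linePt hσ hdD).sub (continuous_iteratedDeriv_linePt hσ hdE)
  set h : ℝ → ℝ := fun x => ‖G (2 * Real.pi * x)‖ with hh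
  have e1 : ∫ y : ℝ, ‖G y‖ = 2 * Real.pi * ∫ x, h x := by
    rw [hh, Measure.integral_comp_mul_left (fun y => ‖G y‖), smul_eq_mul,
      abs_of_pos (by positivity), ← mul_assoc, mul_inv_cancel₀ (by positivity), one_mul]
  have hcl : ∀ r : ℝ, Continuous fun x : ℝ => ‖linePt σ (2 * Real.pi * x)‖ ^ r := by
    intro r
    have hl := continuous_linePt σ
    refine Continuous.rpow_const (by fun_prop) fun x => Or.inl ?_
    have : linePt σ (2 * Real.pi * x) ≠ 0 := ne_zero_of_re_pos (by simpa using hσ)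
    simpa using this
  have him : ∀ x : ℝ, |x| ≤ 1 / 2 → |(linePt σ (2 * Real.pi * x)).im| ≤ Real.pi := by
    intro x hx
    rw [linePt_im, abs_mul, abs_of_pos (by positivity)]
    nlinarith
  have key := integral_le_of_periods (h := h)
    (Q₀ := fun x => C₁ * ‖linePt σ (2 * Real.pi * x)‖ ^ (-p))
    (Q₁ := fun x => C₂ * ‖linePt σ (2 * Real.pi * x)‖ ^ (-q) + C₃)
    (hGi.norm.comp_mul_left' (by positivity)) (continuous_const.mul (hcl _))
    ((continuous_const.mul (hcl _)).add continuous_const) (by fun_prop) ?_ ?_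
  · rw [e1, mul_assoc (2 * Real.pi)]
    refine mul_le_mul_of_nonneg_left (key.trans ?_) (by positivity)
    have hci : IntervalIntegrable (fun x : ℝ => C₂ * ‖linePt σ (2 * Real.pi * x)‖ ^ (-q)) volume
        (-(1 / 2)) (1 / 2) := (continuous_const.mul (hcl _)).intervalIntegrable _ _
    rw [intervalIntegral.integral_add hci
      intervalIntegrable_const, intervalIntegral.integral_const_mul,
      intervalIntegral.integral_const_mul, intervalIntegral.integral_const]
    have i1 := intervalIntegral_norm_linePt_rpow_le hσ (p := p) (by linarith)
    have i2 := intervalIntegral_norm_linePt_rpow_le hσ (p := q) (by linarith)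
    have s1 : σ ^ (1 - p) = σ ^ ((i : ℝ) - b - α) := by congr 1; rw [hp]; ring
    have s2 : σ ^ (1 - q) ≤ σ ^ ((i : ℝ) - b - α) :=
      Real.rpow_le_rpow_of_exponent_ge hσ hσ1 (by linarith)
    have s3 : 1 ≤ σ ^ ((i : ℝ) - b - α) :=
      Real.one_le_rpow_of_pos_of_le_one_of_nonpos hσ hσ1 (by linarith)
    have s4 := i2.trans (mul_le_mul_of_nonneg_right s2 hB2)
    rw [s1] at i1
    set S := σ ^ ((i : ℝ) - b - α) with hS
    calc _ ≤ C₁ * (S * bracketIntegral p)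
          + Z * (C₂ * (S * bracketIntegral q) + C₃ * S) := by
          gcongr
          rw [smul_eq_mul]
          calc _ = C₃ * 1 := by ring
            _ ≤ _ := by gcongr
      _ = _ := by ring
  · intro x hx
    have hz : 0 < (linePt σ (2 * Real.pi * x)).re := by simpa using hσ
    have := k1 l hl (linePt σ (2 * Real.pi * x)) hz (by simpa using hσ1) (him x hx)
    rw [iteratedDeriv_three_sub hdD hdE hz] at this
    refine this.trans (le_of_eq ?_)
    congr 2; rw [hp]; ring
  · intro x hx n hn
    set z := linePt σ (2 * Real.pi * x) with hz
    have hzr : 0 < z.re := by simpa [hz] using hσ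
    have e : linePt σ (2 * Real.pi * (x + n)) = z + n * (2 * Real.pi * Complex.I) := by
      simp only [hz, linePt]; push_cast; ring
    have n1 := k2 l hl z hzr (by simpa [hz] using hσ1) (him x hx) n hn
    have n2 := k3 l hl (z + n * (2 * Real.pi * Complex.I)) (by simpa [hz] using hσ)
    have hn1 : (1 : ℝ) ≤ |(n : ℝ)| := by exact_mod_cast Int.one_le_abs hn
    have hbig : |(n : ℝ)| ≤ ‖z + n * (2 * Real.pi * Complex.I)‖ := by
      rw [← e]
      refine le_trans ?_ (Complex.abs_im_le_norm _)
      rw [linePt_im, abs_mul, abs_of_pos (by positivity : 0 < 2 * Real.pi), add_comm]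
      have : |(n : ℝ)| - 1 / 2 ≤ |(n : ℝ) + x| := by
        have := abs_sub_abs_le_abs_sub (n : ℝ) (-x)
        rw [abs_neg, sub_neg_eq_add] at this
        linarith
      nlinarith
    have m1 := norm_rpow_neg_intCast_le (p := -b) hn le_rfl (by linarith)
      (by positivity : 0 ≤ C₂ * ‖z‖ ^ (-q))
    have m2 := norm_rpow_neg_intCast_le (p := -(b - i) - α - 3) hn hbig (by linarith) hC₃
    have n3 : C₂ * |(n : ℝ)| ^ (-b) * ‖z‖ ^ ((i : ℝ) - α - 3)
        = C₂ * ‖z‖ ^ (-q) * |(n : ℝ)| ^ (-b) := by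
      rw [mul_right_comm]; congr 3; rw [hq]; ring
    rw [n3] at n1
    change ‖iteratedDeriv 3 (discreteSymbol α l b i) (linePt σ (2 * Real.pi * (x + n)))
          - iteratedDeriv 3 (exactSymbol α l (b - i)) (linePt σ (2 * Real.pi * (x + n)))‖ ≤ _
    rw [e, mul_add]
    exact (norm_sub_le _ _).trans (add_le_add (n1.trans m1) (n2.trans m2))

theorem norm_integral_exp_mul_le {s : ℝ} (hs : 0 < s) {G : ℝ → ℂ} (hG : Integrable G) :
    ‖∫ y : ℝ, Complex.exp (linePt (1 / s) y * s) * G y‖ ≤ Real.exp 1 * ∫ y : ℝ, ‖G y‖ := by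
  rw [← integral_const_mul]
  refine norm_integral_le_of_norm_le (hG.norm.const_mul _) (Eventually.of_forall fun y => ?_)
  rw [norm_mul, Complex.norm_exp, Complex.re_mul_ofReal, linePt_re, one_div_mul_cancel hs.ne']

/-- From an inversion formula on the line `Re z = 1 / s` to a pointwise bound. -/
theorem abs_le_of_inversion {s X C r : ℝ} (hs : 0 < s) {G : ℝ → ℂ} (hG : Integrable G)
    (hinv : (s : ℂ) ^ 3 * (X : ℂ) = -(1 / (2 * Real.pi)) *
      ∫ y : ℝ, Complex.exp (linePt (1 / s) y * s) * G y)
    (hb : ∫ y : ℝ, ‖G y‖ ≤ C * (1 / s) ^ (-r)) :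
    |X| ≤ Real.exp 1 * C * s ^ (r - 3) := by
  have hpi := Real.pi_gt_three
  have h1 := congrArg norm hinv
  rw [norm_mul, norm_pow, Complex.norm_real, Complex.norm_real, Real.norm_of_nonneg hs.le,
    Real.norm_eq_abs, norm_mul] at h1
  have h2 : ‖-(1 / (2 * Real.pi) : ℂ)‖ ≤ 1 := by
    rw [norm_neg, ← Complex.ofReal_ofNat, ← Complex.ofReal_mul, ← Complex.ofReal_one,
      ← Complex.ofReal_div, Complex.norm_real, Real.norm_of_nonneg (by positivity),
      div_le_one (by positivity)]
    linarith
  have h3 : s ^ 3 * |X| ≤ Real.exp 1 * (C * s ^ r) := by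
    rw [h1]
    calc _ ≤ 1 * (Real.exp 1 * ∫ y : ℝ, ‖G y‖) :=
          mul_le_mul h2 (norm_integral_exp_mul_le hs hG) (norm_nonneg _) zero_le_one
      _ ≤ _ := by
          rw [one_mul]
          refine mul_le_mul_of_nonneg_left (hb.trans (le_of_eq ?_)) (Real.exp_pos 1).le
          rw [one_div, Real.inv_rpow hs.le, Real.rpow_neg hs.le, inv_inv]
  have h4 : s ^ (r - 3) * s ^ 3 = s ^ r := by
    rw [← Real.rpow_natCast s 3, ← Real.rpow_add hs]; congr 1; norm_num
  have h5 : s ^ 3 * |X| ≤ s ^ 3 * (Real.exp 1 * C * s ^ (r - 3)) := by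
    refine h3.trans (le_of_eq ?_)
    rw [← h4]; ring
  exact le_of_mul_le_mul_left h5 (by positivity)

/-- The kernel error away from the origin, uniformly in the eigenvalue. -/
theorem exists_abs_discreteKernel_sub_le {α b : ℝ} (h0 : 0 < α) (h1 : α < 1) {i : ℕ}
    (hi12 : i = 1 ∨ i = 2) (hb2 : 2 ≤ b) (hib : (i : ℝ) < b + α) :
    ∃ C : ℝ, 0 ≤ C ∧ ∀ l : ℝ, 0 ≤ l → ∀ s : ℝ, 1 ≤ s →
      |discreteKernel α l b i s - relaxKernel α l (b - i) s| ≤ C * s ^ (α + b - i - 3) := by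
  obtain ⟨C, hC, hb⟩ := exists_integral_norm_iteratedDeriv_sub_le h0 h1 hi12 hb2 hib
  have hi2 : (i : ℝ) ≤ 2 := by rcases hi12 with h | h <;> norm_num [h]
  refine ⟨Real.exp 1 * C, by positivity, fun l hl s hs => ?_⟩
  have hs0 : 0 < s := by linarith
  have hσ : 0 < 1 / s := by positivity
  have d1 := discreteKernel_inversion (s := s) (b := b) h0 h1 hl (by linarith) i hσ
  have d2 := relaxKernel_inversion (a := b - i) h0 h1 hl (by linarith) hσ hs0
  refine abs_le_of_inversion (r := α + b - i) hs0 (d1.1.sub d2.1) ?_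
    ((hb l hl (1 / s) hσ ((div_le_one hs0).2 hs)).trans (le_of_eq ?_))
  · have he : ∀ G : ℝ → ℂ, Integrable G → Integrable fun y : ℝ =>
        Complex.exp (linePt (1 / s) y * s) * G y := by
      intro G hG
      refine hG.bdd_mul (c := Real.exp 1) ?_ (Eventually.of_forall fun y => ?_)
      · have := continuous_linePt (1 / s)
        exact Continuous.aestronglyMeasurable (by fun_prop)
      · rw [Complex.norm_exp, Complex.re_mul_ofReal, linePt_re, one_div_mul_cancel hs0.ne']
    push_cast
    rw [mul_sub, d1.2, d2.2, ← mul_sub, ← integral_sub (he _ d1.1) (he _ d2.1)]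
    simp_rw [← mul_sub]
    rfl
  · congr 2; ring

/-- The bound for the exact kernel that is uniform in the eigenvalue. -/
theorem exists_abs_relaxKernel_le_uniform {α a : ℝ} (h0 : 0 < α) (h1 : α < 1) (ha : 0 ≤ a) :
    ∃ C : ℝ, 0 ≤ C ∧ ∀ l : ℝ, 0 ≤ l → ∀ s : ℝ, 0 < s →
      |relaxKernel α l a s| ≤ C * s ^ (a + α - 1) := by
  obtain ⟨C, hC, hb⟩ := exists_norm_iteratedDeriv_exactSymbol_le h0 h1 a
  have hB := bracketIntegral_nonneg (a + α + 3)
  refine ⟨Real.exp 1 * (C * bracketIntegral (a + α + 3)), by positivity, fun l hl s hs => ?_⟩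
  have hσ : 0 < 1 / s := by positivity
  have d2 := relaxKernel_inversion (a := a) h0 h1 hl ha hσ hs
  have := abs_le_of_inversion (r := a + α + 2) (C := C * bracketIntegral (a + α + 3)) hs
    d2.1 d2.2 ?_
  · refine this.trans (le_of_eq ?_)
    congr 2; ring
  · have hi := integrable_norm_linePt_rpow (p := a + α + 3) hσ (by linarith)
    calc _ ≤ ∫ y : ℝ, C * ‖linePt (1 / s) y‖ ^ (-(a + α + 3)) := by
          refine integral_mono d2.1.norm (hi.const_mul _) fun y => ?_
          refine (hb l hl _ (by simpa using hs)).trans (le_of_eq ?_)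
          congr 2; ring
      _ = _ := by
          rw [integral_const_mul, integral_norm_linePt_rpow hσ, mul_comm (_ ^ _), ← mul_assoc]
          congr 2; ring

theorem abs_coeff_zero_transferSeries_le {α l : ℝ} (h0 : 0 < α) (h1 : α < 1) (hl : 0 ≤ l) :
    |PowerSeries.coeff 0 (transferSeries α l 1)| ≤ 3 / 2 := by
  have hc := constantCoeff_schemeSeries α l
  have hp := constantCoeff_schemeSeries_pos (α := α) (l := l) h1 hl
  have e1 : PowerSeries.constantCoeff bdfSeries = 3 / 2 := by simp [bdfSeries]
  have e2 : PowerSeries.constantCoeff (cnSeries α) = 1 - α / 2 := by simp [cnSeries]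
  rw [PowerSeries.coeff_zero_eq_constantCoeff_apply, transferSeries]
  rw [hc] at hp
  simp only [map_mul, pow_one, PowerSeries.constantCoeff_inv, hc, e1, e2]
  rw [abs_of_nonneg (mul_nonneg (by linarith) (inv_nonneg.2 hp.le)), ← div_eq_mul_inv,
    div_le_iff₀ hp]
  nlinarith [mul_nonneg hl (by linarith : 0 ≤ 1 - α / 2)]

/-- The kernel error for the source on the whole half line. -/
theorem exists_abs_discreteKernel_one_sub_le {α b : ℝ} (h0 : 0 < α) (h1 : α < 1) (hb2 : 2 ≤ b) :
    ∃ C : ℝ, 0 ≤ C ∧ ∀ l : ℝ, 0 ≤ l → ∀ s : ℝ, 0 < s →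
      |discreteKernel α l b 1 s - relaxKernel α l (b - 1) s| ≤ C * s ^ (α + b - 4) := by
  obtain ⟨C₁, hC₁, k1⟩ := exists_abs_discreteKernel_sub_le (b := b) h0 h1 (i := 1) (Or.inl rfl) hb2
    (by push_cast; linarith)
  obtain ⟨C₂, hC₂, k2⟩ := exists_abs_relaxKernel_le_uniform (a := b - 1) h0 h1 (by linarith)
  have hG : 0 < Real.Gamma b := Real.Gamma_pos_of_pos (by linarith)
  refine ⟨C₁ + (3 / 2 / Real.Gamma b + C₂), by positivity, fun l hl s hs => ?_⟩
  have hs' : 0 ≤ s ^ (α + b - 4) := by positivity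
  rcases le_or_gt 1 s with h | h
  · have := k1 l hl s h
    rw [show α + b - ((1 : ℕ) : ℝ) - 3 = α + b - 4 by push_cast; ring, Nat.cast_one] at this
    refine this.trans ?_
    gcongr
    have : 0 ≤ 3 / 2 / Real.Gamma b + C₂ := by positivity
    linarith
  · have e1 : |discreteKernel α l b 1 s| ≤ 3 / 2 / Real.Gamma b * s ^ (α + b - 4) := by
      rw [discreteKernel_eq_sum (n := 1) (by simpa using h.le), Finset.sum_range_one, Nat.cast_zero,
        sub_zero, abs_mul, fracKernel_of_pos hs,
        abs_of_nonneg (by positivity : 0 ≤ s ^ (b - 1) / _)]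
      calc _ ≤ 3 / 2 * (s ^ (α + b - 4) / Real.Gamma b) := by
            gcongr ?_ * (?_ / _)
            · exact abs_coeff_zero_transferSeries_le h0 h1 hl
            · exact Real.rpow_le_rpow_of_exponent_ge hs h.le (by linarith)
        _ = _ := by ring
    have e2 : |relaxKernel α l (b - 1) s| ≤ C₂ * s ^ (α + b - 4) := by
      refine (k2 l hl s hs).trans ?_
      gcongr ?_ * ?_
      exact Real.rpow_le_rpow_of_exponent_ge hs h.le (by linarith)
    calc _ ≤ _ := abs_sub _ _
      _ ≤ _ := add_le_add e1 e2
      _ ≤ _ := by nlinarith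

/-! ### Convolution calculus on the half line -/

/-- The convolution on the line. For functions that vanish on `(-∞, 0]` it is
`∫₀ᵗ f(t-s) g(s) ds`. -/
def conv (f g : ℝ → ℝ) (t : ℝ) : ℝ := ∫ s, f (t - s) * g s

theorem fracKernel_mul_left {b τ : ℝ} (hτ : 0 < τ) (x : ℝ) :
    fracKernel b (τ * x) = τ ^ (b - 1) * fracKernel b x := by
  rcases le_or_gt x 0 with h | h
  · rw [fracKernel_of_nonpos h, fracKernel_of_nonpos (mul_nonpos_of_nonneg_of_nonpos hτ.le h),
      mul_zero]
  · rw [fracKernel_of_pos h, fracKernel_of_pos (mul_pos hτ h), Real.mul_rpow hτ.le h.le,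
      mul_div_assoc]

theorem relaxKernel_mul_left {α l a τ : ℝ} (hτ : 0 < τ) (x : ℝ) :
    relaxKernel α l a (τ * x) = τ ^ (a + α - 1) * relaxKernel α (l * τ ^ α) a x := by
  rw [relaxKernel, relaxKernel, ← tsum_mul_left]
  congr 1
  ext k
  rw [relaxTerm, relaxTerm, fracKernel_mul_left hτ,
    show a + α * (k + 1) - 1 = (a + α - 1) + α * k by ring, Real.rpow_add hτ, Real.rpow_mul hτ.le,
    Real.rpow_natCast, show -(l * τ ^ α) = (-l) * τ ^ α by ring, mul_pow]
  ring


theorem conv_eq_intervalIntegral {f g : ℝ → ℝ} (hf : ∀ t ≤ 0, f t = 0) (hg : ∀ t ≤ 0, g t = 0)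
    {t : ℝ} (ht : 0 ≤ t) : conv f g t = ∫ s in (0 : ℝ)..t, f (t - s) * g s := by
  rw [conv, intervalIntegral.integral_of_le ht,
    setIntegral_eq_integral_of_forall_compl_eq_zero]
  intro s hs
  rcases le_or_gt s 0 with h | h
  · rw [hg s h, mul_zero]
  · rw [hf _ (by simp only [mem_Ioc, not_and, not_le] at hs; linarith [hs h]), zero_mul]

theorem conv_of_nonpos {f g : ℝ → ℝ} (hf : ∀ t ≤ 0, f t = 0) (hg : ∀ t ≤ 0, g t = 0)
    {t : ℝ} (ht : t ≤ 0) : conv f g t = 0 := by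
  rw [conv]
  refine integral_eq_zero_of_ae (Eventually.of_forall fun s => ?_)
  rcases le_or_gt s 0 with h | h
  · simp [hg s h]
  · simp [hf (t - s) (by linarith)]

/-- The semigroup property of the fractional integrals, which is Euler's beta integral. -/
theorem conv_fracKernel {p q : ℝ} (hp : 0 < p) (hq : 0 < q) :
    conv (fracKernel p) (fracKernel q) = fracKernel (p + q) := by
  ext t
  rcases le_or_gt t 0 with ht | ht
  · rw [conv_of_nonpos (fun _ => fracKernel_of_nonpos) (fun _ => fracKernel_of_nonpos) ht,
      fracKernel_of_nonpos ht]
  have hG := Complex.Gamma_mul_Gamma_eq_betaIntegral (s := (q : ℂ)) (t := (p : ℂ)) (by simpa)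
    (by simpa)
  have hB := Complex.betaIntegral_scaled (q : ℂ) (p : ℂ) ht
  have hGp := Real.Gamma_pos_of_pos hp
  have hGq := Real.Gamma_pos_of_pos hq
  have hGpq := Real.Gamma_pos_of_pos (add_pos hp hq)
  have e1 : conv (fracKernel p) (fracKernel q) t
      = (Real.Gamma p * Real.Gamma q)⁻¹ * ∫ s in (0 : ℝ)..t, s ^ (q - 1) * (t - s) ^ (p - 1) := by
    rw [conv_eq_intervalIntegral (fun _ => fracKernel_of_nonpos) (fun _ => fracKernel_of_nonpos)
      ht.le, intervalIntegral.integral_of_le ht.le, intervalIntegral.integral_of_le ht.le,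
      integral_Ioc_eq_integral_Ioo, integral_Ioc_eq_integral_Ioo, ← integral_const_mul]
    refine setIntegral_congr_fun measurableSet_Ioo fun s hs => ?_
    rw [fracKernel_of_pos (sub_pos.2 hs.2), fracKernel_of_pos hs.1]
    field_simp
  have e2 : ((∫ s in (0 : ℝ)..t, s ^ (q - 1) * (t - s) ^ (p - 1) : ℝ) : ℂ)
      = (t : ℂ) ^ ((q : ℂ) + p - 1) * Complex.betaIntegral q p := by
    rw [← hB, ← intervalIntegral.integral_ofReal]
    refine intervalIntegral.integral_congr fun s hs => ?_
    rw [uIcc_of_le ht.le] at hs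
    rw [Complex.ofReal_mul, Complex.ofReal_cpow hs.1, Complex.ofReal_cpow (by linarith [hs.2])]
    push_cast
    rfl
  rw [← Complex.ofReal_add, Complex.Gamma_ofReal, Complex.Gamma_ofReal, Complex.Gamma_ofReal] at hG
  have e3 : (t : ℂ) ^ ((q : ℂ) + p - 1) = ((t ^ (p + q - 1) : ℝ) : ℂ) := by
    rw [Complex.ofReal_cpow ht.le]; push_cast; congr 1; ring
  rw [e3] at e2
  rw [e1, fracKernel_of_pos ht]
  apply Complex.ofReal_injective
  push_cast
  rw [e2]
  have n1 : (Real.Gamma p : ℂ) ≠ 0 := Complex.ofReal_ne_zero.2 hGp.ne'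
  have n2 : (Real.Gamma q : ℂ) ≠ 0 := Complex.ofReal_ne_zero.2 hGq.ne'
  have n3 : (Real.Gamma (p + q) : ℂ) ≠ 0 := Complex.ofReal_ne_zero.2 hGpq.ne'
  rw [add_comm q p] at hG
  field_simp
  linear_combination -(((t ^ (p + q - 1) : ℝ)) : ℂ) * hG

theorem integrable_fracKernel_mul_fracKernel {p q : ℝ} (hp : 0 < p) (hq : 0 < q) (t : ℝ) :
    Integrable fun s => fracKernel p (t - s) * fracKernel q s := by
  rcases le_or_gt t 0 with ht | ht
  · have : (fun s => fracKernel p (t - s) * fracKernel q s) = 0 := by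
      ext s
      rcases le_or_gt s 0 with h | h
      · simp [fracKernel_of_nonpos h]
      · simp [fracKernel_of_nonpos (show t - s ≤ 0 by linarith)]
    rw [this]
    exact integrable_zero _ _ _
  · by_contra h
    have h1 := congrFun (conv_fracKernel hp hq) t
    rw [conv, integral_undef h, fracKernel_of_pos ht] at h1
    have := Real.Gamma_pos_of_pos (add_pos hp hq)
    have h2 : 0 < t ^ (p + q - 1) / Real.Gamma (p + q) := by positivity
    exact h2.ne h1

/-- `f` is measurable, vanishes on `(-∞, 0]` and is `O(t^(p-1))` on bounded intervals. -/
def IsFracBounded (p : ℝ) (f : ℝ → ℝ) : Prop :=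
  Measurable f ∧ ∀ R, ∃ C, 0 ≤ C ∧ ∀ t ≤ R, |f t| ≤ C * fracKernel p t

theorem IsFracBounded.of_nonpos {p : ℝ} {f : ℝ → ℝ} (hf : IsFracBounded p f) {t : ℝ} (ht : t ≤ 0) :
    f t = 0 := by
  obtain ⟨C, -, hC⟩ := hf.2 0
  have := hC t ht
  rw [fracKernel_of_nonpos ht, mul_zero] at this
  exact abs_nonpos_iff.1 this

theorem isFracBounded_fracKernel {p : ℝ} (hp : 0 < p) : IsFracBounded p (fracKernel p) :=
  ⟨measurable_fracKernel p, fun _ => ⟨1, zero_le_one, fun t _ => by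
    rw [one_mul, abs_of_nonneg (fracKernel_nonneg hp t)]⟩⟩

theorem isFracBounded_relaxKernel {α l a : ℝ} (h0 : 0 < α) (hl : 0 ≤ l) (ha : 0 ≤ a) :
    IsFracBounded (a + α) (relaxKernel α l a) := by
  refine ⟨measurable_relaxKernel h0 hl ha, fun R => ?_⟩
  obtain ⟨C, hC, hb⟩ := exists_abs_relaxKernel_le h0 hl ha R
  have hG := Real.Gamma_pos_of_pos (show 0 < a + α by linarith)
  refine ⟨C * Real.Gamma (a + α), by positivity, fun t ht => ?_⟩
  rcases le_or_gt t 0 with h | h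
  · rw [relaxKernel_of_nonpos h, fracKernel_of_nonpos h]; simp
  · rw [fracKernel_of_pos h]
    refine (hb t h ht).trans (le_of_eq ?_)
    field_simp

theorem IsFracBounded.integrable_mul {p q : ℝ} (hp : 0 < p) (hq : 0 < q) {f g : ℝ → ℝ}
    (hf : IsFracBounded p f) (hg : IsFracBounded q g) (t : ℝ) :
    Integrable fun s => f (t - s) * g s := by
  obtain ⟨C, hC, hfC⟩ := hf.2 t
  obtain ⟨D, hD, hgD⟩ := hg.2 t
  refine ((integrable_fracKernel_mul_fracKernel hp hq t).const_mul (C * D)).mono'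
    ((hf.1.comp (by fun_prop)).mul hg.1).aestronglyMeasurable (Eventually.of_forall fun s => ?_)
  rcases le_or_gt s 0 with h | h
  · simp [hg.of_nonpos h, fracKernel_of_nonpos h]
  rcases le_or_gt t s with h' | h'
  · simp [hf.of_nonpos (show t - s ≤ 0 by linarith),
      fracKernel_of_nonpos (show t - s ≤ 0 by linarith)]
  rw [norm_mul]
  refine (mul_le_mul (hfC _ (by linarith)) (hgD s h'.le) (abs_nonneg _)
    (mul_nonneg hC (fracKernel_nonneg hp _))).trans (le_of_eq (by ring))

theorem IsFracBounded.norm_conv_le {p q : ℝ} (hp : 0 < p) (hq : 0 < q) {f g : ℝ → ℝ}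
    (hf : IsFracBounded p f) (hg : IsFracBounded q g) (R : ℝ) :
    ∃ C, 0 ≤ C ∧ ∀ t ≤ R, ∫ s, |f (t - s) * g s| ≤ C * fracKernel (p + q) t := by
  obtain ⟨C, hC, hfC⟩ := hf.2 R
  obtain ⟨D, hD, hgD⟩ := hg.2 R
  refine ⟨C * D, by positivity, fun t ht => ?_⟩
  rw [← conv_fracKernel hp hq, conv, ← integral_const_mul]
  refine integral_mono (hf.integrable_mul hp hq hg t).norm
    ((integrable_fracKernel_mul_fracKernel hp hq t).const_mul _) fun s => ?_
  dsimp only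
  rcases le_or_gt s 0 with h | h
  · simp [hg.of_nonpos h, fracKernel_of_nonpos h]
  rcases le_or_gt t s with h' | h'
  · simp [hf.of_nonpos (show t - s ≤ 0 by linarith),
      fracKernel_of_nonpos (show t - s ≤ 0 by linarith)]
  rw [abs_mul]
  refine (mul_le_mul (hfC _ (by linarith)) (hgD s (by linarith)) (abs_nonneg _)
    (mul_nonneg hC (fracKernel_nonneg hp _))).trans (le_of_eq (by ring))

/-- Fubini's theorem for `f * (g * w)`, where `f * g` is locally bounded and `w` is integrable on
the half line. -/
theorem conv_conv {p q : ℝ} (hp : 0 < p) (hq : 0 < q) (hpq : 1 ≤ p + q) {f g w : ℝ → ℝ}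
    (hf : IsFracBounded p f) (hg : IsFracBounded q g) (hw : Integrable w)
    (hw0 : ∀ s ≤ 0, w s = 0) (t : ℝ) :
    (Integrable fun s => f (t - s) * conv g w s) ∧
    (Integrable fun r => conv f g (t - r) * w r) ∧
    conv f (conv g w) t = conv (conv f g) w t := by
  set F : ℝ × ℝ → ℝ := fun z => f (t - z.1) * g (z.1 - z.2) * w z.2 with hF
  have hm : AEStronglyMeasurable F (volume.prod volume) := by
    refine AEStronglyMeasurable.mul ?_ (hw.aestronglyMeasurable.comp_snd)
    exact ((hf.1.comp (by fun_prop)).mul (hg.1.comp (by fun_prop))).aestronglyMeasurable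
  have hshift : ∀ r : ℝ, ∀ H : ℝ → ℝ → ℝ, ∫ s, H (t - s) (s - r) = ∫ s, H (t - r - s) s := by
    intro r H
    rw [← integral_sub_right_eq_self (fun s => H (t - r - s) s) r]
    congr 1; ext s; congr 1; ring
  obtain ⟨M, hM, hMb⟩ := hf.norm_conv_le hp hq hg (max t 0)
  have hGpq := Real.Gamma_pos_of_pos (add_pos hp hq)
  set B := M * ((max t 0) ^ (p + q - 1) / Real.Gamma (p + q)) with hB
  have hB0 : 0 ≤ B := by positivity
  have hFn : ∀ r, ∫ s, ‖F (s, r)‖ = (∫ s, |f (t - r - s) * g s|) * |w r| := by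
    intro r
    simp only [hF, norm_mul, Real.norm_eq_abs]
    rw [integral_mul_const]
    simp_rw [abs_mul]
    rw [hshift r fun a b => |f a| * |g b|]
  have hI : Integrable F (volume.prod volume) := by
    rw [integrable_prod_iff' hm]
    constructor
    · refine Eventually.of_forall fun r => ?_
      have h1 := (hf.integrable_mul hp hq hg (t - r)).comp_sub_right r
      refine (h1.mul_const (w r)).congr (Eventually.of_forall fun s => ?_)
      simp only [hF]
      congr 3; ring
    · refine (hw.norm.const_mul B).mono' (hm.norm.prod_swap.integral_prod_right') ?_
      refine Eventually.of_forall fun r => ?_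
      change ‖∫ s, ‖F (s, r)‖‖ ≤ _
      rw [hFn, Real.norm_of_nonneg (mul_nonneg (integral_nonneg fun s => abs_nonneg _)
        (abs_nonneg _)), Real.norm_eq_abs]
      rcases le_or_gt r 0 with h | h
      · rw [hw0 r h, abs_zero, mul_zero, mul_zero]
      · refine mul_le_mul_of_nonneg_right ?_ (abs_nonneg _)
        refine (hMb _ ((by linarith : t - r ≤ t).trans (le_max_left _ _))).trans ?_
        refine mul_le_mul_of_nonneg_left ?_ hM
        rcases le_or_gt (t - r) 0 with h' | h'
        · rw [fracKernel_of_nonpos h']; positivity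
        · rw [fracKernel_of_pos h']
          have := (by linarith : t - r ≤ t).trans (le_max_left t 0)
          gcongr
  have e1 : ∀ s, ∫ r, F (s, r) = f (t - s) * conv g w s := by
    intro s
    simp only [hF, mul_assoc]
    rw [integral_const_mul, conv]
  have e2 : ∀ r, ∫ s, F (s, r) = conv f g (t - r) * w r := by
    intro r
    simp only [hF]
    rw [integral_mul_const, hshift r fun a b => f a * g b, conv]
  refine ⟨?_, ?_, ?_⟩
  · have := hI.integral_prod_left
    simp_rw [e1] at this
    exact this
  · have := hI.integral_prod_right
    simp_rw [e2] at this
    exact this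
  · rw [conv, conv]
    simp_rw [← e1, ← e2]
    exact integral_integral_swap hI

/-- Fractional integration of the source acts on the exact kernel by a shift of its index. -/
theorem conv_relaxKernel_fracKernel {α l a c : ℝ} (h0 : 0 < α) (hl : 0 ≤ l) (ha : 0 ≤ a)
    (hc : 0 < c) : conv (relaxKernel α l a) (fracKernel c) = relaxKernel α l (a + c) := by
  ext t
  have hb : ∀ k : ℕ, 0 < a + α * (k + 1) := fun k => by positivity
  set F : ℕ → ℝ → ℝ := fun k s => relaxTerm α l a k (t - s) * fracKernel c s with hF
  have eF : ∀ k, F k = fun s =>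
      (-l) ^ k * (fracKernel (a + α * (k + 1)) (t - s) * fracKernel c s) :=
    fun k => by ext s; simp only [hF, relaxTerm]; ring
  have hFi : ∀ k, Integrable (F k) := fun k => by
    rw [eF]; exact (integrable_fracKernel_mul_fracKernel (hb k) hc t).const_mul _
  have hval : ∀ k : ℕ, ∫ s, fracKernel (a + α * (k + 1)) (t - s) * fracKernel c s
      = fracKernel (a + c + α * (k + 1)) t := by
    intro k
    have := congrFun (conv_fracKernel (hb k) hc) t
    rw [conv] at this
    rw [this]; congr 1; ring
  have hFn : ∀ k, ∫ s, ‖F k s‖ = |relaxTerm α l (a + c) k t| := by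
    intro k
    rw [eF]
    simp_rw [norm_mul, Real.norm_of_nonneg (fracKernel_nonneg (hb k) _),
      Real.norm_of_nonneg (fracKernel_nonneg hc _)]
    rw [integral_const_mul, hval, relaxTerm, abs_mul,
      abs_of_nonneg (fracKernel_nonneg (by linarith [hb k]) t), Real.norm_eq_abs]
  have hFv : ∀ k, ∫ s, F k s = relaxTerm α l (a + c) k t := by
    intro k
    rw [eF, integral_const_mul, hval, relaxTerm]
  have h := hasSum_integral_of_summable_integral_norm hFi (by
    simp_rw [hFn]; exact summable_abs_relaxTerm h0 hl (by linarith) t)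
  simp_rw [hFv] at h
  rw [relaxKernel, h.tsum_eq, conv]
  congr 1
  ext s
  simp only [hF]
  rw [tsum_mul_right, relaxKernel]

theorem relaxKernel_one_sub {α l : ℝ} (h0 : 0 < α) (h1 : α < 1) (hl : 0 ≤ l) (t : ℝ) :
    relaxKernel α l (1 - α) t = fracKernel 1 t - l * relaxKernel α l 1 t := by
  rw [relaxKernel, (summable_relaxTerm h0 hl (by linarith) t).tsum_eq_zero_add, relaxKernel,
    sub_eq_add_neg (fracKernel 1 t), ← neg_mul, ← tsum_mul_left]
  congr 1
  · simp [relaxTerm]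
  · congr 1
    ext k
    rw [relaxTerm, relaxTerm, pow_succ]
    push_cast
    rw [show 1 - α + α * ((k : ℝ) + 1 + 1) = 1 + α * (k + 1) by ring]
    ring

theorem conv_add_right {f g h : ℝ → ℝ} {t : ℝ} (hg : Integrable fun s => f (t - s) * g s)
    (hh : Integrable fun s => f (t - s) * h s) :
    conv f (fun s => g s + h s) t = conv f g t + conv f h t := by
  simp only [conv, mul_add]
  exact integral_add hg hh

theorem conv_const_mul_right {f g : ℝ → ℝ} {t : ℝ} (c : ℝ) :
    conv f (fun s => c * g s) t = c * conv f g t := by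
  simp only [conv, mul_left_comm _ c]
  exact integral_const_mul _ _

theorem conv_congr_right {f g h : ℝ → ℝ} {t : ℝ} (hf : ∀ t ≤ 0, f t = 0)
    (hgh : ∀ᵐ s, s ≤ t → g s = h s) : conv f g t = conv f h t := by
  refine integral_congr_ae ?_
  filter_upwards [hgh] with s hs
  rcases le_or_gt s t with h' | h'
  · rw [hs h']
  · rw [hf _ (by linarith), zero_mul, zero_mul]

/-- The variation of constants formula for the scalar problem `D^α y + l y = φ`, where `w` is the
derivative of `y`. -/
theorem eq_relaxKernel_of_caputo_eq {α l T y0 : ℝ} (h0 : 0 < α) (h1 : α < 1) (hl : 0 ≤ l)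
    {w φ : ℝ → ℝ} (hw : Integrable w) (hw0 : ∀ s ≤ 0, w s = 0)
    (heq : ∀ᵐ s, s ≤ T → φ s = conv (fracKernel (1 - α)) w s
      + l * (y0 * fracKernel 1 s + conv (fracKernel 1) w s))
    {t : ℝ} (htT : t ≤ T) :
    y0 * fracKernel 1 t + conv (fracKernel 1) w t
      = y0 * relaxKernel α l (1 - α) t + conv (relaxKernel α l 0) φ t := by
  have hb0 : IsFracBounded α (relaxKernel α l 0) := by
    simpa using isFracBounded_relaxKernel h0 hl le_rfl
  obtain ⟨i1, i2, e1⟩ := conv_conv h0 (by linarith : 0 < 1 - α) (by linarith) hb0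
    (isFracBounded_fracKernel (by linarith)) hw hw0 t
  obtain ⟨j1, j2, e2⟩ := conv_conv h0 one_pos (by linarith) hb0
    (isFracBounded_fracKernel one_pos) hw hw0 t
  have j3 := hb0.integrable_mul h0 one_pos (isFracBounded_fracKernel one_pos) t
  have k1 := conv_relaxKernel_fracKernel h0 hl le_rfl (by linarith : 0 < 1 - α)
  have k2 := conv_relaxKernel_fracKernel h0 hl le_rfl one_pos
  rw [zero_add] at k1 k2
  rw [k1] at i2 e1
  rw [k2] at j2 e2
  have hφ : conv (relaxKernel α l 0) φ t = conv (relaxKernel α l (1 - α)) w t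
      + l * (y0 * relaxKernel α l 1 t + conv (relaxKernel α l 1) w t) := by
    rw [conv_congr_right (fun s hs => relaxKernel_of_nonpos hs)
      (heq.mono fun s hs hst => hs (hst.trans htT)), conv_add_right i1, conv_const_mul_right,
      conv_add_right, conv_const_mul_right, e1, e2, k2]
    · simpa only [mul_left_comm] using j3.const_mul y0
    · exact j1
    · have := (((j3.const_mul y0).congr (Eventually.of_forall fun s =>
        (mul_left_comm y0 (relaxKernel α l 0 (t - s)) (fracKernel 1 s)))).add j1).const_mul l
      refine this.congr (Eventually.of_forall fun s => ?_)
      simp only [Pi.add_apply]; ring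
  have e3 : conv (relaxKernel α l (1 - α)) w t
      = conv (fracKernel 1) w t - l * conv (relaxKernel α l 1) w t := by
    have i3 : Integrable fun s => fracKernel 1 (t - s) * w s := by
      refine (i2.add (j2.const_mul l)).congr (Eventually.of_forall fun s => ?_)
      simp only [Pi.add_apply, relaxKernel_one_sub h0 h1 hl]; ring
    simp only [conv]
    rw [← integral_const_mul, ← integral_sub i3 (j2.const_mul l)]
    congr 1
    ext s
    rw [relaxKernel_one_sub h0 h1 hl]; ring
  rw [hφ, e3, relaxKernel_one_sub h0 h1 hl]
  ring

/-- A convolution with a fractional integral of a datum that is given by its Taylor formula of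
second order. -/
theorem conv_taylor {p q c₀ c₁ : ℝ} {f : ℝ → ℝ} (hp : 0 < p) (hq : 0 < q)
    (hf : IsFracBounded p f) {w : ℝ → ℝ} (hw : Integrable w) (hw0 : ∀ s ≤ 0, w s = 0) (t : ℝ) :
    conv f (fun s => c₀ * fracKernel q s
        + (c₁ * fracKernel (q + 1) s + conv (fracKernel (q + 1)) w s))
      t = c₀ * conv f (fracKernel q) t
        + (c₁ * conv f (fracKernel (q + 1)) t + conv (conv f (fracKernel (q + 1))) w t) := by
  have i1 := hf.integrable_mul hp hq (isFracBounded_fracKernel hq) t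
  have i2 := hf.integrable_mul hp (by linarith) (isFracBounded_fracKernel
    (by linarith : 0 < q + 1)) t
  obtain ⟨j1, -, e⟩ := conv_conv hp (by linarith : 0 < q + 1) (by linarith) hf
    (isFracBounded_fracKernel (by linarith)) hw hw0 t
  have i2' : Integrable fun s => f (t - s) * (c₁ * fracKernel (q + 1) s) := by
    simpa only [mul_left_comm] using i2.const_mul c₁
  rw [conv_add_right, conv_add_right i2' j1, conv_const_mul_right, conv_const_mul_right, e]
  · simpa only [mul_left_comm] using i1.const_mul c₀
  · refine (i2'.add j1).congr (Eventually.of_forall fun s => ?_)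
    simp only [Pi.add_apply]; ring

/-! ### The scheme as a discrete convolution -/

theorem coeff_mul_eq_of_coeff_eq {R : Type*} [CommSemiring R] {S A B : PowerSeries R} {N : ℕ}
    (h : ∀ n ≤ N, PowerSeries.coeff n A = PowerSeries.coeff n B) {n : ℕ} (hn : n ≤ N) :
    PowerSeries.coeff n (S * A) = PowerSeries.coeff n (S * B) := by
  rw [PowerSeries.coeff_mul, PowerSeries.coeff_mul]
  refine Finset.sum_congr rfl fun ij hij => ?_
  have := Finset.HasAntidiagonal.mem_antidiagonal.1 hij
  rw [h ij.2 (by omega)]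

theorem coeff_mul_mk (S : PowerSeries ℝ) (f : ℕ → ℝ) (n : ℕ) :
    PowerSeries.coeff n (S * PowerSeries.mk f)
      = ∑ m ∈ Finset.range (n + 1), PowerSeries.coeff m S * f (n - m) := by
  rw [PowerSeries.coeff_mul, Finset.Nat.sum_antidiagonal_eq_sum_range_succ_mk]
  simp only [PowerSeries.coeff_mk]

theorem coeff_cnSeries_mul_succ (α : ℝ) (A : PowerSeries ℝ) (n : ℕ) :
    PowerSeries.coeff (n + 1) (cnSeries α * A)
      = (1 - α / 2) * PowerSeries.coeff (n + 1) A + α / 2 * PowerSeries.coeff n A := by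
  rw [cnSeries, add_mul, mul_assoc, map_add, PowerSeries.coeff_C_mul, PowerSeries.coeff_C_mul,
    PowerSeries.coeff_succ_X_mul]

/-- The sequence `U` extended by zero to negative indices. -/
theorem coeff_bdfSeries_mul_mk {U : ℤ → ℝ} (hU : ∀ k < 0, U k = 0) (n : ℕ) :
    PowerSeries.coeff n (bdfSeries * PowerSeries.mk fun m : ℕ => U m)
      = 3 / 2 * U n - 2 * U ((n : ℤ) - 1) + 1 / 2 * U ((n : ℤ) - 2) := by
  rw [bdfSeries, add_mul, add_mul, mul_assoc, mul_assoc, map_add, map_add, PowerSeries.coeff_C_mul,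
    PowerSeries.coeff_C_mul, PowerSeries.coeff_C_mul, mul_assoc]
  rcases n with _ | _ | n
  · simp [hU (-1) (by norm_num), hU (-2) (by norm_num)]
  · rw [PowerSeries.coeff_succ_X_mul, PowerSeries.coeff_succ_X_mul]
    simp [hU (-1) (by norm_num)]
    ring
  · rw [PowerSeries.coeff_succ_X_mul, PowerSeries.coeff_succ_X_mul, PowerSeries.coeff_succ_X_mul]
    simp only [PowerSeries.coeff_mk]
    push_cast
    rw [show (n : ℤ) + 1 + 1 - 1 = n + 1 by ring, show (n : ℤ) + 1 + 1 - 2 = n by ring]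
    ring

theorem startFun_eq_fracKernel (α t : ℝ) : startFun α t = fracKernel (3 - α) t := by
  rw [startFun, fracKernel, show 3 - α - 1 = 2 - α by ring]

/-- The scalar Crank-Nicolson scheme, solved by generating functions. -/
theorem scheme_eq_sum {α l τ y0 : ℝ} {N : ℕ} (h1 : α < 1) (hl : 0 ≤ l) (hτ : 0 < τ)
    {U : ℤ → ℝ} {Φ : ℝ → ℝ} (hU : ∀ k ≤ 0, U k = 0) (hΦ : Φ 0 = 0)
    (hstep : ∀ n : ℕ, 1 ≤ n → n ≤ N →
      τ ^ (-α) * ∑ j ∈ Finset.range (n + 1), glCoeff α j * U ((n : ℤ) - (j : ℤ))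
        + (1 - α / 2) * (l * U n) + α / 2 * (l * U ((n : ℤ) - 1))
      = (1 - α / 2) * Φ (n * τ) + α / 2 * Φ (((n : ℝ) - 1) * τ)
        + (1 - α / 2) * bdf2 τ (startFun α) (n * τ) * y0
        + α / 2 * bdf2 τ (startFun α) (((n : ℝ) - 1) * τ) * y0)
    {n : ℕ} (hn : n ≤ N) :
    τ⁻¹ * (3 / 2 * U n - 2 * U ((n : ℤ) - 1) + 1 / 2 * U ((n : ℤ) - 2))
      = y0 * discreteKernel α (l * τ ^ α) (3 - α) 2 n
        + τ ^ (α - 1) * ∑ m ∈ Finset.range (n + 1),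
          PowerSeries.coeff m (transferSeries α (l * τ ^ α) 1) * Φ (((n : ℝ) - m) * τ) := by
  have hτα : 0 < τ ^ α := by positivity
  set L := l * τ ^ α with hL
  have hS := (constantCoeff_schemeSeries_pos (α := α) (l := L) h1 (by positivity)).ne'
  set A : PowerSeries ℝ := PowerSeries.mk fun m : ℕ => U m with hA
  set P : ℤ → ℝ := fun k => startFun α (k * τ) with hP
  have hP0 : ∀ k < 0, P k = 0 := by
    intro k hk
    have : (k : ℝ) < 0 := by exact_mod_cast hk
    simp only [hP]
    rw [startFun_eq_fracKernel, fracKernel_of_nonpos]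
    nlinarith
  set B : PowerSeries ℝ := PowerSeries.mk (fun m : ℕ => Φ (m * τ))
    + PowerSeries.C (y0 * τ⁻¹) * (bdfSeries * PowerSeries.mk fun m : ℕ => P m) with hB
  have hBc : ∀ m : ℕ, PowerSeries.coeff m B = Φ (m * τ) + bdf2 τ (startFun α) (m * τ) * y0 := by
    intro m
    rw [hB, map_add, PowerSeries.coeff_C_mul, coeff_bdfSeries_mul_mk hP0,
      PowerSeries.coeff_mk, bdf2]
    simp only [hP]
    push_cast
    rw [sub_mul, sub_mul, one_mul]
    ring
  have hB0 : PowerSeries.coeff 0 B = 0 := by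
    rw [hBc]
    simp only [bdf2, startFun_eq_fracKernel, Nat.cast_zero, zero_mul, hΦ]
    rw [fracKernel_of_nonpos le_rfl, fracKernel_of_nonpos (by linarith),
      fracKernel_of_nonpos (by linarith)]
    simp
  have key : ∀ n ≤ N, PowerSeries.coeff n (schemeSeries α L * A)
      = PowerSeries.coeff n (cnSeries α * (PowerSeries.C (τ ^ α) * B)) := by
    intro n hn
    rcases n with _ | n
    · simp only [PowerSeries.coeff_zero_eq_constantCoeff_apply, map_mul]
      rw [← PowerSeries.coeff_zero_eq_constantCoeff_apply B, hB0,
        ← PowerSeries.coeff_zero_eq_constantCoeff_apply A, hA, PowerSeries.coeff_mk]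
      simp [hU 0 le_rfl]
    · have hs := hstep (n + 1) (by omega) hn
      rw [schemeSeries, add_mul, mul_assoc, map_add, PowerSeries.coeff_C_mul,
        coeff_cnSeries_mul_succ, coeff_cnSeries_mul_succ, PowerSeries.coeff_C_mul,
        PowerSeries.coeff_C_mul, hBc, hBc, hA, coeff_mul_mk, PowerSeries.coeff_mk,
        PowerSeries.coeff_mk]
      have e1 : ∑ m ∈ Finset.range (n + 1 + 1), PowerSeries.coeff m (glSeries α)
            * U ((n + 1 - m : ℕ) : ℤ)
          = ∑ j ∈ Finset.range (n + 1 + 1), glCoeff α j * U (((n + 1 : ℕ) : ℤ) - (j : ℤ)) := by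
        refine Finset.sum_congr rfl fun m hm => ?_
        rw [glSeries, PowerSeries.coeff_mk, Nat.cast_sub (by
          have := Finset.mem_range.1 hm; omega)]
      rw [e1]
      have e2 : τ ^ α * τ ^ (-α) = 1 := by rw [← Real.rpow_add hτ]; simp
      have e3 : ((n + 1 : ℕ) : ℤ) - 1 = n := by push_cast; ring
      have e4 : (((n + 1 : ℕ) : ℝ) - 1) = n := by push_cast; ring
      rw [e3, e4] at hs
      set W := ∑ j ∈ Finset.range (n + 1 + 1), glCoeff α j * U (((n + 1 : ℕ) : ℤ) - (j : ℤ))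
      rw [hL]
      linear_combination τ ^ α * hs - W * e2
  have hsol : ∀ n ≤ N, PowerSeries.coeff n A
      = PowerSeries.coeff n
          ((schemeSeries α L)⁻¹ * (cnSeries α * (PowerSeries.C (τ ^ α) * B))) := by
    intro n hn
    rw [← coeff_mul_eq_of_coeff_eq key hn, ← mul_assoc, PowerSeries.inv_mul_cancel _ hS, one_mul]
  have hrec := coeff_mul_eq_of_coeff_eq (S := bdfSeries) hsol hn
  rw [hA, coeff_bdfSeries_mul_mk (fun k hk => hU k hk.le)] at hrec
  rw [hrec]
  have e5 : bdfSeries * ((schemeSeries α L)⁻¹ * (cnSeries α * (PowerSeries.C (τ ^ α) * B)))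
      = PowerSeries.C (τ ^ α) * (transferSeries α L 1 * PowerSeries.mk (fun m : ℕ => Φ (m * τ)))
        + PowerSeries.C (τ ^ α) * (PowerSeries.C (y0 * τ⁻¹)
          * (transferSeries α L 2 * PowerSeries.mk fun m : ℕ => P m)) := by
    rw [hB, transferSeries, transferSeries]
    ring
  rw [e5, map_add, PowerSeries.coeff_C_mul, PowerSeries.coeff_C_mul, PowerSeries.coeff_C_mul,
    coeff_mul_mk, coeff_mul_mk, discreteKernel_eq_sum (n := n + 1) (by push_cast; linarith)]
  have e6 : τ⁻¹ * τ ^ α = τ ^ (α - 1) := by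
    rw [Real.rpow_sub_one hτ.ne']; field_simp
  have e7 : ∀ m ∈ Finset.range (n + 1), PowerSeries.coeff m (transferSeries α L 2)
        * P ((n - m : ℕ) : ℤ)
      = τ ^ (2 - α) * (PowerSeries.coeff m (transferSeries α L 2)
          * fracKernel (3 - α) (n - m)) := by
    intro m hm
    have hmn : m ≤ n := by have := Finset.mem_range.1 hm; omega
    simp only [hP]
    rw [startFun_eq_fracKernel, Int.cast_natCast, Nat.cast_sub hmn, mul_comm _ τ,
      fracKernel_mul_left hτ, show 3 - α - 1 = 2 - α by ring]
    ring
  have e8 : ∀ m ∈ Finset.range (n + 1), PowerSeries.coeff m (transferSeries α L 1)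
        * Φ ((n - m : ℕ) * τ)
      = PowerSeries.coeff m (transferSeries α L 1) * Φ (((n : ℝ) - m) * τ) := by
    intro m hm
    rw [Nat.cast_sub (by have := Finset.mem_range.1 hm; omega)]
  rw [Finset.sum_congr rfl e7, Finset.sum_congr rfl e8, ← Finset.mul_sum]
  have e9 : τ ^ (α - 1) * τ⁻¹ * τ ^ (2 - α) = 1 := by
    rw [← Real.rpow_neg_one τ, ← Real.rpow_add hτ, ← Real.rpow_add hτ]
    ring_nf; exact Real.rpow_zero τ
  rw [← e6] at e9 ⊢
  linear_combination (y0 * ∑ m ∈ Finset.range (n + 1),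
    PowerSeries.coeff m (transferSeries α L 2) * fracKernel (3 - α) (n - m)) * e9

/-- What the scheme with time step `τ` produces from the source `t^(b-2) / Γ(b-1)`; the scheme sees
the primitive `t^(b-1) / Γ(b)` and applies one BDF operator, hence `i = 1`. -/
def scaledDiscreteKernel (α l τ b t : ℝ) : ℝ :=
  τ ^ (α + b - 2) * discreteKernel α (l * τ ^ α) b 1 (t / τ)

theorem sum_fracKernel_eq {α l τ b t : ℝ} {n : ℕ} (hτ : 0 < τ) (ht : t ≤ n * τ) :
    τ ^ (α - 1) * ∑ m ∈ Finset.range (n + 1),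
        PowerSeries.coeff m (transferSeries α (l * τ ^ α) 1) * fracKernel b (t - m * τ)
      = scaledDiscreteKernel α l τ b t := by
  have ht' : t / τ ≤ (n + 1 : ℕ) := by
    rw [div_le_iff₀ hτ]; push_cast; nlinarith
  rw [scaledDiscreteKernel, discreteKernel_eq_sum ht',
    show α + b - 2 = (α - 1) + (b - 1) by ring, Real.rpow_add hτ, mul_assoc]
  congr 1
  rw [Finset.mul_sum]
  refine Finset.sum_congr rfl fun m _ => ?_
  rw [show t - m * τ = τ * (t / τ - m) by field_simp, fracKernel_mul_left hτ]
  ring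

theorem continuous_scaledDiscreteKernel {α l τ b : ℝ} (hb : 1 < b) :
    Continuous (scaledDiscreteKernel α l τ b) :=
  continuous_const.mul ((continuous_discreteKernel hb).comp (by fun_prop))

theorem integrable_continuous_mul {f w : ℝ → ℝ} (hf : Continuous f) (hf0 : ∀ s ≤ 0, f s = 0)
    (hw : Integrable w) (hw0 : ∀ s ≤ 0, w s = 0) (t : ℝ) :
    Integrable fun s => f (t - s) * w s := by
  obtain ⟨C, hC⟩ := (isCompact_Icc (a := 0) (b := max t 0)).exists_bound_of_continuousOn
    hf.continuousOn
  refine (hw.norm.const_mul C).mono' ?_ (Eventually.of_forall fun s => ?_)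
  · exact (Continuous.aestronglyMeasurable (by fun_prop)).mul hw.aestronglyMeasurable
  · rw [norm_mul]
    rcases le_or_gt s 0 with h | h
    · simp [hw0 s h]
    refine mul_le_mul_of_nonneg_right ?_ (norm_nonneg _)
    rcases le_or_gt (t - s) 0 with h' | h'
    · rw [hf0 _ h', ← hf0 0 le_rfl]
      exact hC 0 ⟨le_rfl, le_max_right _ _⟩
    · exact hC _ ⟨h'.le, (by linarith : t - s ≤ t).trans (le_max_left _ _)⟩

/-- The scheme applied to a source whose primitive is given by Taylor's formula. -/
theorem sum_source_eq {α l τ b c₀ c₁ : ℝ} (hb : 1 < b) (hτ : 0 < τ) {w : ℝ → ℝ}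
    (hw : Integrable w) (hw0 : ∀ s ≤ 0, w s = 0) (n : ℕ) :
    τ ^ (α - 1) * ∑ m ∈ Finset.range (n + 1),
        PowerSeries.coeff m (transferSeries α (l * τ ^ α) 1)
          * (c₀ * fracKernel b (((n : ℝ) - m) * τ) + (c₁ * fracKernel (b + 1) (((n : ℝ) - m) * τ)
            + conv (fracKernel (b + 1)) w (((n : ℝ) - m) * τ)))
      = c₀ * scaledDiscreteKernel α l τ b (n * τ)
        + (c₁ * scaledDiscreteKernel α l τ (b + 1) (n * τ)
          + conv (scaledDiscreteKernel α l τ (b + 1)) w (n * τ)) := by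
  set v : ℕ → ℝ := fun m => PowerSeries.coeff m (transferSeries α (l * τ ^ α) 1) with hv
  have hint : ∀ x : ℝ, Integrable fun s => fracKernel (b + 1) (x - s) * w s :=
    integrable_continuous_mul (continuous_fracKernel (by linarith))
      (fun _ => fracKernel_of_nonpos) hw hw0
  have key : ∀ b' : ℝ, τ ^ (α - 1) * ∑ m ∈ Finset.range (n + 1),
      v m * fracKernel b' (((n : ℝ) - m) * τ) = scaledDiscreteKernel α l τ b' (n * τ) := by
    intro b'
    rw [← sum_fracKernel_eq (n := n) hτ le_rfl]
    simp only [sub_mul, hv]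
  have key2 : τ ^ (α - 1) * ∑ m ∈ Finset.range (n + 1),
      v m * conv (fracKernel (b + 1)) w (((n : ℝ) - m) * τ)
        = conv (scaledDiscreteKernel α l τ (b + 1)) w (n * τ) := by
    simp only [conv]
    simp_rw [← integral_const_mul]
    rw [← integral_finsetSum _ fun m _ => (hint _).const_mul _, ← integral_const_mul]
    refine integral_congr_ae (Eventually.of_forall fun s => ?_)
    dsimp only
    rcases le_or_gt s 0 with h | h
    · simp [hw0 s h]
    rw [← sum_fracKernel_eq (n := n) hτ (by linarith), mul_assoc, Finset.sum_mul]
    congr 1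
    refine Finset.sum_congr rfl fun m _ => ?_
    rw [show (n : ℝ) * τ - s - m * τ = (n - m) * τ - s by ring, mul_assoc]
  rw [← key, ← key, ← key2, mul_left_comm, mul_left_comm c₁, ← mul_add, ← mul_add]
  congr 1
  rw [Finset.mul_sum, Finset.mul_sum, ← Finset.sum_add_distrib, ← Finset.sum_add_distrib]
  refine Finset.sum_congr rfl fun m _ => ?_
  ring

/-! ### Weak derivatives and Taylor's formula -/

section WeakDeriv

variable {E : Type*} [NormedAddCommGroup E] [NormedSpace ℝ E]

/-- A test function with vanishing integral is the derivative of a test function. -/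
theorem exists_testFunction_deriv_eq {T : ℝ} {ψ : ℝ → ℝ} (hψ : ContDiff ℝ (⊤ : ℕ∞) ψ)
    (hc : HasCompactSupport ψ) (hs : tsupport ψ ⊆ Ioo 0 T) (h0 : ∫ t in Ioo 0 T, ψ t = 0) :
    ∃ φ : ℝ → ℝ, ContDiff ℝ (⊤ : ℕ∞) φ ∧ HasCompactSupport φ ∧ tsupport φ ⊆ Ioo 0 T ∧
      deriv φ = ψ := by
  have hcont : Continuous ψ := hψ.continuous
  have hzero : ∀ t, t ∉ tsupport ψ → ψ t = 0 := fun t ht => image_eq_zero_of_notMem_tsupport ht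
  set φ : ℝ → ℝ := fun t => ∫ s in (0 : ℝ)..t, ψ s with hφ
  have hd : ∀ t, HasDerivAt φ (ψ t) t := fun t =>
    intervalIntegral.integral_hasDerivAt_right (hcont.intervalIntegrable _ _)
      (hcont.stronglyMeasurableAtFilter _ _) hcont.continuousAt
  have hderiv : deriv φ = ψ := funext fun t => (hd t).deriv
  rcases (tsupport ψ).eq_empty_or_nonempty with hK | hK
  · refine ⟨0, contDiff_const, HasCompactSupport.zero, by simp, ?_⟩
    have : ψ = 0 := tsupport_eq_empty_iff.1 hK
    rw [this]; ext t; simp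
  obtain ⟨a, ha, hamin⟩ := hc.isCompact.exists_isLeast hK
  obtain ⟨b, hb, hbmax⟩ := hc.isCompact.exists_isGreatest hK
  have hsub : tsupport φ ⊆ Icc a b := by
    refine closure_minimal (fun t ht => ?_) isClosed_Icc
    by_contra hn
    refine ht ?_
    rw [mem_Icc, not_and_or, not_le, not_le] at hn
    have ha0 := (hs ha).1
    have hbT := (hs hb).2
    have hab : a ≤ b := hamin hb
    rcases hn with hn | hn
    · refine intervalIntegral.integral_zero_ae (Eventually.of_forall fun s hsm => ?_)
      refine hzero s fun hs' => ?_
      have h1 := hamin hs'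
      rcases le_total 0 t with h | h
      · rw [uIoc_of_le h] at hsm; linarith [hsm.2]
      · rw [uIoc_of_ge h] at hsm; linarith [hsm.2]
    · have e1 : φ t = φ T := by
        have : φ T - φ t = ∫ s in t..T, ψ s :=
          intervalIntegral.integral_interval_sub_left (hcont.intervalIntegrable _ _)
            (hcont.intervalIntegrable _ _)
        rw [intervalIntegral.integral_zero_ae] at this
        · linarith
        · refine Eventually.of_forall fun s hsm => hzero s fun hs' => ?_
          have h1 := hbmax hs'
          rcases le_total t T with h | h
          · rw [uIoc_of_le h] at hsm; linarith [hsm.1]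
          · rw [uIoc_of_ge h] at hsm; linarith [hsm.1]
      rw [e1, hφ]
      dsimp only
      rw [intervalIntegral.integral_of_le (by linarith), integral_Ioc_eq_integral_Ioo, h0]
  refine ⟨φ, ?_, ?_, ?_, hderiv⟩
  · rw [contDiff_infty_iff_deriv, hderiv]
    exact ⟨fun t => (hd t).differentiableAt, hψ⟩
  · exact HasCompactSupport.intro isCompact_Icc fun t ht =>
      image_eq_zero_of_notMem_tsupport fun h => ht (hsub h)
  · exact hsub.trans fun t ht => ⟨(hs ha).1.trans_le ht.1, ht.2.trans_lt (hs hb).2⟩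

theorem integral_deriv_smul_primitive [CompleteSpace E] {T : ℝ} {h : ℝ → E}
    (hh : IntegrableOn h (Ioo 0 T)) {φ : ℝ → ℝ} (hφ : ContDiff ℝ (⊤ : ℕ∞) φ)
    (hs : tsupport φ ⊆ Ioo 0 T) :
    ∫ t in Ioo 0 T, deriv φ t • ∫ s in (0 : ℝ)..t, h s = -∫ t in Ioo 0 T, φ t • h t := by
  have hdc : Continuous (deriv φ) := hφ.continuous_deriv (by simp)
  set ν := volume.restrict (Ioo (0 : ℝ) T) with hν
  have hφT : φ T = 0 := image_eq_zero_of_notMem_tsupport fun h => lt_irrefl _ (hs h).2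
  have hdi : Integrable (deriv φ) ν :=
    (hdc.integrableOn_Icc (a := 0) (b := T)).mono_set Ioo_subset_Icc_self
  set F : ℝ × ℝ → E := indicator {z : ℝ × ℝ | z.2 < z.1} fun z => deriv φ z.1 • h z.2 with hF
  have hFi : Integrable F (ν.prod ν) :=
    (hdi.smul_prod hh).indicator (measurableSet_lt measurable_snd measurable_fst)
  have e1 : ∀ t ∈ Ioo 0 T, deriv φ t • ∫ s in (0 : ℝ)..t, h s = ∫ s, F (t, s) ∂ν := by
    intro t ht
    rw [intervalIntegral.integral_of_le ht.1.le, integral_Ioc_eq_integral_Ioo, ← integral_smul]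
    have : ∀ s, F (t, s) = indicator (Iio t) (fun s => deriv φ t • h s) s := by
      intro s; simp [hF, indicator]
    simp_rw [this]
    rw [integral_indicator measurableSet_Iio, hν, Measure.restrict_restrict measurableSet_Iio]
    congr 2
    ext s; simp only [mem_inter_iff, mem_Iio, mem_Ioo]
    constructor
    · intro h; exact ⟨h.2, h.1, h.2.trans ht.2⟩
    · intro h; exact ⟨h.2.1, h.1⟩
  have e2 : ∀ s ∈ Ioo 0 T, ∫ t, F (t, s) ∂ν = -(φ s • h s) := by
    intro s hs'
    have : ∀ t, F (t, s) = indicator (Ioi s) (fun t => deriv φ t • h s) t := by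
      intro t; simp [hF, indicator]
    simp_rw [this]
    rw [integral_indicator measurableSet_Ioi, hν, Measure.restrict_restrict measurableSet_Ioi,
      integral_smul_const]
    have e : Ioi s ∩ Ioo 0 T = Ioo s T := by
      ext t; simp only [mem_inter_iff, mem_Ioi, mem_Ioo]
      constructor
      · intro h; exact ⟨h.1, h.2.2⟩
      · intro h; exact ⟨h.1, hs'.1.trans h.1, h.2⟩
    rw [e, ← integral_Ioc_eq_integral_Ioo, ← intervalIntegral.integral_of_le hs'.2.le,
      intervalIntegral.integral_deriv_eq_sub
        (fun x _ => (hφ.differentiable (by simp)).differentiableAt)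
        (hdc.intervalIntegrable _ _), hφT, zero_sub, neg_smul]
  rw [setIntegral_congr_fun measurableSet_Ioo e1]
  change ∫ t, ∫ s, F (t, s) ∂ν ∂ν = _
  rw [integral_integral_swap (f := fun t s => F (t, s)) hFi, ← integral_neg]
  exact setIntegral_congr_fun measurableSet_Ioo e2

/-- The lemma of du Bois-Reymond. -/
theorem eq_of_integral_deriv_smul_eq_zero [CompleteSpace E] {T : ℝ} (hT : 0 < T) {D : ℝ → E}
    (hD : ContinuousOn D (Icc 0 T))
    (h : ∀ φ : ℝ → ℝ, ContDiff ℝ (⊤ : ℕ∞) φ → HasCompactSupport φ → tsupport φ ⊆ Ioo 0 T →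
      ∫ t in Ioo 0 T, deriv φ t • D t = 0) {t : ℝ} (ht : t ∈ Icc 0 T) : D t = D 0 := by
  have hDi : ∀ ψ : ℝ → ℝ, Continuous ψ → IntegrableOn (fun t => ψ t • D t) (Ioo 0 T) := fun ψ hψ =>
    ((hψ.continuousOn.smul hD).integrableOn_compact isCompact_Icc).mono_set Ioo_subset_Icc_self
  -- a fixed test function of integral one
  obtain ⟨η, hη1, hη2, hη3, hη4⟩ : ∃ η : ℝ → ℝ, ContDiff ℝ (⊤ : ℕ∞) η ∧ HasCompactSupport η ∧
      tsupport η ⊆ Ioo 0 T ∧ ∫ t in Ioo 0 T, η t = 1 := by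
    set b : ContDiffBump (T / 2) := ⟨T / 8, T / 4, by linarith, by linarith⟩ with hb
    have hsup : tsupport (b.normed volume) ⊆ Ioo 0 T := by
      rw [b.tsupport_normed_eq, Real.closedBall_eq_Icc]
      intro t ht
      have h1 : b.rOut = T / 4 := rfl
      rw [h1] at ht
      exact ⟨by linarith [ht.1], by linarith [ht.2]⟩
    refine ⟨b.normed volume, b.contDiff_normed, b.hasCompactSupport_normed, hsup, ?_⟩
    rw [setIntegral_eq_integral_of_forall_compl_eq_zero, b.integral_normed]
    intro t ht
    exact image_eq_zero_of_notMem_tsupport fun h' => ht (hsup h')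
  set m := ∫ t in Ioo 0 T, η t • D t with hm
  have hae : ∀ᵐ t, t ∈ Ioo 0 T → D t - m = 0 := by
    refine isOpen_Ioo.ae_eq_zero_of_integral_contDiff_smul_eq_zero ?_ ?_
    · exact ((hD.mono Ioo_subset_Icc_self).sub continuousOn_const).locallyIntegrableOn
        measurableSet_Ioo
    · intro ψ h1 h2 h3
      have e0 : ∫ t, ψ t • (D t - m) = ∫ t in Ioo 0 T, ψ t • (D t - m) := by
        rw [setIntegral_eq_integral_of_forall_compl_eq_zero]
        intro t ht
        rw [image_eq_zero_of_notMem_tsupport fun h' => ht (h3 h'), zero_smul]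
      set c := ∫ t in Ioo 0 T, ψ t with hc
      have hψi : IntegrableOn ψ (Ioo 0 T) :=
        (h1.continuous.integrableOn_Icc).mono_set Ioo_subset_Icc_self
      have hηi : IntegrableOn η (Ioo 0 T) :=
        (hη1.continuous.integrableOn_Icc).mono_set Ioo_subset_Icc_self
      obtain ⟨φ, p1, p2, p3, p4⟩ := exists_testFunction_deriv_eq (T := T)
        (ψ := fun t => ψ t - c * η t)
        (h1.sub (contDiff_const.mul hη1)) (h2.sub (hη2.mul_left))
        ((tsupport_sub _ _).trans (union_subset h3
          ((tsupport_mul_subset_right).trans hη3)))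
        (by rw [integral_sub hψi (hηi.const_mul c), integral_const_mul, hη4, mul_one, ← hc,
          sub_self])
      have e1 := h φ p1 p2 p3
      rw [p4] at e1
      simp_rw [sub_smul, mul_smul] at e1
      have hci : IntegrableOn (fun t => c • η t • D t) (Ioo 0 T) := (hDi η hη1.continuous).smul c
      rw [integral_sub (hDi ψ h1.continuous) hci, integral_smul,
        ← hm] at e1
      rw [e0]
      simp_rw [smul_sub]
      rw [integral_sub (hDi ψ h1.continuous) (hψi.smul_const m), integral_smul_const, ← hc]
      exact e1
  have hcl : EqOn D (fun _ => m) (Icc 0 T) := by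
    have h1 : EqOn D (fun _ => m) (Ioo 0 T) := by
      refine Measure.eqOn_open_of_ae_eq (μ := volume) ?_ isOpen_Ioo
        (hD.mono Ioo_subset_Icc_self) continuousOn_const
      rw [EventuallyEq, ae_restrict_iff' measurableSet_Ioo]
      exact hae.mono fun t ht h' => sub_eq_zero.1 (ht h')
    refine h1.of_subset_closure hD continuousOn_const Ioo_subset_Icc_self ?_
    rw [closure_Ioo hT.ne]
  rw [hcl ht, hcl ⟨le_rfl, hT.le⟩]

/-- A continuous function with an integrable weak derivative is the integral of it. -/
theorem HasWeakDeriv.eq_add_integral [CompleteSpace E] {T : ℝ} (hT : 0 < T) {g h : ℝ → E}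
    (hw : HasWeakDeriv T g h) (hg : ContinuousOn g (Icc 0 T)) (hh : IntegrableOn h (Ioo 0 T))
    {t : ℝ} (ht : t ∈ Icc 0 T) : g t = g 0 + ∫ s in (0 : ℝ)..t, h s := by
  have hhI : IntervalIntegrable h volume 0 T := by
    rw [intervalIntegrable_iff_integrableOn_Ioo_of_le hT.le]; exact hh
  have hGc : ContinuousOn (fun t => ∫ s in (0 : ℝ)..t, h s) (Icc 0 T) := by
    have := intervalIntegral.continuousOn_primitive_interval' hhI left_mem_uIcc
    rwa [uIcc_of_le hT.le] at this
  have key := eq_of_integral_deriv_smul_eq_zero hT (hg.sub hGc) (fun φ h1 h2 h3 => ?_) ht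
  · simp only [Pi.sub_apply, intervalIntegral.integral_same, sub_zero] at key
    rw [← key]; abel
  · have hdc : Continuous (deriv φ) := h1.continuous_deriv (by simp)
    have hi : ∀ D : ℝ → E, ContinuousOn D (Icc 0 T) →
        IntegrableOn (fun t => deriv φ t • D t) (Ioo 0 T) := fun D hD =>
      ((hdc.continuousOn.smul hD).integrableOn_compact isCompact_Icc).mono_set Ioo_subset_Icc_self
    simp only [Pi.sub_apply, smul_sub]
    rw [integral_sub (hi _ hg) (hi _ hGc), hw.2.2 φ h1 h2 h3,
      integral_deriv_smul_primitive hh h1 h3, sub_self]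

end WeakDeriv

theorem conv_fracKernel_one {w : ℝ → ℝ} (hw0 : ∀ s ≤ 0, w s = 0) {t : ℝ} (ht : 0 ≤ t) :
    conv (fracKernel 1) w t = ∫ s in (0 : ℝ)..t, w s := by
  rw [conv_eq_intervalIntegral (fun _ => fracKernel_of_nonpos) hw0 ht,
    intervalIntegral.integral_of_le ht, intervalIntegral.integral_of_le ht,
    integral_Ioc_eq_integral_Ioo, integral_Ioc_eq_integral_Ioo]
  refine setIntegral_congr_fun measurableSet_Ioo fun s hs => ?_
  simp [fracKernel_of_pos (sub_pos.2 hs.2)]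

theorem fracKernel_one_of_pos {t : ℝ} (ht : 0 < t) : fracKernel 1 t = 1 := by
  simp [fracKernel_of_pos ht]

/-- Taylor's formula of second order in terms of the kernels `t^(b-1) / Γ(b)`. -/
theorem eq_taylor_conv {T γ₀ γ₁ : ℝ} {γ γ' w : ℝ → ℝ} (hw : Integrable w) (hw0 : ∀ s ≤ 0, w s = 0)
    (h1 : ∀ t ∈ Ioc 0 T, γ' t = γ₁ + ∫ s in (0 : ℝ)..t, w s)
    (h0 : ∀ t ∈ Ioc 0 T, γ t = γ₀ + ∫ s in (0 : ℝ)..t, γ' s) {t : ℝ} (ht : t ∈ Ioc 0 T) :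
    γ t = γ₀ * fracKernel 1 t + (γ₁ * fracKernel 2 t + conv (fracKernel 2) w t) := by
  have hk := isFracBounded_fracKernel one_pos
  obtain ⟨i1, -, e1⟩ := conv_conv one_pos one_pos (by norm_num) hk hk hw hw0 t
  have i2 := hk.integrable_mul one_pos one_pos hk t
  have e2 := congrFun (conv_fracKernel one_pos one_pos) t
  have e3 := conv_fracKernel one_pos one_pos
  norm_num at e2 e3
  rw [e3] at e1
  have h2 : conv (fracKernel 1) (fun s => γ₁ * fracKernel 1 s + conv (fracKernel 1) w s) t
      = γ₁ * fracKernel 2 t + conv (fracKernel 2) w t := by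
    rw [conv_add_right _ i1, conv_const_mul_right, e1, e2]
    simpa only [mul_left_comm] using i2.const_mul γ₁
  rw [h0 t ht, ← h2, conv_fracKernel_one _ ht.1.le, fracKernel_one_of_pos ht.1, mul_one]
  · congr 1
    refine intervalIntegral.integral_congr_ae (Eventually.of_forall fun s hs => ?_)
    rw [uIoc_of_le ht.1.le] at hs
    rw [h1 s ⟨hs.1, hs.2.trans ht.2⟩, conv_fracKernel_one hw0 hs.1.le, fracKernel_one_of_pos hs.1,
      mul_one]
  · intro s hs
    rw [fracKernel_of_nonpos hs, conv_of_nonpos (fun _ => fracKernel_of_nonpos) hw0 hs]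
    simp

/-! ### The error of one component -/

/-- The error of the scheme for the source `t^(b-2) / Γ(b-1)`. -/
def errorKernel (α l τ b t : ℝ) : ℝ :=
  relaxKernel α l (b - 1) t - scaledDiscreteKernel α l τ b t

/-- The error bound on the mesh of width `τ`, uniform in the eigenvalue: scaling time by `τ` and the
eigenvalue by `τ^α` turns the bound for unit step into one with the factor `τ²`. -/
theorem exists_abs_errorKernel_le {α b : ℝ} (h0 : 0 < α) (h1 : α < 1) (hb2 : 2 ≤ b) :
    ∃ C : ℝ, 0 ≤ C ∧ ∀ l : ℝ, 0 ≤ l → ∀ τ : ℝ, 0 < τ → ∀ t : ℝ, 0 < t →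
      |errorKernel α l τ b t| ≤ C * τ ^ 2 * t ^ (α + b - 4) := by
  obtain ⟨C, hC, hb⟩ := exists_abs_discreteKernel_one_sub_le h0 h1 hb2
  refine ⟨C, hC, fun l hl τ hτ t ht => ?_⟩
  have h := hb (l * τ ^ α) (by positivity) (t / τ) (by positivity)
  have e1 : errorKernel α l τ b t = -(τ ^ (α + b - 2) * (discreteKernel α (l * τ ^ α) b 1 (t / τ)
      - relaxKernel α (l * τ ^ α) (b - 1) (t / τ))) := by
    rw [errorKernel, scaledDiscreteKernel]
    nth_rw 1 [show t = τ * (t / τ) by field_simp]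
    rw [relaxKernel_mul_left hτ, show b - 1 + α - 1 = α + b - 2 by ring]
    ring
  rw [e1, abs_neg, abs_mul, abs_of_nonneg (by positivity : 0 ≤ τ ^ (α + b - 2))]
  refine (mul_le_mul_of_nonneg_left h (by positivity)).trans (le_of_eq ?_)
  rw [Real.div_rpow ht.le hτ.le, show α + b - 2 = (α + b - 4) + 2 by ring, Real.rpow_add hτ,
    Real.rpow_two]
  field_simp

/-- The error bound for the initial value. It enters the scheme through `t^(2-α) / Γ(3-α)`, to which
two BDF operators are applied, hence `b = 3 - α` and `i = 2`. -/
theorem exists_abs_startError_le {α : ℝ} (h0 : 0 < α) (h1 : α < 1) :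
    ∃ C : ℝ, 0 ≤ C ∧ ∀ l : ℝ, 0 ≤ l → ∀ τ : ℝ, 0 < τ → ∀ n : ℕ, 1 ≤ n →
      |relaxKernel α l (1 - α) (n * τ) - discreteKernel α (l * τ ^ α) (3 - α) 2 n|
        ≤ C * τ ^ 2 * (n * τ) ^ (-2 : ℝ) := by
  obtain ⟨C, hC, hb⟩ := exists_abs_discreteKernel_sub_le (b := 3 - α) h0 h1 (i := 2) (Or.inr rfl)
    (by linarith) (by push_cast; linarith)
  refine ⟨C, hC, fun l hl τ hτ n hn => ?_⟩
  have hn' : (1 : ℝ) ≤ n := by exact_mod_cast hn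
  have h := hb (l * τ ^ α) (by positivity) n hn'
  rw [mul_comm (n : ℝ) τ, relaxKernel_mul_left hτ, show 1 - α + α - 1 = 0 by ring, Real.rpow_zero,
    one_mul, abs_sub_comm]
  push_cast at h
  rw [show 3 - α - 2 = 1 - α by ring, show α + (3 - α) - 2 - 3 = -2 by ring] at h
  refine h.trans (le_of_eq ?_)
  rw [Real.mul_rpow hτ.le (by linarith), Real.rpow_neg hτ.le, Real.rpow_two]
  field_simp

/-- The error of the scheme for the scalar problem `D^α y + l y = f`, where `f` is the convolution
of `t^μ` with a function that has the Taylor data `γ₀`, `γ₁`, `w`, and `v` is the derivative of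
`y`. -/
theorem scalar_error_eq {α μ l T τ y0 γ₀ γ₁ : ℝ} {N : ℕ} (h0 : 0 < α) (h1 : α < 1) (hμ : -1 < μ)
    (hl : 0 ≤ l) (hτ : 0 < τ) (hT : T = N * τ)
    {v w : ℝ → ℝ} (hv : Integrable v) (hv0 : ∀ s ≤ 0, v s = 0)
    (hw : Integrable w) (hw0 : ∀ s ≤ 0, w s = 0)
    (heq : ∀ᵐ s, s ≤ T → Real.Gamma (μ + 1) * (γ₀ * fracKernel (μ + 2) s
        + (γ₁ * fracKernel (μ + 2 + 1) s + conv (fracKernel (μ + 2 + 1)) w s))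
      = conv (fracKernel (1 - α)) v s + l * (y0 * fracKernel 1 s + conv (fracKernel 1) v s))
    {U : ℤ → ℝ} (hU : ∀ k ≤ 0, U k = 0) {Φ : ℝ → ℝ}
    (hΦ : ∀ t, Φ t = Real.Gamma (μ + 1) * (γ₀ * fracKernel (μ + 3) t
        + (γ₁ * fracKernel (μ + 3 + 1) t + conv (fracKernel (μ + 3 + 1)) w t)))
    (hstep : ∀ n : ℕ, 1 ≤ n → n ≤ N →
      τ ^ (-α) * ∑ j ∈ Finset.range (n + 1), glCoeff α j * U ((n : ℤ) - (j : ℤ))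
        + (1 - α / 2) * (l * U n) + α / 2 * (l * U ((n : ℤ) - 1))
      = (1 - α / 2) * Φ (n * τ) + α / 2 * Φ (((n : ℝ) - 1) * τ)
        + (1 - α / 2) * bdf2 τ (startFun α) (n * τ) * y0
        + α / 2 * bdf2 τ (startFun α) (((n : ℝ) - 1) * τ) * y0)
    {n : ℕ} (hn : n ≤ N) :
    y0 * fracKernel 1 (n * τ) + conv (fracKernel 1) v (n * τ)
        - τ⁻¹ * (3 / 2 * U n - 2 * U ((n : ℤ) - 1) + 1 / 2 * U ((n : ℤ) - 2))
      = y0 * (relaxKernel α l (1 - α) (n * τ) - discreteKernel α (l * τ ^ α) (3 - α) 2 n)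
        + Real.Gamma (μ + 1) * (γ₀ * errorKernel α l τ (μ + 3) (n * τ)
          + (γ₁ * errorKernel α l τ (μ + 4) (n * τ)
            + conv (errorKernel α l τ (μ + 4)) w (n * τ))) := by
  have htT : (n : ℝ) * τ ≤ T := by
    rw [hT]
    exact mul_le_mul_of_nonneg_right (by exact_mod_cast hn) hτ.le
  have hb0 : IsFracBounded α (relaxKernel α l 0) := by
    simpa using isFracBounded_relaxKernel h0 hl le_rfl
  have hΦ0 : Φ 0 = 0 := by
    rw [hΦ, fracKernel_of_nonpos le_rfl, fracKernel_of_nonpos le_rfl,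
      conv_of_nonpos (fun _ => fracKernel_of_nonpos) hw0 le_rfl]
    simp
  -- the exact solution
  have ex := eq_relaxKernel_of_caputo_eq h0 h1 hl hv hv0 heq htT
  have c1 := conv_relaxKernel_fracKernel h0 hl le_rfl (by linarith : 0 < μ + 2)
  have c2 := conv_relaxKernel_fracKernel h0 hl le_rfl (by linarith : 0 < μ + 2 + 1)
  rw [conv_const_mul_right, conv_taylor h0 (by linarith) hb0 hw hw0, c1, c2, zero_add,
    zero_add] at ex
  -- the discrete solution
  have ds := scheme_eq_sum h1 hl hτ hU hΦ0 hstep hn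
  have e1 : ∑ m ∈ Finset.range (n + 1), PowerSeries.coeff m (transferSeries α (l * τ ^ α) 1)
        * Φ (((n : ℝ) - m) * τ)
      = Real.Gamma (μ + 1) * ∑ m ∈ Finset.range (n + 1),
        PowerSeries.coeff m (transferSeries α (l * τ ^ α) 1)
          * (γ₀ * fracKernel (μ + 3) (((n : ℝ) - m) * τ)
            + (γ₁ * fracKernel (μ + 3 + 1) (((n : ℝ) - m) * τ)
              + conv (fracKernel (μ + 3 + 1)) w (((n : ℝ) - m) * τ))) := by
    rw [Finset.mul_sum]
    refine Finset.sum_congr rfl fun m _ => ?_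
    rw [hΦ]; ring
  rw [e1, mul_left_comm, sum_source_eq (by linarith) hτ hw hw0] at ds
  rw [ex, ds]
  -- the kernels
  have i1 := (conv_conv h0 (by linarith : 0 < μ + 2 + 1) (by linarith) hb0
    (isFracBounded_fracKernel (by linarith)) hw hw0 (n * τ)).2.1
  rw [c2, zero_add] at i1
  have i2 := integrable_continuous_mul (continuous_scaledDiscreteKernel (α := α) (l := l) (τ := τ)
    (by linarith : 1 < μ + 3 + 1)) (fun s hs => by
      rw [scaledDiscreteKernel, discreteKernel_of_nonpos (div_nonpos_of_nonpos_of_nonneg hs hτ.le),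
        mul_zero]) hw hw0 (n * τ)
  have e2 : conv (errorKernel α l τ (μ + 4)) w (n * τ)
      = conv (relaxKernel α l (μ + 2 + 1)) w (n * τ)
        - conv (scaledDiscreteKernel α l τ (μ + 3 + 1)) w (n * τ) := by
    rw [conv, conv, conv, ← integral_sub i1 i2]
    congr 1
    ext s
    rw [errorKernel, show μ + 4 - 1 = μ + 2 + 1 by ring, show μ + 4 = μ + 3 + 1 by ring, sub_mul]
  rw [e2, errorKernel, errorKernel, show μ + 4 - 1 = μ + 2 + 1 by ring,
    show μ + 3 - 1 = μ + 2 by ring, show μ + 4 = μ + 3 + 1 by ring]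
  ring

/-! ### Fractional integrals of vector-valued functions -/

section Vector

variable {E : Type*}

/-- The convolution of an integrable kernel with an integrable function exists almost everywhere and
is integrable; pointwise existence at every `t` may fail. -/
theorem ae_intervalIntegrable_conv [NormedAddCommGroup E] [NormedSpace ℝ E] {T : ℝ} {k : ℝ → ℝ}
    {h : ℝ → E} (hk : IntegrableOn k (Ioc 0 T)) (hh : IntegrableOn h (Ioc 0 T)) :
    (∀ᵐ t, t ∈ Ioc 0 T → IntervalIntegrable (fun s => k (t - s) • h s) volume 0 t) ∧
    IntegrableOn (fun t => ∫ s in (0 : ℝ)..t, k (t - s) • h s) (Ioc 0 T) := by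
  set K := indicator (Ioc 0 T) k with hK
  set H := indicator (Ioc 0 T) h with hH
  have hKi : Integrable K := (integrable_indicator_iff measurableSet_Ioc).2 hk
  have hHi : Integrable H := (integrable_indicator_iff measurableSet_Ioc).2 hh
  have hI := hHi.convolution_integrand (ContinuousLinearMap.lsmul ℝ ℝ : ℝ →L[ℝ] E →L[ℝ] E).flip hKi
  simp only [ContinuousLinearMap.flip_apply, ContinuousLinearMap.lsmul_apply] at hI
  have e : ∀ t ∈ Ioc 0 T, ∀ s,
      K (t - s) • H s = indicator (Ioo 0 t) (fun s => k (t - s) • h s) s := by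
    intro t ht s
    by_cases hs : s ∈ Ioo 0 t
    · rw [indicator_of_mem hs, hK, hH, indicator_of_mem, indicator_of_mem]
      · exact ⟨hs.1, hs.2.le.trans ht.2⟩
      · exact ⟨sub_pos.2 hs.2, by linarith [hs.1, ht.2]⟩
    · rw [indicator_of_notMem hs]
      by_cases h' : 0 < s
      · have : t ≤ s := by
          by_contra hlt
          exact hs ⟨h', not_le.1 hlt⟩
        rw [hK, indicator_of_notMem, zero_smul]
        intro hm; linarith [hm.1]
      · rw [hH, indicator_of_notMem, smul_zero]
        intro hm; exact h' hm.1
  constructor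
  · filter_upwards [hI.prod_right_ae] with t h1 ht
    simp only [e t ht] at h1
    rw [intervalIntegrable_iff_integrableOn_Ioo_of_le ht.1.le]
    exact (integrable_indicator_iff measurableSet_Ioo).1 h1
  · refine (hI.integral_prod_left.integrableOn (s := Ioc 0 T)).congr_fun (fun t ht => ?_)
      measurableSet_Ioc
    simp only [e t ht]
    rw [integral_indicator measurableSet_Ioo, ← integral_Ioc_eq_integral_Ioo,
      ← intervalIntegral.integral_of_le ht.1.le]

theorem inner_intervalIntegral_left [NormedAddCommGroup E] [InnerProductSpace ℝ E]
    [CompleteSpace E] {f : ℝ → E} {a b : ℝ}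
    (hf : IntervalIntegrable f volume a b) (x : E) :
    inner ℝ (∫ s in a..b, f s) x = ∫ s in a..b, inner ℝ (f s) x := by
  have := (innerSL ℝ x).intervalIntegral_comp_comm hf
  simp only [innerSL_apply_apply] at this
  rw [real_inner_comm, ← this]
  simp_rw [real_inner_comm x]

theorem conv_fracKernel_indicator {T p : ℝ} {h : ℝ → ℝ} {t : ℝ} (ht : t ∈ Ioc 0 T) :
    conv (fracKernel p) (indicator (Ioc 0 T) h) t
      = (Real.Gamma p)⁻¹ * ∫ s in (0 : ℝ)..t, (t - s) ^ (p - 1) * h s := by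
  rw [conv_eq_intervalIntegral (fun _ => fracKernel_of_nonpos)
    (fun s hs => indicator_of_notMem (fun h' => by linarith [h'.1]) _) ht.1.le,
    ← intervalIntegral.integral_const_mul,
    intervalIntegral.integral_of_le ht.1.le, intervalIntegral.integral_of_le ht.1.le,
    integral_Ioc_eq_integral_Ioo, integral_Ioc_eq_integral_Ioo]
  refine setIntegral_congr_fun measurableSet_Ioo fun s hs => ?_
  have hs' : s ∈ Ioc 0 T := ⟨hs.1, hs.2.le.trans ht.2⟩
  rw [fracKernel_of_pos (sub_pos.2 hs.2), indicator_of_mem hs']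
  ring

end Vector

/-! ### The error of the component along an eigenvector -/

section Component

variable {H : Type*} [NormedAddCommGroup H] [InnerProductSpace ℝ H]

theorem integrableOn_rpow_Ioc {r T : ℝ} (hr : -1 < r) (hT : 0 ≤ T) :
    IntegrableOn (fun x : ℝ => x ^ r) (Ioc 0 T) :=
  (intervalIntegrable_iff_integrableOn_Ioc_of_le hT).1
    (intervalIntegral.intervalIntegrable_rpow' hr)

theorem intervalIntegrable_sub_rpow_smul {μ t : ℝ} (hμ : -1 < μ) {g : ℝ → H} (ht : 0 ≤ t)
    (hg : ContinuousOn g (Icc 0 t)) :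
    IntervalIntegrable (fun s => (t - s) ^ μ • g s) volume 0 t := by
  have h1 : IntervalIntegrable (fun s : ℝ => (t - s) ^ μ) volume 0 t := by
    have := (intervalIntegral.intervalIntegrable_rpow' (a := 0) (b := t) hμ).comp_sub_left t
    simp only [sub_zero, sub_self] at this
    exact this.symm
  refine h1.smul_continuousOn ?_
  rwa [uIcc_of_le ht]

theorem intervalIntegrable_powConv {μ T t : ℝ} (hμ : -1 < μ) {g : ℝ → H}
    (hg : ContinuousOn g (Icc 0 T)) (ht : t ∈ Icc 0 T) :
    IntervalIntegrable (powConv μ g) volume 0 t := by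
  have hT : 0 ≤ T := ht.1.trans ht.2
  have := (ae_intervalIntegrable_conv (integrableOn_rpow_Ioc hμ hT)
    ((hg.integrableOn_compact isCompact_Icc).mono_set Ioc_subset_Icc_self)).2
  rw [intervalIntegrable_iff_integrableOn_Ioc_of_le ht.1]
  exact this.mono_set (Ioc_subset_Ioc_right ht.2)

theorem integrable_indicator_inner {T : ℝ} {h : ℝ → H} (hh : IntegrableOn h (Ioc 0 T)) (e : H) :
    Integrable (indicator (Ioc 0 T) fun s => inner ℝ (h s) e) := by
  rw [integrable_indicator_iff measurableSet_Ioc]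
  exact hh.inner_const e

theorem indicator_Ioc_of_nonpos {T : ℝ} (h : ℝ → ℝ) : ∀ s ≤ 0, indicator (Ioc 0 T) h s = 0 :=
  fun s hs => indicator_of_notMem (fun h' => by linarith [h'.1]) _

theorem conv_fracKernel_one_indicator {T t : ℝ} (h : ℝ → ℝ) (ht : t ∈ Icc 0 T) :
    conv (fracKernel 1) (indicator (Ioc 0 T) h) t = ∫ s in (0 : ℝ)..t, h s := by
  rw [conv_fracKernel_one (indicator_Ioc_of_nonpos h) ht.1]
  refine intervalIntegral.integral_congr_ae (Eventually.of_forall fun s hs => ?_)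
  rw [uIoc_of_le ht.1] at hs
  exact indicator_of_mem (Ioc_subset_Ioc_right ht.2 hs) _

variable [CompleteSpace H]

theorem inner_primitive_eq {T : ℝ} {y h : ℝ → H} (hh : IntegrableOn h (Ioc 0 T))
    (hy : ∀ t ∈ Icc 0 T, y t = y 0 + ∫ s in (0 : ℝ)..t, h s) (e : H) {t : ℝ} (ht : t ∈ Icc 0 T) :
    inner ℝ (y t) e = inner ℝ (y 0) e + ∫ s in (0 : ℝ)..t, inner ℝ (h s) e := by
  rw [hy t ht, inner_add_left, inner_intervalIntegral_left]
  rw [intervalIntegrable_iff_integrableOn_Ioc_of_le ht.1]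
  exact hh.mono_set (Ioc_subset_Ioc_right ht.2)

/-- The components of the source in terms of the Taylor data of `g`. -/
theorem inner_powConv_eq {μ T : ℝ} (hμ : -1 < μ) {g g' g'' : ℝ → H}
    (hgc : ContinuousOn g (Icc 0 T)) (hgc' : ContinuousOn g' (Icc 0 T))
    (hg0 : ∀ t ∈ Icc 0 T, g t = g 0 + ∫ s in (0 : ℝ)..t, g' s)
    (hg1 : ∀ t ∈ Icc 0 T, g' t = g' 0 + ∫ s in (0 : ℝ)..t, g'' s)
    (hg2 : IntegrableOn g'' (Ioc 0 T)) (e : H) {t : ℝ} (ht : t ∈ Ioc 0 T) :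
    inner ℝ (powConv μ g t) e = Real.Gamma (μ + 1) *
      (inner ℝ (g 0) e * fracKernel (μ + 2) t + (inner ℝ (g' 0) e * fracKernel (μ + 2 + 1) t
        + conv (fracKernel (μ + 2 + 1)) (indicator (Ioc 0 T) fun s => inner ℝ (g'' s) e) t)) := by
  have hG : 0 < Real.Gamma (μ + 1) := Real.Gamma_pos_of_pos (by linarith)
  set w := indicator (Ioc 0 T) fun s => inner ℝ (g'' s) e with hw
  have hwi : Integrable w := integrable_indicator_inner hg2 e
  have hw0 : ∀ s ≤ 0, w s = 0 := indicator_Ioc_of_nonpos _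
  have hg2' : IntegrableOn g' (Ioc 0 T) :=
    (hgc'.integrableOn_compact isCompact_Icc).mono_set Ioc_subset_Icc_self
  have h1 : inner ℝ (powConv μ g t) e
      = Real.Gamma (μ + 1)
        * conv (fracKernel (μ + 1)) (indicator (Ioc 0 T) fun s => inner ℝ (g s) e) t := by
    rw [powConv, inner_intervalIntegral_left (intervalIntegrable_sub_rpow_smul hμ ht.1.le
      (hgc.mono (Icc_subset_Icc_right ht.2))), conv_fracKernel_indicator ht, add_sub_cancel_right,
      ← mul_assoc, mul_inv_cancel₀ hG.ne', one_mul]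
    simp_rw [real_inner_smul_left]
  have h2 : ∀ᵐ s, s ≤ t → indicator (Ioc 0 T) (fun s => inner ℝ (g s) e) s
      = inner ℝ (g 0) e * fracKernel 1 s
        + (inner ℝ (g' 0) e * fracKernel (1 + 1) s + conv (fracKernel (1 + 1)) w s) := by
    refine Eventually.of_forall fun s hs => ?_
    rcases le_or_gt s 0 with h | h
    · rw [indicator_Ioc_of_nonpos _ s h, fracKernel_of_nonpos h, fracKernel_of_nonpos h,
        conv_of_nonpos (fun _ => fracKernel_of_nonpos) hw0 h]
      simp
    · have hsT : s ∈ Ioc 0 T := ⟨h, hs.trans ht.2⟩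
      rw [indicator_of_mem hsT]
      norm_num
      refine eq_taylor_conv (γ := fun s => inner ℝ (g s) e) (γ' := fun s => inner ℝ (g' s) e)
        hwi hw0 (fun r hr => ?_) (fun r hr => ?_) hsT
      · rw [inner_primitive_eq hg2 hg1 e (Ioc_subset_Icc_self hr),
          ← conv_fracKernel_one_indicator _ (Ioc_subset_Icc_self hr),
          conv_fracKernel_one hw0 hr.1.le]
      · exact inner_primitive_eq hg2' hg0 e (Ioc_subset_Icc_self hr)
  rw [h1, conv_congr_right (fun _ => fracKernel_of_nonpos) h2,
    conv_taylor (by linarith) one_pos (isFracBounded_fracKernel (by linarith)) hwi hw0,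
    conv_fracKernel (by linarith) (by norm_num), conv_fracKernel (by linarith) (by norm_num),
    show μ + 1 + 1 = μ + 2 by ring, show μ + 1 + (1 + 1) = μ + 2 + 1 by ring]

theorem inner_integral_powConv_eq {μ T : ℝ} (hμ : -1 < μ) {g g' g'' : ℝ → H}
    (hgc : ContinuousOn g (Icc 0 T)) (hgc' : ContinuousOn g' (Icc 0 T))
    (hg0 : ∀ t ∈ Icc 0 T, g t = g 0 + ∫ s in (0 : ℝ)..t, g' s)
    (hg1 : ∀ t ∈ Icc 0 T, g' t = g' 0 + ∫ s in (0 : ℝ)..t, g'' s)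
    (hg2 : IntegrableOn g'' (Ioc 0 T)) (e : H) {t : ℝ} (ht : t ∈ Icc 0 T) :
    inner ℝ (∫ s in (0 : ℝ)..t, powConv μ g s) e = Real.Gamma (μ + 1) *
      (inner ℝ (g 0) e * fracKernel (μ + 3) t + (inner ℝ (g' 0) e * fracKernel (μ + 3 + 1) t
        + conv (fracKernel (μ + 3 + 1)) (indicator (Ioc 0 T) fun s => inner ℝ (g'' s) e) t)) := by
  set w := indicator (Ioc 0 T) fun s => inner ℝ (g'' s) e with hw
  have hwi : Integrable w := integrable_indicator_inner hg2 e
  have hw0 : ∀ s ≤ 0, w s = 0 := indicator_Ioc_of_nonpos _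
  set S : ℝ → ℝ := fun t => inner ℝ (g 0) e * fracKernel (μ + 2) t
    + (inner ℝ (g' 0) e * fracKernel (μ + 2 + 1) t + conv (fracKernel (μ + 2 + 1)) w t) with hS
  have hS0 : ∀ s ≤ 0, S s = 0 := by
    intro s h
    simp only [hS]
    rw [fracKernel_of_nonpos h, fracKernel_of_nonpos h,
      conv_of_nonpos (fun _ => fracKernel_of_nonpos) hw0 h]
    simp
  have e1 : ∫ s in (0 : ℝ)..t, inner ℝ (powConv μ g s) e
      = Real.Gamma (μ + 1) * conv (fracKernel 1) S t := by
    rw [conv_fracKernel_one hS0 ht.1, ← intervalIntegral.integral_const_mul]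
    refine intervalIntegral.integral_congr_ae (Eventually.of_forall fun s hs => ?_)
    rw [uIoc_of_le ht.1] at hs
    exact inner_powConv_eq hμ hgc hgc' hg0 hg1 hg2 e ⟨hs.1, hs.2.trans ht.2⟩
  rw [inner_intervalIntegral_left (intervalIntegrable_powConv hμ hgc ht), e1, hS,
    conv_taylor one_pos (by linarith) (isFracBounded_fracKernel one_pos) hwi hw0,
    conv_fracKernel one_pos (by linarith), conv_fracKernel one_pos (by linarith),
    show 1 + (μ + 2) = μ + 3 by ring, show 1 + (μ + 2 + 1) = μ + 3 + 1 by ring]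

theorem ae_inner_caputoDeriv_eq {α T : ℝ} (h1 : α < 1) (hT : 0 ≤ T) {y : ℝ → H}
    (hy : IsAbsCont T y) (e : H) :
    ∀ᵐ t, t ∈ Ioc 0 T → inner ℝ (caputoDeriv α y t) e
      = conv (fracKernel (1 - α)) (indicator (Ioc 0 T) fun s => inner ℝ (deriv y s) e) t := by
  have hd := (intervalIntegrable_iff_integrableOn_Ioc_of_le hT).1 hy.1
  filter_upwards [(ae_intervalIntegrable_conv
    (integrableOn_rpow_Ioc (by linarith : -1 < -α) hT) hd).1] with t hi ht
  rw [caputoDeriv, real_inner_smul_left, inner_intervalIntegral_left (hi ht),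
    conv_fracKernel_indicator ht, one_div, show 1 - α - 1 = -α by ring]
  simp_rw [real_inner_smul_left]

/-- The error of the component along a vector `e` on which the elliptic operator acts as the
multiplication by `l`. -/
theorem component_error_eq {α μ l T τ : ℝ} {N : ℕ} (h0 : 0 < α) (h1 : α < 1) (hμ : -1 < μ)
    (hl : 0 ≤ l) (hτ : 0 < τ) (hT : T = N * τ) {y g g' g'' : ℝ → H} {e : H}
    (hy : IsAbsCont T y)
    (heq : ∀ᵐ t ∂(volume.restrict (Ioc 0 T)), inner ℝ (caputoDeriv α y t) e + l * inner ℝ (y t) e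
      = inner ℝ (powConv μ g t) e)
    (hgc : ContinuousOn g (Icc 0 T)) (hgc' : ContinuousOn g' (Icc 0 T))
    (hg0 : ∀ t ∈ Icc 0 T, g t = g 0 + ∫ s in (0 : ℝ)..t, g' s)
    (hg1 : ∀ t ∈ Icc 0 T, g' t = g' 0 + ∫ s in (0 : ℝ)..t, g'' s)
    (hg2 : IntegrableOn g'' (Ioc 0 T))
    {U : ℤ → ℝ} (hU : ∀ k ≤ 0, U k = 0)
    (hstep : ∀ n : ℕ, 1 ≤ n → n ≤ N →
      τ ^ (-α) * ∑ j ∈ Finset.range (n + 1), glCoeff α j * U ((n : ℤ) - (j : ℤ))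
        + (1 - α / 2) * (l * U n) + α / 2 * (l * U ((n : ℤ) - 1))
      = (1 - α / 2) * inner ℝ (∫ s in (0 : ℝ)..((n : ℝ) * τ), powConv μ g s) e
        + α / 2 * inner ℝ (∫ s in (0 : ℝ)..(((n : ℝ) - 1) * τ), powConv μ g s) e
        + (1 - α / 2) * bdf2 τ (startFun α) (n * τ) * inner ℝ (y 0) e
        + α / 2 * bdf2 τ (startFun α) (((n : ℝ) - 1) * τ) * inner ℝ (y 0) e)
    {n : ℕ} (hn1 : 1 ≤ n) (hn : n ≤ N) :
    inner ℝ (y (n * τ)) e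
        - τ⁻¹ * (3 / 2 * U n - 2 * U ((n : ℤ) - 1) + 1 / 2 * U ((n : ℤ) - 2))
      = inner ℝ (y 0) e
          * (relaxKernel α l (1 - α) (n * τ) - discreteKernel α (l * τ ^ α) (3 - α) 2 n)
        + Real.Gamma (μ + 1) * (inner ℝ (g 0) e * errorKernel α l τ (μ + 3) (n * τ)
          + (inner ℝ (g' 0) e * errorKernel α l τ (μ + 4) (n * τ)
            + ∫ s in (0 : ℝ)..n * τ, errorKernel α l τ (μ + 4) (n * τ - s)
              * inner ℝ (g'' s) e)) := by
  have hT0 : 0 ≤ T := by rw [hT]; positivity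
  have hnT : ∀ m : ℕ, m ≤ N → (m : ℝ) * τ ≤ T := fun m hm => by
    rw [hT]; exact mul_le_mul_of_nonneg_right (by exact_mod_cast hm) hτ.le
  have hn0 : 0 < (n : ℝ) * τ := mul_pos (by exact_mod_cast hn1) hτ
  have hd := (intervalIntegrable_iff_integrableOn_Ioc_of_le hT0).1 hy.1
  set v := indicator (Ioc 0 T) fun s => inner ℝ (deriv y s) e with hv
  set w := indicator (Ioc 0 T) fun s => inner ℝ (g'' s) e with hw
  have hv0 : ∀ s ≤ 0, v s = 0 := indicator_Ioc_of_nonpos _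
  have hw0 : ∀ s ≤ 0, w s = 0 := indicator_Ioc_of_nonpos _
  have hyk : ∀ t ∈ Ioc 0 T, inner ℝ (y t) e
      = inner ℝ (y 0) e * fracKernel 1 t + conv (fracKernel 1) v t := by
    intro t ht
    rw [inner_primitive_eq hd hy.2 e (Ioc_subset_Icc_self ht), fracKernel_one_of_pos ht.1, mul_one,
      hv, conv_fracKernel_one_indicator _ (Ioc_subset_Icc_self ht)]
  rw [hyk _ ⟨hn0, hnT n hn⟩]
  rw [scalar_error_eq h0 h1 hμ hl hτ hT (integrable_indicator_inner hd e) hv0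
    (integrable_indicator_inner hg2 e) hw0 ?_ hU (Φ := fun t => _) (fun t => rfl) ?_ hn]
  · congr 4
    rw [conv_eq_intervalIntegral _ hw0 hn0.le]
    · refine intervalIntegral.integral_congr_ae (Eventually.of_forall fun s hs => ?_)
      rw [uIoc_of_le hn0.le] at hs
      have hs' : s ∈ Ioc 0 T := ⟨hs.1, hs.2.trans (hnT n hn)⟩
      rw [hw, indicator_of_mem hs']
    · intro t ht
      rw [errorKernel, relaxKernel_of_nonpos ht, scaledDiscreteKernel,
        discreteKernel_of_nonpos (div_nonpos_of_nonpos_of_nonneg ht hτ.le), mul_zero, sub_zero]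
  · rw [ae_restrict_iff' measurableSet_Ioc] at heq
    filter_upwards [heq, ae_inner_caputoDeriv_eq h1 hT0 hy e] with t a1 a2 htT
    rcases le_or_gt t 0 with h | h
    · rw [conv_of_nonpos (fun _ => fracKernel_of_nonpos) hw0 h,
        conv_of_nonpos (fun _ => fracKernel_of_nonpos) hv0 h,
        conv_of_nonpos (fun _ => fracKernel_of_nonpos) hv0 h, fracKernel_of_nonpos h,
        fracKernel_of_nonpos h, fracKernel_of_nonpos h]
      simp
    · have ht : t ∈ Ioc 0 T := ⟨h, htT⟩
      rw [← inner_powConv_eq hμ hgc hgc' hg0 hg1 hg2 e ht, ← a1 ht, a2 ht, hyk t ht]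
  · intro m hm1 hm
    have e1 := inner_integral_powConv_eq hμ hgc hgc' hg0 hg1 hg2 e (t := m * τ)
      ⟨by positivity, hnT m hm⟩
    have hm' : (0 : ℝ) ≤ (m : ℝ) - 1 := by
      have : (1 : ℝ) ≤ m := by exact_mod_cast hm1
      linarith
    have e2 := inner_integral_powConv_eq hμ hgc hgc' hg0 hg1 hg2 e (t := ((m : ℝ) - 1) * τ)
      ⟨by positivity, le_trans (by nlinarith) (hnT m hm)⟩
    rw [← e1, ← e2]
    exact hstep m hm1 hm

end Component

/-! ### Diagonalization of the discrete elliptic operator -/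

/-- Simultaneous diagonalization of the inner product and of a symmetric positive form. -/
theorem exists_orthonormal_eigenvectors {V H : Type*} [AddCommGroup V] [Module ℝ V]
    [FiniteDimensional ℝ V] [NormedAddCommGroup H] [InnerProductSpace ℝ H] (ι : V →ₗ[ℝ] H)
    (hι : Function.Injective ι) (B : V →ₗ[ℝ] V →ₗ[ℝ] ℝ) (hsymm : ∀ v w, B v w = B w v)
    (hpos : ∀ v, 0 ≤ B v v) :
    ∃ (m : ℕ) (e : Fin m → V) (lam : Fin m → ℝ), (∀ i, 0 ≤ lam i) ∧
      Orthonormal ℝ (fun i => ι (e i)) ∧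
      (∀ v i, B v (e i) = lam i * inner ℝ (ι v) (ι (e i))) ∧
      ∀ v, ∑ i, inner ℝ (ι v) (ι (e i)) ^ 2 = ‖ι v‖ ^ 2 := by
  set E := LinearEquiv.ofInjective ι hι with hE
  have hEι : ∀ x : LinearMap.range ι, ι (E.symm x) = x := by
    intro x
    have := congrArg Subtype.val (E.apply_symm_apply x)
    rwa [hE, LinearEquiv.ofInjective_apply] at this
  have hEv : ∀ v, ((E v : LinearMap.range ι) : H) = ι v := fun v => by
    rw [hE, LinearEquiv.ofInjective_apply]
  set b := stdOrthonormalBasis ℝ (LinearMap.range ι) with hb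
  set T : LinearMap.range ι →ₗ[ℝ] LinearMap.range ι :=
    ∑ k, ((B.flip (E.symm (b k))).comp E.symm.toLinearMap).smulRight (b k) with hT
  have hTB : ∀ x y, inner ℝ (T x) y = B (E.symm x) (E.symm y) := by
    intro x y
    conv_rhs => rw [← b.sum_repr' y]
    simp only [hT, LinearMap.sum_apply, LinearMap.smulRight_apply, sum_inner,
      real_inner_smul_left, map_sum, map_smul, smul_eq_mul]
    exact Finset.sum_congr rfl fun k _ => mul_comm _ _
  have hTs : T.IsSymmetric := fun x y => by
    rw [hTB, hsymm, ← hTB, real_inner_comm]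
  set eb := hTs.eigenvectorBasis rfl with heb
  have heig : ∀ x i, B (E.symm x) (E.symm (eb i)) = hTs.eigenvalues rfl i * inner ℝ x (eb i) := by
    intro x i
    rw [hsymm, ← hTB, heb, hTs.apply_eigenvectorBasis rfl i, real_inner_comm]
    simp only [RCLike.ofReal_real_eq_id, id]
    rw [real_inner_smul_right]
  refine ⟨_, fun i => E.symm (eb i), hTs.eigenvalues rfl, fun i => ?_, ?_, fun v i => ?_,
    fun v => ?_⟩
  · have h1 := hpos (E.symm (eb i))
    rw [heig, real_inner_self_eq_norm_sq, eb.orthonormal.1 i] at h1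
    simpa using h1
  · simp only [hEι]
    exact eb.orthonormal.comp_linearIsometry (LinearMap.range ι).subtypeₗᵢ
  · have := heig (E v) i
    rw [E.symm_apply_apply] at this
    rw [this, hEι, ← hEv v]
    rfl
  · have := eb.sum_sq_norm_inner_left (E v)
    simp only [hEι, ← hEv v]
    rw [← Submodule.coe_norm, ← this]
    refine Finset.sum_congr rfl fun i _ => ?_
    rw [Real.norm_eq_abs, sq_abs]
    rfl

section Fem

variable {d : ℕ} {Ω : Set (Space d)}

theorem finiteDimensional_femSpace (𝒯 : Mesh Ω) : FiniteDimensional ℝ (femSpace 𝒯) := by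
  set S : Set (Space d) := ⋃ s ∈ 𝒯.complex.faces, (s : Set (Space d)) with hS
  have hSf : S.Finite := 𝒯.finite.biUnion fun s _ => s.finite_toSet
  have : Fintype S := hSf.fintype
  set R : femSpace 𝒯 →ₗ[ℝ] (S → ℝ) :=
    (LinearMap.funLeft ℝ ℝ (Subtype.val : S → Space d)).comp (femSpace 𝒯).subtype with hR
  refine Module.Finite.of_injective R ?_
  rw [← LinearMap.ker_eq_bot, LinearMap.ker_eq_bot']
  intro φ hφ
  have hv : ∀ x ∈ S, φ.1 x = 0 := fun x hx => congrFun hφ ⟨x, hx⟩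
  obtain ⟨-, h2, h3, -⟩ := φ.2
  ext x
  change φ.1 x = 0
  by_cases hx : x ∈ 𝒯.complex.space
  · obtain ⟨s, hs, hxs⟩ := Geometry.SimplicialComplex.mem_space_iff.1 hx
    obtain ⟨L, hL⟩ := h2 s hs
    have hsub : convexHull ℝ (s : Set (Space d)) ⊆ L ⁻¹' {0} := by
      refine convexHull_min (fun y hy => ?_) ((convex_singleton 0).affine_preimage L)
      rw [mem_preimage, ← hL y (subset_convexHull ℝ _ hy)]
      exact hv y (mem_biUnion hs hy)
    rw [hL x hxs]
    exact hsub hxs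
  · exact h3 x hx

theorem injective_toL2 {𝒯 : Mesh Ω} (hΩ : IsOpen Ω) :
    Function.Injective (toL2 : femSpace 𝒯 →ₗ[ℝ] L2 Ω) := by
  rw [← LinearMap.ker_eq_bot, LinearMap.ker_eq_bot']
  intro φ hφ
  obtain ⟨⟨K, hK⟩, -, -, h4⟩ := φ.2
  have h1 : φ.1 =ᵐ[volume.restrict Ω] fun _ => (0 : ℝ) := by
    have a1 := (memLp_of_mem_femSpace φ.2).coeFn_toLp
    have a2 : (memLp_of_mem_femSpace φ.2).toLp φ.1 = 0 := hφ
    rw [a2] at a1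
    exact a1.symm.trans (Lp.coeFn_zero _ _ _)
  have h2 := Measure.eqOn_open_of_ae_eq h1 hΩ hK.continuous.continuousOn continuousOn_const
  ext x
  by_cases hx : x ∈ Ω
  · exact h2 hx
  · exact h4 x hx

theorem measurable_partialDeriv (i : Fin d) (v : Space d → ℝ) : Measurable (partialDeriv i v) :=
  measurable_fderiv_apply_const ℝ v _

theorem abs_partialDeriv_le {K : NNReal} {v : Space d → ℝ} (hv : LipschitzWith K v) (i : Fin d)
    (x : Space d) : |partialDeriv i v x| ≤ K := by
  have h1 := (fderiv ℝ v x).le_opNorm (EuclideanSpace.single i 1)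
  rw [EuclideanSpace.single, PiLp.norm_single, norm_one, mul_one] at h1
  exact h1.trans (norm_fderiv_le_of_lipschitz ℝ hv)

theorem integrable_mul_mul_of_bounded {μ : Measure (Space d)} [IsFiniteMeasure μ]
    {b p q : Space d → ℝ} {M K₁ K₂ : ℝ} (hb : AEMeasurable b μ) (hbM : ∀ᵐ x ∂μ, |b x| ≤ M)
    (hp : Measurable p) (hpK : ∀ x, |p x| ≤ K₁) (hq : Measurable q) (hqK : ∀ x, |q x| ≤ K₂) :
    Integrable (fun x => b x * p x * q x) μ := by
  refine Integrable.of_bound ((hb.mul hp.aemeasurable).mul hq.aemeasurable).aestronglyMeasurable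
    (M * K₁ * K₂) ?_
  filter_upwards [hbM] with x hx
  have h1 := hpK x
  have h2 := hqK x
  have hM := (abs_nonneg _).trans hx
  have hK₁ := (abs_nonneg _).trans h1
  rw [norm_mul, norm_mul]
  simp only [Real.norm_eq_abs]
  gcongr

/-- The integrand of the bilinear form of the elliptic operator. -/
def formIntegrand (A : EllipticOperator Ω) (v w : Space d → ℝ) (x : Space d) : ℝ :=
  (∑ i, ∑ j, A.a x i j * partialDeriv j v x * partialDeriv i w x) + A.c x * v x * w x

theorem bounded_of_mem_femSpace {𝒯 : Mesh Ω} {v : Space d → ℝ} (hv : v ∈ femSpace 𝒯) :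
    ∃ C, ∀ x, |v x| ≤ C := by
  obtain ⟨⟨K, hK⟩, -, h3, -⟩ := hv
  exact (HasCompactSupport.intro 𝒯.isCompact_space h3).exists_bound_of_continuous hK.continuous

theorem integrable_formIntegrand (hΩ : Bornology.IsBounded Ω) (A : EllipticOperator Ω)
    {𝒯 : Mesh Ω} (v w : femSpace 𝒯) :
    Integrable (formIntegrand A v w) (volume.restrict Ω) := by
  have : IsFiniteMeasure (volume.restrict Ω) := ⟨by simpa using hΩ.measure_lt_top⟩
  obtain ⟨M, hM⟩ := A.bounded
  obtain ⟨C₁, hC₁⟩ := bounded_of_mem_femSpace v.2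
  obtain ⟨C₂, hC₂⟩ := bounded_of_mem_femSpace w.2
  obtain ⟨⟨K₁, hK₁⟩, -⟩ := v.2
  obtain ⟨⟨K₂, hK₂⟩, -⟩ := w.2
  refine Integrable.add (integrable_finsetSum _ fun i _ => integrable_finsetSum _ fun j _ => ?_) ?_
  · exact integrable_mul_mul_of_bounded (A.measurable_a i j) (hM.mono fun x hx => hx.1 i j)
      (measurable_partialDeriv j _) (abs_partialDeriv_le hK₁ j) (measurable_partialDeriv i _)
      (abs_partialDeriv_le hK₂ i)
  · exact integrable_mul_mul_of_bounded A.measurable_c (hM.mono fun x hx => hx.2)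
      hK₁.continuous.measurable hC₁ hK₂.continuous.measurable hC₂

theorem form_add_left (hΩ : Bornology.IsBounded Ω) (A : EllipticOperator Ω) {𝒯 : Mesh Ω}
    (v v' w : femSpace 𝒯) :
    A.form ((v + v' : femSpace 𝒯) : Space d → ℝ) w = A.form v w + A.form v' w := by
  obtain ⟨⟨K₁, hK₁⟩, -⟩ := v.2
  obtain ⟨⟨K₂, hK₂⟩, -⟩ := v'.2
  refine Eq.trans ?_ (integral_add (integrable_formIntegrand hΩ A v w)
    (integrable_formIntegrand hΩ A v' w))
  refine integral_congr_ae (ae_restrict_of_ae ?_)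
  filter_upwards [hK₁.ae_differentiableAt, hK₂.ae_differentiableAt] with x h1 h2
  have hp : ∀ j, partialDeriv j (v.1 + v'.1) x
      = partialDeriv j v x + partialDeriv j v' x := by
    intro j
    simp only [partialDeriv]
    rw [fderiv_add h1 h2]
    rfl
  simp only [hp, mul_add, add_mul, Finset.sum_add_distrib, Submodule.coe_add,
    Pi.add_apply]
  ring

theorem form_smul_left (A : EllipticOperator Ω) {𝒯 : Mesh Ω} (r : ℝ) (v w : femSpace 𝒯) :
    A.form ((r • v : femSpace 𝒯) : Space d → ℝ) w = r * A.form v w := by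
  obtain ⟨⟨K₁, hK₁⟩, -⟩ := v.2
  refine Eq.trans ?_ (integral_const_mul r (formIntegrand A v w))
  refine integral_congr_ae (ae_restrict_of_ae ?_)
  filter_upwards [hK₁.ae_differentiableAt] with x h1
  have hp : ∀ j, partialDeriv j (r • v.1) x
      = r * partialDeriv j v x := by
    intro j
    simp only [partialDeriv]
    rw [fderiv_const_smul h1]
    rfl
  simp only [formIntegrand, hp, mul_add, Finset.mul_sum, Submodule.coe_smul, Pi.smul_apply,
    smul_eq_mul]
  congr 1
  · exact Finset.sum_congr rfl fun i _ => Finset.sum_congr rfl fun j _ => by ring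
  · ring

theorem form_comm (A : EllipticOperator Ω) (v w : Space d → ℝ) : A.form v w = A.form w v := by
  refine integral_congr_ae ?_
  filter_upwards [A.symm] with x hx
  congr 1
  · rw [Finset.sum_comm]
    refine Finset.sum_congr rfl fun i _ => Finset.sum_congr rfl fun j _ => ?_
    rw [hx.apply i j]; ring
  · ring

/-- The bilinear form of the elliptic operator on the finite element space. -/
def femForm (hΩ : Bornology.IsBounded Ω) (A : EllipticOperator Ω) (𝒯 : Mesh Ω) :
    femSpace 𝒯 →ₗ[ℝ] femSpace 𝒯 →ₗ[ℝ] ℝ :=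
  LinearMap.mk₂ ℝ (fun v w => A.form v w) (form_add_left hΩ A) (form_smul_left A)
    (fun v w w' => by rw [form_comm, form_add_left hΩ, form_comm A w, form_comm A w'])
    (fun r v w => by rw [form_comm, form_smul_left, form_comm A w]; rfl)

theorem form_self_nonneg (A : EllipticOperator Ω) {𝒯 : Mesh Ω} (v : femSpace 𝒯) :
    0 ≤ A.form v v := by
  obtain ⟨κ, hκ, h⟩ := A.posDef
  obtain ⟨hK, -, -, h4⟩ := v.2
  exact (mul_nonneg hκ.le (integral_nonneg fun x => sq_nonneg _)).trans (h v hK h4)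

/-- The eigenvectors of the discrete elliptic operator. -/
theorem exists_fem_eigenvectors (hΩo : IsOpen Ω) (hΩ : Bornology.IsBounded Ω)
    (A : EllipticOperator Ω) (𝒯 : Mesh Ω) :
    ∃ (m : ℕ) (e : Fin m → femSpace 𝒯) (lam : Fin m → ℝ), (∀ i, 0 ≤ lam i) ∧
      Orthonormal ℝ (fun i => toL2 (e i)) ∧
      (∀ (v : femSpace 𝒯) i, A.form v (e i) = lam i * inner ℝ (toL2 v) (toL2 (e i))) ∧
      ∀ v : femSpace 𝒯, ∑ i, inner ℝ (toL2 v) (toL2 (e i)) ^ 2 = ‖toL2 v‖ ^ 2 := by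
  have := finiteDimensional_femSpace 𝒯
  exact exists_orthonormal_eigenvectors toL2 (injective_toL2 hΩo) (femForm hΩ A 𝒯)
    (fun v w => form_comm A v w) (form_self_nonneg A)

end Fem

/-! ### Summation over the components -/

section Duality

variable {H : Type*} [NormedAddCommGroup H] [InnerProductSpace ℝ H] {m : ℕ} {f : Fin m → H}
  {x : Fin m → ℝ} {Z : ℝ}

/-- A multiplier bounded by `K`, applied to the components of `h` and tested with a vector of
norm `Z` with components `x`: Cauchy-Schwarz and Bessel's inequality make the bound independent of
the number of components. -/
theorem abs_sum_mul_inner_le (hf : Orthonormal ℝ f) (hZ : 0 ≤ Z) (hx : ∑ i, x i ^ 2 = Z ^ 2)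
    {κ : Fin m → ℝ} {K : ℝ} (hK : 0 ≤ K) (hκ : ∀ i, |κ i| ≤ K) (h : H) :
    |∑ i, x i * (inner ℝ h (f i) * κ i)| ≤ Z * (K * ‖h‖) := by
  have h1 : ∑ i, |inner ℝ h (f i)| ^ 2 ≤ ‖h‖ ^ 2 := by
    refine le_trans (le_of_eq ?_) (hf.sum_inner_products_le h (s := Finset.univ))
    refine Finset.sum_congr rfl fun i _ => ?_
    rw [real_inner_comm, Real.norm_eq_abs]
  have h2 := Real.sum_mul_le_sqrt_mul_sqrt Finset.univ (fun i => |x i|) fun i => |inner ℝ h (f i)|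
  have h3 : √(∑ i, |x i| ^ 2) = Z := by
    simp_rw [sq_abs]; rw [hx, Real.sqrt_sq hZ]
  have h4 : √(∑ i, |inner ℝ h (f i)| ^ 2) ≤ ‖h‖ := Real.sqrt_le_iff.2 ⟨norm_nonneg _, h1⟩
  calc |∑ i, x i * (inner ℝ h (f i) * κ i)|
      ≤ ∑ i, |x i * (inner ℝ h (f i) * κ i)| := Finset.abs_sum_le_sum_abs _ _
    _ ≤ ∑ i, K * (|x i| * |inner ℝ h (f i)|) := by
        refine Finset.sum_le_sum fun i _ => ?_
        rw [abs_mul, abs_mul, ← mul_assoc, mul_comm]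
        exact mul_le_mul_of_nonneg_right (hκ i) (by positivity)
    _ = K * ∑ i, |x i| * |inner ℝ h (f i)| := by rw [Finset.mul_sum]
    _ ≤ K * (Z * ‖h‖) := by
        refine mul_le_mul_of_nonneg_left (h2.trans ?_) hK
        rw [h3]
        exact mul_le_mul_of_nonneg_left h4 hZ
    _ = Z * (K * ‖h‖) := by ring

/-- The same for a multiplier that depends on time: the sum is moved under the integral. -/
theorem abs_sum_mul_integral_inner_le (hf : Orthonormal ℝ f) (hZ : 0 ≤ Z)
    (hx : ∑ i, x i ^ 2 = Z ^ 2) {t : ℝ} (ht : 0 ≤ t) {κ : Fin m → ℝ → ℝ}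
    (hκm : ∀ i, Measurable (κ i)) {ρ : ℝ → ℝ} {h : ℝ → H}
    (hκ : ∀ i, ∀ s ∈ Ioo 0 t, |κ i s| ≤ ρ s) (hρ : ∀ s ∈ Ioo 0 t, 0 ≤ ρ s)
    (hi : IntervalIntegrable (fun s => ρ s * ‖h s‖) volume 0 t)
    (hm : AEStronglyMeasurable h (volume.restrict (Ioo 0 t))) :
    |∑ i, x i * ∫ s in (0 : ℝ)..t, κ i s * inner ℝ (h s) (f i)|
      ≤ Z * ∫ s in (0 : ℝ)..t, ρ s * ‖h s‖ := by
  rw [intervalIntegrable_iff_integrableOn_Ioo_of_le ht] at hi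
  have hint : ∀ i, IntegrableOn (fun s => κ i s * inner ℝ (h s) (f i)) (Ioo 0 t) := by
    intro i
    refine hi.mono' ((hκm i).aestronglyMeasurable.mul (hm.inner_const)) ?_
    rw [ae_restrict_iff' measurableSet_Ioo]
    refine Eventually.of_forall fun s hs => ?_
    rw [norm_mul, Real.norm_eq_abs]
    refine mul_le_mul (hκ i s hs) ((norm_inner_le_norm _ _).trans (le_of_eq ?_)) (norm_nonneg _)
      (hρ s hs)
    rw [hf.1 i, mul_one]
  simp_rw [intervalIntegral.integral_of_le ht, integral_Ioc_eq_integral_Ioo, ← integral_const_mul]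
  rw [← integral_finsetSum _ fun i _ => (hint i).const_mul (x i), ← Real.norm_eq_abs]
  refine norm_integral_le_of_norm_le (hi.const_mul Z) ?_
  rw [ae_restrict_iff' measurableSet_Ioo]
  refine Eventually.of_forall fun s hs => ?_
  rw [Real.norm_eq_abs]
  simp_rw [mul_comm (κ _ s)]
  exact abs_sum_mul_inner_le hf hZ hx (hρ s hs) (fun i => hκ i s hs) (h s)

end Duality

/-! ### The error estimate -/

section Estimate

variable {E : Type*} [NormedAddCommGroup E]

/-- The weight in the assumption on `g''` is bounded below, so `g''` is integrable. -/
theorem integrableOn_of_intervalIntegrable_rpow_mul {T r : ℝ} (hT : 0 < T) (hr : r ≤ 0) {h : ℝ → E}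
    (hm : AEStronglyMeasurable h (volume.restrict (Ioo 0 T)))
    (hi : IntervalIntegrable (fun s => (T - s) ^ r * ‖h s‖) volume 0 T) :
    IntegrableOn h (Ioo 0 T) := by
  rw [intervalIntegrable_iff_integrableOn_Ioo_of_le hT.le] at hi
  refine (hi.const_mul (T ^ (-r))).mono' hm ?_
  rw [ae_restrict_iff' measurableSet_Ioo]
  refine Eventually.of_forall fun s hs => ?_
  have h1 : T ^ r ≤ (T - s) ^ r :=
    Real.rpow_le_rpow_of_nonpos (sub_pos.2 hs.2) (by linarith [hs.1]) hr
  calc ‖h s‖ = T ^ (-r) * T ^ r * ‖h s‖ := by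
        rw [← Real.rpow_add hT, neg_add_cancel, Real.rpow_zero, one_mul]
    _ ≤ T ^ (-r) * (T - s) ^ r * ‖h s‖ := by gcongr
    _ = _ := by ring

/-- The weight in the error bound is a bounded multiple of the weight in the assumption on `g''`. -/
theorem intervalIntegrable_rpow_mul_of_min {t r : ℝ} (ht : 0 < t) {h : ℝ → E}
    (hm : AEStronglyMeasurable h (volume.restrict (Ioo 0 t)))
    (hi : IntervalIntegrable (fun s => (t - s) ^ min r 0 * ‖h s‖) volume 0 t) :
    IntervalIntegrable (fun s => (t - s) ^ r * ‖h s‖) volume 0 t := by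
  rw [intervalIntegrable_iff_integrableOn_Ioo_of_le ht.le] at hi ⊢
  refine (hi.const_mul (t ^ (r - min r 0))).mono' ?_ ?_
  · exact (Measurable.aestronglyMeasurable (by fun_prop)).mul hm.norm
  rw [ae_restrict_iff' measurableSet_Ioo]
  refine Eventually.of_forall fun s hs => ?_
  have hts : 0 < t - s := sub_pos.2 hs.2
  rw [Real.norm_of_nonneg (by positivity), ← mul_assoc]
  refine mul_le_mul_of_nonneg_right ?_ (norm_nonneg _)
  have h1 : (t - s) ^ (r - min r 0) ≤ t ^ (r - min r 0) :=
    Real.rpow_le_rpow hts.le (by linarith [hs.1]) (by linarith [min_le_left r 0])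
  calc (t - s) ^ r = (t - s) ^ (r - min r 0) * (t - s) ^ min r 0 := by
        rw [← Real.rpow_add hts, sub_add_cancel]
    _ ≤ _ := by gcongr

end Estimate

theorem measurable_errorKernel {α l τ b : ℝ} (h0 : 0 < α) (hl : 0 ≤ l) (hb : 1 < b) :
    Measurable (errorKernel α l τ b) :=
  (measurable_relaxKernel h0 hl (by linarith)).sub (continuous_scaledDiscreteKernel hb).measurable

theorem weighted_sum_le {c₀ c₁ c₂ G a b p q : ℝ} (h₀ : 0 ≤ c₀) (h₁ : 0 ≤ c₁) (h₂ : 0 ≤ c₂)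
    (hG : 0 ≤ G) (ha : 0 ≤ a) (hb : 0 ≤ b) (hp : 0 ≤ p) (hq : 0 ≤ q) :
    c₀ * a + G * c₁ * b + G * c₂ * (p + q) ≤ (c₀ + G * (c₁ + c₂) + 1) * (a + b + p + q) := by
  have e1 : 0 ≤ G * c₁ := by positivity
  have e2 : 0 ≤ G * c₂ := by positivity
  have f1 : 0 ≤ (G * c₁ + G * c₂ + 1) * a := by positivity
  have f2 : 0 ≤ (c₀ + G * c₂ + 1) * b := by positivity
  have f3 : 0 ≤ (c₀ + G * c₁ + 1) * (p + q) := by positivity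
  linarith

end SubDiffusion

end

theorem mainTheorem6 (α μ : ℝ) (hα0 : 0 < α) (hα1 : α < 1) (hμ : -1 < μ) :
    ∃ c : ℝ, 0 < c ∧
      ∀ (d : ℕ) (_hd : d = 1 ∨ d = 2)
        (Ω : Set (Space d)) (_hΩo : IsOpen Ω) (_hΩc : IsConnected Ω)
        (_hΩb : Bornology.IsBounded Ω)
        (A : EllipticOperator Ω) (𝒯 : Mesh Ω) (T : ℝ) (_hT : 0 < T)
        (u0 : L2 Ω) (g g' g'' : ℝ → L2 Ω)
        (_hg : IsW1Inf T g g') (_hg' : HasWeakDeriv T g' g'')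
        (_hgc : ContinuousOn g (Set.Icc 0 T)) (_hgc' : ContinuousOn g' (Set.Icc 0 T))
        (_hg'' : ∀ t ∈ Set.Ioc 0 T, IntervalIntegrable
          (fun ζ => (t - ζ) ^ min (α + μ) 0 * ‖g'' ζ‖) MeasureTheory.volume 0 t)
        (u : ℝ → femSpace 𝒯)
        (_hu : IsSemidiscreteSolution A α T u0 (powConv μ g) u)
        (N : ℕ) (_hN : 1 ≤ N) (τ : ℝ) (_hτ : τ = T / N)
        (U : ℤ → femSpace 𝒯) (ut : ℕ → femSpace 𝒯)
        (_hU : IsCrankNicolsonSolution A α τ N (u 0) (powConv μ g) U ut)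
        (n : ℕ) (_hn1 : 1 ≤ n) (_hnN : n ≤ N) (t_n : ℝ) (_htn : t_n = n * τ),
        ‖toL2 (u t_n) - toL2 (ut n)‖ ≤
          c * τ ^ 2 * (t_n ^ (-2 : ℝ) * ‖u0‖ + t_n ^ (α + μ - 1) * ‖g 0‖
            + t_n ^ (α + μ) * ‖g' 0‖
            + ∫ ζ in (0 : ℝ)..t_n, (t_n - ζ) ^ (α + μ) * ‖g'' ζ‖) := by
  obtain ⟨C₀, hC₀, k₀⟩ := exists_abs_startError_le hα0 hα1
  obtain ⟨C₁, hC₁, k₁⟩ := exists_abs_errorKernel_le (b := μ + 3) hα0 hα1 (by linarith)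
  obtain ⟨C₂, hC₂, k₂⟩ := exists_abs_errorKernel_le (b := μ + 4) hα0 hα1 (by linarith)
  have hG : 0 < Real.Gamma (μ + 1) := Real.Gamma_pos_of_pos (by linarith)
  set G := Real.Gamma (μ + 1) with hGdef
  refine ⟨C₀ + G * (C₁ + C₂) + 1, by positivity, ?_⟩
  intro d _ Ω hΩo _ hΩb A 𝒯 T hT u0 g g' g'' hg hg' hgc hgc' hg'' u hu N hN τ hτdef U ut hU n hn1
    hnN t htdef
  have hN0 : (0 : ℝ) < N := by exact_mod_cast hN
  have hτ : 0 < τ := by rw [hτdef]; positivity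
  have hTN : T = N * τ := by rw [hτdef]; field_simp
  have ht : 0 < t := by rw [htdef]; exact mul_pos (by exact_mod_cast hn1) hτ
  have htT : t ≤ T := by
    rw [htdef, hTN]; exact mul_le_mul_of_nonneg_right (by exact_mod_cast hnN) hτ.le
  -- Taylor's formula for `g`.
  have hm2 : AEStronglyMeasurable g'' (volume.restrict (Ioo 0 T)) := hg'.2.1.aestronglyMeasurable
  have hi2 : IntegrableOn g'' (Ioo 0 T) := integrableOn_of_intervalIntegrable_rpow_mul hT
    (min_le_right (α + μ) 0) hm2 (hg'' T ⟨hT, le_rfl⟩)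
  have hi1 : IntegrableOn g' (Ioo 0 T) :=
    (hgc'.integrableOn_compact isCompact_Icc).mono_set Ioo_subset_Icc_self
  have hT0 : ∀ s ∈ Icc 0 T, g s = g 0 + ∫ r in (0 : ℝ)..s, g' r := fun s hs =>
    hg.2.2.eq_add_integral hT hgc hi1 hs
  have hT1 : ∀ s ∈ Icc 0 T, g' s = g' 0 + ∫ r in (0 : ℝ)..s, g'' r := fun s hs =>
    hg'.eq_add_integral hT hgc' hi2 hs
  -- The components of the error along the eigenvectors of the discrete operator.
  obtain ⟨m, e, lam, hlam, horth, heig, hpars⟩ := exists_fem_eigenvectors hΩo hΩb A 𝒯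
  set z := u t - ut n with hz
  set x : Fin m → ℝ := fun i => inner ℝ (toL2 z) (toL2 (e i)) with hx
  set κ₀ : Fin m → ℝ := fun i => relaxKernel α (lam i) (1 - α) t
    - discreteKernel α (lam i * τ ^ α) (3 - α) 2 n with hκ₀
  have hcomp : ∀ i, x i = inner ℝ u0 (toL2 (e i)) * κ₀ i
      + G * (inner ℝ (g 0) (toL2 (e i)) * errorKernel α (lam i) τ (μ + 3) t
        + (inner ℝ (g' 0) (toL2 (e i)) * errorKernel α (lam i) τ (μ + 4) t
          + ∫ s in (0 : ℝ)..t, errorKernel α (lam i) τ (μ + 4) (t - s)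
            * inner ℝ (g'' s) (toL2 (e i)))) := by
    intro i
    have key := component_error_eq (N := N) (n := n) (l := lam i) (e := toL2 (e i))
      (U := fun k => inner ℝ (toL2 (U k)) (toL2 (e i))) hα0 hα1 hμ (hlam i) hτ hTN hu.absCont
      (hu.eqn.mono fun s hs => by rw [← hs (e i), heig]) hgc hgc' hT0 hT1
      ((integrableOn_Ioc_iff_integrableOn_Ioo (by simp)).2 hi2)
      (fun k hk => by simp [hU.start k hk]) (fun k hk1 hk => ?_) hn1 hnN
    · rw [← htdef] at key
      rw [hu.initial (e i)] at key
      rw [← key, hx, hz]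
      simp only [map_sub, inner_sub_left, hU.recover n hn1 hnN, map_smul, map_add,
        real_inner_smul_left, inner_add_left]
    · have h := hU.step k hk1 hk (e i)
      rw [heig, heig, map_sum, sum_inner] at h
      simp only [map_smul, real_inner_smul_left] at h
      exact h
  -- The norm of the error is estimated by testing the error with itself; a bound for each component
  -- separately would bring in the dimension of the finite element space.
  set Z := ‖toL2 z‖ with hZ
  have hZ0 : 0 ≤ Z := norm_nonneg _
  have hxZ : ∑ i, x i ^ 2 = Z ^ 2 := hpars z
  have b₀ := abs_sum_mul_inner_le horth hZ0 hxZ (κ := κ₀) (K := C₀ * τ ^ 2 * t ^ (-2 : ℝ))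
    (by positivity) (fun i => by
      have := k₀ (lam i) (hlam i) τ hτ n hn1
      rwa [← htdef] at this) u0
  have b₁ := abs_sum_mul_inner_le horth hZ0 hxZ (κ := fun i => errorKernel α (lam i) τ (μ + 3) t)
    (K := C₁ * τ ^ 2 * t ^ (α + μ - 1)) (by positivity) (fun i => by
      have := k₁ (lam i) (hlam i) τ hτ t ht
      rwa [show α + (μ + 3) - 4 = α + μ - 1 by ring] at this) (g 0)
  have hk₂ : ∀ i, ∀ s : ℝ, 0 < s →
      |errorKernel α (lam i) τ (μ + 4) s| ≤ C₂ * τ ^ 2 * s ^ (α + μ) := by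
    intro i s hs
    have := k₂ (lam i) (hlam i) τ hτ s hs
    rwa [show α + (μ + 4) - 4 = α + μ by ring] at this
  have b₂ := abs_sum_mul_inner_le horth hZ0 hxZ (κ := fun i => errorKernel α (lam i) τ (μ + 4) t)
    (K := C₂ * τ ^ 2 * t ^ (α + μ)) (by positivity) (fun i => hk₂ i t ht) (g' 0)
  have hmt : AEStronglyMeasurable g'' (volume.restrict (Ioo 0 t)) :=
    hm2.mono_measure (Measure.restrict_mono (Ioo_subset_Ioo_right htT) le_rfl)
  have hint := intervalIntegrable_rpow_mul_of_min ht hmt (hg'' t ⟨ht, htT⟩)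
  have b₃ := abs_sum_mul_integral_inner_le (h := g'') horth hZ0 hxZ ht.le
    (κ := fun i s => errorKernel α (lam i) τ (μ + 4) (t - s))
    (ρ := fun s => C₂ * τ ^ 2 * (t - s) ^ (α + μ))
    (fun i => (measurable_errorKernel hα0 (hlam i) (by linarith)).comp (by fun_prop))
    (fun i s hs => hk₂ i _ (sub_pos.2 hs.2))
    (fun s hs => by
      have := sub_pos.2 hs.2
      positivity)
    (by simpa only [mul_assoc (C₂ * τ ^ 2)] using hint.const_mul (C₂ * τ ^ 2)) hmt
  simp only [mul_assoc (C₂ * τ ^ 2)] at b₃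
  rw [intervalIntegral.integral_const_mul] at b₃
  set I := ∫ s in (0 : ℝ)..t, (t - s) ^ (α + μ) * ‖g'' s‖ with hI
  have hI0 : 0 ≤ I := intervalIntegral.integral_nonneg ht.le fun s hs => by
    have := sub_nonneg.2 hs.2
    positivity
  set Q := t ^ (-2 : ℝ) * ‖u0‖ + t ^ (α + μ - 1) * ‖g 0‖ + t ^ (α + μ) * ‖g' 0‖ + I with hQ
  have hmain : Z * Z ≤ Z * ((C₀ + G * (C₁ + C₂) + 1) * τ ^ 2 * Q) := by
    have hsum : Z * Z = ∑ i, x i * (inner ℝ u0 (toL2 (e i)) * κ₀ i)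
        + G * (∑ i, x i * (inner ℝ (g 0) (toL2 (e i)) * errorKernel α (lam i) τ (μ + 3) t)
          + (∑ i, x i * (inner ℝ (g' 0) (toL2 (e i)) * errorKernel α (lam i) τ (μ + 4) t)
            + ∑ i, x i * ∫ s in (0 : ℝ)..t, errorKernel α (lam i) τ (μ + 4) (t - s)
              * inner ℝ (g'' s) (toL2 (e i)))) := by
      rw [← sq, ← hxZ]
      simp only [← Finset.sum_add_distrib, Finset.mul_sum]
      refine Finset.sum_congr rfl fun i _ => ?_
      rw [sq]
      nth_rw 2 [hcomp i]
      ring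
    have hA : 0 ≤ t ^ (-2 : ℝ) * ‖u0‖ := by positivity
    have hB : 0 ≤ t ^ (α + μ - 1) * ‖g 0‖ := by positivity
    have hC : 0 ≤ t ^ (α + μ) * ‖g' 0‖ := by positivity
    rw [hsum]
    calc _ ≤ Z * (C₀ * τ ^ 2 * t ^ (-2 : ℝ) * ‖u0‖)
          + G * (Z * (C₁ * τ ^ 2 * t ^ (α + μ - 1) * ‖g 0‖)
            + (Z * (C₂ * τ ^ 2 * t ^ (α + μ) * ‖g' 0‖) + Z * (C₂ * τ ^ 2 * I))) := by
          gcongr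
          · exact (le_abs_self _).trans b₀
          · exact (le_abs_self _).trans b₁
          · exact (le_abs_self _).trans b₂
          · exact (le_abs_self _).trans b₃
      _ = Z * (τ ^ 2 * (C₀ * (t ^ (-2 : ℝ) * ‖u0‖) + G * C₁ * (t ^ (α + μ - 1) * ‖g 0‖)
            + G * C₂ * (t ^ (α + μ) * ‖g' 0‖ + I))) := by ring
      _ ≤ Z * (τ ^ 2 * ((C₀ + G * (C₁ + C₂) + 1) * Q)) := by
          gcongr
          exact weighted_sum_le hC₀ hC₁ hC₂ hG.le hA hB hC hI0
      _ = _ := by ring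
  rw [← map_sub]
  rcases hZ0.eq_or_lt with h | h
  · rw [← hz, ← hZ, ← h]; positivity
  · exact le_of_mul_le_mul_left hmain h
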